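/- Let $\varphi\in C^\infty(\mathbb R)$ with $\varphi''>0$ everywhere, put $c=\varphi''(0)$, and let $$\Lambda(\xi,\tau)=\int_{-\infty}^{\infty}\exp(-2s^4+\tau s^2-\xi s)\,ds,\qquad w_{1,0}(\xi,\tau)=-\frac{2}{c\,\Lambda(\xi,\tau)}\frac{\partial\Lambda(\xi,\tau)}{\partial\xi}.$$ Let $H=H(\xi,\tau)$ be the Whitney fold function: the real root of $H^3-\tau H+\xi=0$ that is the smallest root if $\xi>0$ and the largest root if $\xi\le 0$ (for $\xi\neq0$ it is the unique root of sign opposite to $\xi$). Put $D=3H^2-\tau$. (1) There are polynomials $P_l$ in three variables with real coefficients, $l\ge1$, such that $P_l$ is homogeneous of degree $1-4l$ when its variables are given the weights $1,2,-2$, and such that the functions $h_{1-4l}(\xi,\tau)=P_l\big(H,\tau,D^{-1}\big)$ (polynomials in $H$, $\tau$, $(3H^2-\tau)^{-1}$, homogeneous of degree $1-4l$ in $H,\sqrt{-\tau},\sqrt{3H^2-\tau}$) give a full asymptotic expansion $$w_{1,0}=\frac{H}{c}+\sum_{l=1}^{\infty}h_{1-4l},\qquad 3H^2-\tau\to\infty,\quad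 (\xi,\tau)\in\Omega_1=\mathbb R^2\setminus\{|\xi|<\tau^{\gamma_1-1/2},\ \tau>0\},$$ for every $0<\gamma_1<2$. That is, for every $\gamma_1\in(0,2)$ and every $N\ge0$, $$w_{1,0}-\frac Hc-\sum_{l=1}^{N}h_{1-4l}=O\big(D^{(1-4(N+1))/2}\big)\quad\text{as } D\to\infty,$$ uniformly for $(\xi,\tau)\in\Omega_1$. (2) There are functions $q_k\in C^\infty(\mathbb R)$, $k\ge0$, with $q_0(z)=-\tanh(z)/c$, which solve the recurrence system of ordinary differential equations $$q_{k+1}''-2c\sum_{i+j=k+1}q_i\,q_j'=(2-8k)\,q_k+2z\,q_k',\qquad k\ge0,$$ satisfy $|q_k(z)|\le M_k(1+|z|^k)$ for $k\ge1$ with constants $M_k$, and, with $z=\xi\sqrt\tau/2$, give an asymptotic expansion $$w_{1,0}=\sqrt\tau\Big(-\frac{\tanh z}{c}+\sum_{k=1}^{\infty}\tau^{-2k}q_k(z)\Big),\qquad \tau\to+\infty,\quad(\xi,\tau)\in\Omega_2=\{\tau>0,\ |\xi|\tau^{1/2}<\tau^{\gamma_2}\},$$ for all $0<\gamma_1<\gamma_2<2$.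 That is, for all such $\gamma_1,\gamma_2$ and every $N\ge0$, $$w_{1,0}-\sqrt\tau\Big(-\frac{\tanh z}{c}+\sum_{k=1}^{N}\tau^{-2k}q_k(z)\Big)=O\Big(\sqrt\tau\,\tau^{-2(N+1)}\big(1+|z|^{N+1}\big)\Big)\quad\text{as }\tau\to+\infty,$$ uniformly for $(\xi,\tau)\in\Omega_2$. -/

import Mathlib

open Filter Asymptotics
open scoped ContDiff

/-- The real-valued analogue of the Pearcey function,
`Λ(ξ,τ) = ∫ exp(-2 s⁴ + τ s² - ξ s) ds` over the real line. -/
noncomputable def pearceyIntegral (ξ τ : ℝ) : ℝ :=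
  ∫ s : ℝ, Real.exp (-2 * s ^ 4 + τ * s ^ 2 - ξ * s)

/-- The leading inner coefficient `w_{1,0}`, i.e. the Cole–Hopf transform
`-2 / (φ''(0) Λ) · ∂Λ/∂ξ` of `Λ`. -/
noncomputable def leadingTerm (φ : ℝ → ℝ) (ξ τ : ℝ) : ℝ :=
  -(2 / (iteratedDeriv 2 φ 0 * pearceyIntegral ξ τ)) *
    deriv (fun x : ℝ => pearceyIntegral x τ) ξ

/-- The Whitney fold function `H(ξ,τ)`: the real root of `H³ - τ H + ξ = 0` lying on the outer
sheet, that is the smallest root for `ξ > 0` and the largest root for `ξ ≤ 0`.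
For `ξ ≠ 0` it is the only root whose sign is opposite to that of `ξ`. -/
noncomputable def whitneyFold (ξ τ : ℝ) : ℝ :=
  if 0 < ξ then sInf {h : ℝ | h ^ 3 - τ * h + ξ = 0}
  else sSup {h : ℝ | h ^ 3 - τ * h + ξ = 0}

/-- For `ξ > 0` the smallest root exists and is negative. -/
theorem whitneyFold_exists_isLeast {ξ : ℝ} (hξ : 0 < ξ) (τ : ℝ) :
    ∃ h : ℝ, h < 0 ∧ IsLeast {h : ℝ | h ^ 3 - τ * h + ξ = 0} h := by
  obtain ⟨h, ⟨-, hle⟩, hh⟩ :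
      (0 : ℝ) ∈ (fun h : ℝ => h ^ 3 - τ * h + ξ) '' Set.Icc (-(1 + |τ| + ξ)) 0 := by
    apply intermediate_value_Icc (by have := abs_nonneg τ; linarith) (by fun_prop)
    refine ⟨?_, by simpa using hξ.le⟩
    have h1 := abs_nonneg τ
    have h2 := le_abs_self τ
    have h3 : τ * (1 + |τ| + ξ) ≤ |τ| * (1 + |τ| + ξ) :=
      mul_le_mul_of_nonneg_right h2 (by linarith)
    have h4 : (|τ| + ξ) * (1 + |τ| + ξ) ≤ (1 + |τ| + ξ) ^ 3 := by
      have h5 : (0 : ℝ) ≤ (1 + |τ| + ξ) := by linarith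
      have h6 : |τ| + ξ ≤ (1 + |τ| + ξ) ^ 2 := by nlinarith
      calc (|τ| + ξ) * (1 + |τ| + ξ) ≤ (1 + |τ| + ξ) ^ 2 * (1 + |τ| + ξ) :=
            mul_le_mul_of_nonneg_right h6 h5
        _ = _ := by ring
    have h7 : 0 ≤ ξ * (|τ| + ξ) := by positivity
    nlinarith
  simp only at hh
  have hneg : h < 0 := lt_of_le_of_ne hle (by rintro rfl; norm_num at hh; linarith)
  refine ⟨h, hneg, hh, ?_⟩
  intro g hg
  simp only [Set.mem_ofPred_eq] at hg
  by_contra! hlt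
  have hp : 0 < g ^ 2 + g * h := by nlinarith
  have hq : 0 < τ * h - h ^ 3 := by linarith
  have hr : τ < h ^ 2 := by nlinarith
  have h8 : (g - h) * (g ^ 2 + g * h + h ^ 2 - τ) = 0 := by linear_combination hg - hh
  rcases mul_eq_zero.1 h8 with h9 | h9 <;> linarith

/-- The fold function solves `H³ - τ H + ξ = 0`. -/
theorem whitneyFold_root (ξ τ : ℝ) :
    whitneyFold ξ τ ^ 3 - τ * whitneyFold ξ τ + ξ = 0 := by
  unfold whitneyFold
  split_ifs with hξ
  · obtain ⟨h, -, hh⟩ := whitneyFold_exists_isLeast hξ τ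
    rw [hh.csInf_eq]; exact hh.1
  · rcases lt_or_eq_of_le (not_lt.1 hξ) with h0 | rfl
    · obtain ⟨h, -, hh, hm⟩ := whitneyFold_exists_isLeast (neg_pos.2 h0) τ
      have hg : IsGreatest {h : ℝ | h ^ 3 - τ * h + ξ = 0} (-h) := by
        simp only [Set.mem_ofPred_eq] at hh
        refine ⟨by simp only [Set.mem_ofPred_eq]; linear_combination -hh, fun g hg => ?_⟩
        simp only [Set.mem_ofPred_eq] at hg
        have : h ≤ -g := hm (by simp only [Set.mem_ofPred_eq]; linear_combination -hg)
        linarith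
      rw [hg.csSup_eq]; exact hg.1
    · have hg : IsGreatest {h : ℝ | h ^ 3 - τ * h + 0 = 0} (√τ) := by
        constructor
        · simp only [Set.mem_ofPred_eq]
          rcases le_total 0 τ with h | h
          · linear_combination √τ * Real.sq_sqrt h
          · simp [Real.sqrt_eq_zero_of_nonpos h]
        · intro g hg
          simp only [Set.mem_ofPred_eq] at hg
          have h1 : g * (g ^ 2 - τ) = 0 := by linear_combination hg
          rcases mul_eq_zero.1 h1 with h2 | h2
          · rw [h2]; exact Real.sqrt_nonneg _
          · exact Real.le_sqrt_of_sq_le (by linarith)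
      rw [hg.csSup_eq]; exact hg.1

/-- The quantity `3 H² - τ`, half the absolute value of the second derivative of the phase
`-2 s⁴ + τ s² - ξ s` at its critical point `s = H / 2`. -/
noncomputable def foldDiscr (ξ τ : ℝ) : ℝ := 3 * whitneyFold ξ τ ^ 2 - τ

/-- The region `Ω₁`, the plane without `{|ξ| < τ^(γ₁ - 1/2), τ > 0}`; points are `(ξ, τ)`. -/
def regionOne (γ₁ : ℝ) : Set (ℝ × ℝ) :=
  {p : ℝ × ℝ | |p.1| < p.2 ^ (γ₁ - 1 / 2) ∧ 0 < p.2}ᶜ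

/-- The region `Ω₂ = {|ξ| τ^(1/2) < τ^γ₂}` in the half-plane `τ > 0`; points are `(ξ, τ)`. -/
def regionTwo (γ₂ : ℝ) : Set (ℝ × ℝ) :=
  {p : ℝ × ℝ | 0 < p.2 ∧ |p.1| * √p.2 < p.2 ^ γ₂}

/-- The function of `(ξ, τ)` obtained by inserting `H`, `τ` and `(3 H² - τ)⁻¹` for the three
variables of a polynomial. -/
noncomputable def foldEval (P : MvPolynomial (Fin 3) ℝ) (ξ τ : ℝ) : ℝ :=
  MvPolynomial.eval ![whitneyFold ξ τ, τ, (foldDiscr ξ τ)⁻¹] P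

/-- Homogeneity of degree `d` in `H`, `√(-τ)` and `√(3 H² - τ)` of a polynomial in `H`, `τ` and
`(3 H² - τ)⁻¹`: the three variables have the weights `1`, `2` and `-2`. -/
def IsFoldHomogeneous (P : MvPolynomial (Fin 3) ℝ) (d : ℤ) : Prop :=
  MvPolynomial.IsWeightedHomogeneous (![1, 2, -2] : Fin 3 → ℤ) P d

/-- The recurrence system of ordinary differential equations for `q₁, q₂, …` (starting from a given
`q₀`): equality of the coefficients at `τ^(3/2 - 2(k+1))` after substituting
`w = √τ ∑ τ^(-2k) q_k(z)`, `z = ξ √τ / 2`, into `∂w/∂τ + c w ∂w/∂ξ - ∂²w/∂ξ² = 0`,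
multiplied by `4`. The unknown `q_{k+1}` enters linearly. -/
def SolvesRecurrence (c : ℝ) (q : ℕ → ℝ → ℝ) : Prop :=
  ∀ (k : ℕ) (z : ℝ),
    iteratedDeriv 2 (q (k + 1)) z
      - 2 * c * ∑ ij ∈ Finset.HasAntidiagonal.antidiagonal (k + 1), q ij.1 z * deriv (q ij.2) z
    = (2 - 8 * (k : ℝ)) * q k z + 2 * z * deriv (q k) z

/-! The Cole–Hopf transform equals `2 / c` times the mean position `⟨s⟩` for the probability density
proportional to `exp (-(2 s⁴ - τ s² + ξ s))` (`leadingTerm_eq`). Both expansions therefore concern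
moments of a one-dimensional Gibbs measure, and the main tool is integration by parts, `⟨p Q'⟩ =
⟨p'⟩` for every polynomial `p` (`gibbsMean_mul_derivative`).

Outer region. Centring at the critical point `H / 2` turns the phase into `D u² + 4 H u³ + 2 u⁴`,
and the mean becomes `H / 2 + ⟨u⟩`. Integration by parts expresses the moment of order `k + 1`
through those of orders `k - 1`, `k + 2`, `k + 3`. Since `|H| ≤ √D`, iterating this gives a full
expansion as soon as `⟨uᵏ⟩ = O(D^(-k/2))`. That bound holds uniformly on `Ω₁` because the phase
factors as `u² (2 (u + H)² + (H² - τ))`, and `H² - τ ≥ D^(γ₁-1) / 10` there: the competing well is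
high enough to contribute only a stretched exponential (`rpow_le_of_mem_regionOne`,
`foldPotential_lower_bound`). Parity removes every second term, so the degrees drop by `4`.

Inner region. Rescaling by `√τ / 2` gives the double well `(T / 8) (s² - 1)² + z s` with `T = τ²`.
Its mean `m(z, T)` satisfies `m' = m² - ⟨s²⟩` in `z`. Integration by parts closes this equation: to
every order in `(1 + |z|) / T`, `⟨s²⟩` is affine in `m` with coefficients explicit in `z`
(`exists_abs_wellMoment_sub_le`). Solving the resulting Riccati equation order by order, with `m(0)
= 0` by symmetry, yields `-tanh` and its corrections. The error of a partial sum solves a linear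
equation with coefficient at most `1/4 - tanh z` for `z ≥ 0`, and a barrier function controls it
uniformly (`exists_abs_wellMean_sub_innerSum_le`).

Recurrence. The partition function solves a heat-type equation, so the `T`-derivative of `∫₀ᶻ m` is
a combination of `⟨s²⟩` and `m`, which have expansions of their own. A function and its derivative
that both have expansions in `1 / T` must have matching coefficients
(`HasInvExpansion.deriv_coeff`). This identifies the coefficients of `⟨s²⟩` up to a constant in `z`,
and differentiating the Riccati equation once in `z` gives the stated system. -/

section GibbsMean

/-! ### Gibbs means of polynomials and the Cole–Hopf transform as a mean position. -/

open MeasureTheory Polynomial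

/-- A polynomial potential that grows at least quadratically. -/
def IsConfining (Q : ℝ[X]) : Prop :=
  ∃ b > 0, ∃ K : ℝ, ∀ s : ℝ, b * s ^ 2 - K ≤ Q.eval s

theorem integrable_eval_mul_exp_neg_mul_sq (p : ℝ[X]) {b : ℝ} (hb : 0 < b) :
    Integrable fun s : ℝ => p.eval s * Real.exp (-b * s ^ 2) := by
  induction p using Polynomial.induction_on' with
  | add p q hp hq =>
    refine (hp.add hq).congr (ae_of_all _ fun s => ?_)
    simp [add_mul]
  | monomial n a =>
    have h := (integrable_rpow_mul_exp_neg_mul_sq hb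
      (s := n) (by have : (0 : ℝ) ≤ n := n.cast_nonneg
                   linarith)).const_mul a
    refine h.congr (ae_of_all _ fun s => ?_)
    simp [mul_assoc]

theorem IsConfining.integrable {Q : ℝ[X]} (hQ : IsConfining Q) (p : ℝ[X]) :
    Integrable fun s : ℝ => p.eval s * Real.exp (-Q.eval s) := by
  obtain ⟨b, hb, K, hK⟩ := hQ
  refine ((integrable_eval_mul_exp_neg_mul_sq p hb).const_mul (Real.exp K)).mono
    (by fun_prop) (ae_of_all _ fun s => ?_)
  rw [norm_mul, norm_mul, norm_mul, mul_left_comm, Real.norm_eq_abs (Real.exp _),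
    Real.norm_eq_abs (Real.exp _), Real.norm_eq_abs (Real.exp _), Real.abs_exp, Real.abs_exp,
    Real.abs_exp, ← Real.exp_add]
  gcongr
  linarith [hK s]

theorem IsConfining.integrable_exp {Q : ℝ[X]} (hQ : IsConfining Q) :
    Integrable fun s : ℝ => Real.exp (-Q.eval s) := by
  simpa using hQ.integrable 1

theorem IsConfining.partition_pos {Q : ℝ[X]} (hQ : IsConfining Q) :
    0 < ∫ s : ℝ, Real.exp (-Q.eval s) := by
  rw [integral_pos_iff_support_of_nonneg (fun s => (Real.exp_pos _).le) hQ.integrable_exp]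
  have : (Function.support fun s : ℝ => Real.exp (-Q.eval s)) = Set.univ := by
    ext s; simp [Real.exp_ne_zero]
  simp [this]

/-- The mean of polynomials with respect to the probability density proportional to
`exp (-Q)`. -/
noncomputable def gibbsMean {Q : ℝ[X]} (hQ : IsConfining Q) : ℝ[X] →ₗ[ℝ] ℝ where
  toFun p := (∫ s : ℝ, p.eval s * Real.exp (-Q.eval s)) / ∫ s : ℝ, Real.exp (-Q.eval s)
  map_add' p q := by
    rw [← add_div, ← integral_add (hQ.integrable p) (hQ.integrable q)]
    simp [add_mul]
  map_smul' a p := by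
    simp only [eval_smul, smul_eq_mul, mul_assoc, integral_const_mul, RingHom.id_apply,
      mul_div_assoc]

theorem gibbsMean_apply {Q : ℝ[X]} (hQ : IsConfining Q) (p : ℝ[X]) :
    gibbsMean hQ p =
      (∫ s : ℝ, p.eval s * Real.exp (-Q.eval s)) / ∫ s : ℝ, Real.exp (-Q.eval s) := rfl

theorem gibbsMean_one {Q : ℝ[X]} (hQ : IsConfining Q) : gibbsMean hQ 1 = 1 := by
  rw [gibbsMean_apply]
  simpa using div_self hQ.partition_pos.ne'

theorem gibbsMean_C_mul {Q : ℝ[X]} (hQ : IsConfining Q) (a : ℝ) (p : ℝ[X]) :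
    gibbsMean hQ (C a * p) = a * gibbsMean hQ p := by
  rw [← smul_eq_C_mul, map_smul, smul_eq_mul]

theorem gibbsMean_C {Q : ℝ[X]} (hQ : IsConfining Q) (a : ℝ) : gibbsMean hQ (C a) = a := by
  rw [← mul_one (C a), gibbsMean_C_mul, gibbsMean_one, mul_one]

theorem gibbsMean_mono {Q : ℝ[X]} (hQ : IsConfining Q) {p q : ℝ[X]}
    (h : ∀ s, p.eval s ≤ q.eval s) : gibbsMean hQ p ≤ gibbsMean hQ q := by
  rw [gibbsMean_apply, gibbsMean_apply]
  have := hQ.partition_pos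
  gcongr
  · exact hQ.integrable p
  · exact hQ.integrable q
  · exact fun s => by gcongr; exact h s

theorem abs_gibbsMean_le {Q : ℝ[X]} (hQ : IsConfining Q) {p q : ℝ[X]}
    (h : ∀ s, |p.eval s| ≤ q.eval s) : |gibbsMean hQ p| ≤ gibbsMean hQ q := by
  refine abs_le.2 ⟨?_, gibbsMean_mono hQ fun s => (le_abs_self _).trans (h s)⟩
  rw [← map_neg]
  refine gibbsMean_mono hQ fun s => ?_
  rw [eval_neg]
  exact neg_le.1 ((neg_le_abs _).trans (h s))

/-- Integration by parts. -/
theorem gibbsMean_mul_derivative {Q : ℝ[X]} (hQ : IsConfining Q) (p : ℝ[X]) :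
    gibbsMean hQ (p * derivative Q) = gibbsMean hQ (derivative p) := by
  rw [← sub_eq_zero, ← map_sub, gibbsMean_apply, div_eq_zero_iff]
  left
  have hd : ∀ s : ℝ, HasDerivAt (fun s => -(p.eval s * Real.exp (-Q.eval s)))
      ((p * derivative Q - derivative p).eval s * Real.exp (-Q.eval s)) s := fun s => by
    have h := ((p.hasDerivAt s).fun_mul (Q.hasDerivAt s).fun_neg.exp).fun_neg
    exact h.congr_deriv (by rw [eval_sub, eval_mul]; ring)
  exact integral_eq_zero_of_hasDerivAt_of_integrable hd (hQ.integrable _) (hQ.integrable p).neg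

/-- Differentiation under the integral sign with respect to a coupling constant. -/
theorem hasDerivAt_integral_eval_mul_exp_neg {A B : ℝ[X]} {t₀ b K δ : ℝ} (hb : 0 < b) (hδ : 0 < δ)
    (h : ∀ t : ℝ, |t - t₀| < δ → ∀ s : ℝ, b * s ^ 2 - K ≤ A.eval s + t * B.eval s) (p : ℝ[X]) :
    HasDerivAt (fun t : ℝ => ∫ s : ℝ, p.eval s * Real.exp (-(A + C t * B).eval s))
      (-∫ s : ℝ, (p * B).eval s * Real.exp (-(A + C t₀ * B).eval s)) t₀ := by
  have hconf : IsConfining (A + C t₀ * B) :=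
    ⟨b, hb, K, fun s => by simpa using h t₀ (by simpa using hδ) s⟩
  rw [← integral_neg]
  refine (hasDerivAt_integral_of_dominated_loc_of_deriv_le (Metric.ball_mem_nhds t₀ hδ)
    (bound := fun s => ‖Real.exp K * ((p * B).eval s * Real.exp (-b * s ^ 2))‖)
    (Eventually.of_forall fun t => by fun_prop) (hconf.integrable p) (by fun_prop)
    (ae_of_all _ fun s t ht => ?_)
    ((integrable_eval_mul_exp_neg_mul_sq (p * B) hb).const_mul (Real.exp K)).norm
    (F' := fun t s => -((p * B).eval s * Real.exp (-(A + C t * B).eval s)))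
    (ae_of_all _ fun s t _ => ?_)).2
  · rw [norm_neg, norm_mul, norm_mul, norm_mul, mul_left_comm, Real.norm_eq_abs (Real.exp _),
      Real.norm_eq_abs (Real.exp _), Real.norm_eq_abs (Real.exp _), Real.abs_exp, Real.abs_exp,
      Real.abs_exp, ← Real.exp_add]
    gcongr
    have := h t (by simpa [Real.dist_eq] using ht) s
    simp only [eval_add, eval_mul, eval_C]
    linarith
  · have h1 : HasDerivAt (fun t : ℝ => -(A + C t * B).eval s) (-(B.eval s)) t := by
      simp only [eval_add, eval_mul, eval_C]
      simpa only [one_mul, id] using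
        (((hasDerivAt_id t).mul_const (B.eval s)).const_add (A.eval s)).fun_neg
    exact (h1.exp.const_mul (p.eval s)).congr_deriv (by rw [eval_mul]; ring)

/-- Completing a square absorbs the cubic term into half of the quartic one; the other half
dominates the lower terms. That `K` depends only on `a` and `R` provides one dominating function for
a whole range of parameters. -/
theorem exists_quartic_lower_bound {a : ℝ} (ha : 0 < a) (R : ℝ) :
    ∃ K : ℝ, ∀ b c d : ℝ, |b| ≤ R → |c| ≤ R → |d| ≤ R → ∀ s : ℝ,
      1 * s ^ 2 - K ≤ a * s ^ 4 + b * s ^ 3 + c * s ^ 2 + d * s := by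
  -- From `(s² - l)² ≥ 0` one has `a s⁴ / 2 ≥ a l s² - a l² / 2`. The slope `a l` pays for the
  -- cubic, quadratic and linear losses and leaves `1 * s²`.
  obtain ⟨l, hl⟩ : ∃ l : ℝ, a * l = 1 + R ^ 2 / (2 * a) + R + R :=
    ⟨(1 + R ^ 2 / (2 * a) + R + R) / a, by field_simp⟩
  refine ⟨a * l ^ 2 / 2 + R, fun b c d hb hc hd s => ?_⟩
  have h1 : -(a / 2 * s ^ 4 + R ^ 2 / (2 * a) * s ^ 2) ≤ b * s ^ 3 := by
    have h2 : b ^ 2 ≤ R ^ 2 := sq_le_sq' (abs_le.1 hb).1 (abs_le.1 hb).2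
    have h3 : a / 2 * s ^ 4 + R ^ 2 / (2 * a) * s ^ 2 + b * s ^ 3
        = ((a * s ^ 2 + b * s) ^ 2 + (R ^ 2 - b ^ 2) * s ^ 2) / (2 * a) := by
      field_simp; ring
    have h4 : 0 ≤ ((a * s ^ 2 + b * s) ^ 2 + (R ^ 2 - b ^ 2) * s ^ 2) / (2 * a) :=
      div_nonneg (add_nonneg (sq_nonneg _) (mul_nonneg (by linarith) (sq_nonneg _)))
        (by linarith)
    linarith
  have h5 : -R * s ^ 2 ≤ c * s ^ 2 :=
    mul_le_mul_of_nonneg_right (abs_le.1 hc).1 (sq_nonneg s)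
  have h6 : -R * (s ^ 2 + 1) ≤ d * s := by
    have h7 : |s| ≤ s ^ 2 + 1 := by nlinarith [sq_abs s, sq_nonneg (|s| - 1)]
    have h8 : |d * s| ≤ R * (s ^ 2 + 1) := by
      rw [abs_mul]; exact mul_le_mul hd h7 (abs_nonneg _) ((abs_nonneg _).trans hd)
    linarith [(abs_le.1 h8).1]
  have h9 : 0 ≤ a / 2 * (s ^ 2 - l) ^ 2 := by positivity
  have h10 : a * l * s ^ 2 = (1 + R ^ 2 / (2 * a) + R + R) * s ^ 2 := by rw [hl]
  nlinarith

/-- The potential `2 s⁴ - τ s² + ξ s` of the Pearcey integral. -/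
noncomputable def pearceyPotential (ξ τ : ℝ) : ℝ[X] := 2 * X ^ 4 - C τ * X ^ 2 + C ξ * X

theorem isConfining_pearceyPotential (ξ τ : ℝ) : IsConfining (pearceyPotential ξ τ) := by
  obtain ⟨K, hK⟩ := exists_quartic_lower_bound (a := 2) (by norm_num) (|τ| + |ξ|)
  refine ⟨1, one_pos, K, fun s => ?_⟩
  have := hK 0 (-τ) ξ (by simp; positivity) (by simp) (by simp) s
  simp only [pearceyPotential, eval_add, eval_sub, eval_mul, eval_pow, eval_X, eval_C,
    eval_ofNat]
  linarith

theorem pearceyIntegral_eq (ξ τ : ℝ) :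
    pearceyIntegral ξ τ = ∫ s : ℝ, Real.exp (-(pearceyPotential ξ τ).eval s) := by
  unfold pearceyIntegral pearceyPotential
  congr 1 with s
  congr 1
  simp only [eval_add, eval_sub, eval_mul, eval_pow, eval_X, eval_C, eval_ofNat]
  ring

/-- The Cole-Hopf transform is, up to the factor `2 / φ''(0)`, a mean position. -/
theorem leadingTerm_eq (φ : ℝ → ℝ) (ξ τ : ℝ) :
    leadingTerm φ ξ τ = 2 * (iteratedDeriv 2 φ 0)⁻¹ *
      gibbsMean (isConfining_pearceyPotential ξ τ) X := by
  obtain ⟨K, hK⟩ := exists_quartic_lower_bound (a := 2) (by norm_num) (|τ| + |ξ| + 1)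
  have hd : HasDerivAt (fun x : ℝ => pearceyIntegral x τ)
      (-∫ s : ℝ, (X : ℝ[X]).eval s * Real.exp (-(pearceyPotential ξ τ).eval s)) ξ := by
    have := hasDerivAt_integral_eval_mul_exp_neg (A := 2 * X ^ 4 - C τ * X ^ 2) (B := X)
      (t₀ := ξ) (b := 1) (K := K) (δ := 1) one_pos one_pos (fun t ht s => by
        have h1 : |t| ≤ |τ| + |ξ| + 1 := by
          have : |t| ≤ |t - ξ| + |ξ| := by simpa using abs_add_le (t - ξ) ξ
          linarith [abs_nonneg τ]
        have := hK 0 (-τ) t (by simp; positivity)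
          (by rw [abs_neg]; linarith [abs_nonneg ξ]) h1 s
        simp only [eval_sub, eval_mul, eval_pow, eval_X, eval_C, eval_ofNat]
        linarith) 1
    simpa only [one_mul, eval_one, pearceyIntegral_eq, pearceyPotential] using this
  rw [leadingTerm, hd.deriv, gibbsMean_apply, pearceyIntegral_eq]
  have := (isConfining_pearceyPotential ξ τ).partition_pos.ne'
  rw [← div_div]
  ring

end GibbsMean

/-! ### Sign and size of the fold function. -/

section WhitneyFold

theorem whitneyFold_neg_of_pos {ξ : ℝ} (hξ : 0 < ξ) (τ : ℝ) : whitneyFold ξ τ < 0 := by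
  obtain ⟨h, hneg, hh⟩ := whitneyFold_exists_isLeast hξ τ
  rw [whitneyFold, if_pos hξ, hh.csInf_eq]
  exact hneg

theorem whitneyFold_pos_of_neg {ξ : ℝ} (hξ : ξ < 0) (τ : ℝ) : 0 < whitneyFold ξ τ := by
  obtain ⟨h, hneg, hh, hm⟩ := whitneyFold_exists_isLeast (neg_pos.2 hξ) τ
  have hg : IsGreatest {h : ℝ | h ^ 3 - τ * h + ξ = 0} (-h) := by
    simp only [Set.mem_ofPred_eq] at hh
    refine ⟨by simp only [Set.mem_ofPred_eq]; linear_combination -hh, fun g hg => ?_⟩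
    simp only [Set.mem_ofPred_eq] at hg
    have : h ≤ -g := hm (by simp only [Set.mem_ofPred_eq]; linear_combination -hg)
    linarith
  rw [whitneyFold, if_neg hξ.not_gt, hg.csSup_eq]
  linarith

theorem whitneyFold_zero_left (τ : ℝ) : whitneyFold 0 τ = √τ := by
  have hg : IsGreatest {h : ℝ | h ^ 3 - τ * h + 0 = 0} (√τ) := by
    constructor
    · simp only [Set.mem_ofPred_eq]
      rcases le_total 0 τ with h | h
      · linear_combination √τ * Real.sq_sqrt h
      · simp [Real.sqrt_eq_zero_of_nonpos h]
    · intro g hg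
      simp only [Set.mem_ofPred_eq] at hg
      have h1 : g * (g ^ 2 - τ) = 0 := by linear_combination hg
      rcases mul_eq_zero.1 h1 with h2 | h2
      · rw [h2]; exact Real.sqrt_nonneg _
      · exact Real.le_sqrt_of_sq_le (by linarith)
  rw [whitneyFold, if_neg (lt_irrefl _), hg.csSup_eq]

/-- On the outer sheet `H² ≥ τ`. -/
theorem le_whitneyFold_sq (ξ τ : ℝ) : τ ≤ whitneyFold ξ τ ^ 2 := by
  have h := whitneyFold_root ξ τ
  rcases lt_trichotomy ξ 0 with h0 | rfl | h0
  · have := whitneyFold_pos_of_neg h0 τ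
    by_contra! hlt
    nlinarith
  · rw [whitneyFold_zero_left]
    rcases le_total 0 τ with h | h
    · rw [Real.sq_sqrt h]
    · exact h.trans (sq_nonneg _)
  · have := whitneyFold_neg_of_pos h0 τ
    by_contra! hlt
    nlinarith

theorem two_mul_whitneyFold_sq_le (ξ τ : ℝ) : 2 * whitneyFold ξ τ ^ 2 ≤ foldDiscr ξ τ := by
  have := le_whitneyFold_sq ξ τ
  unfold foldDiscr
  linarith

/-- The right side is `H² - τ`, and the root equation gives `|H| (H² - τ) = |ξ|`. If `H² ≥ 2 τ`,
then `H² - τ` is already comparable to `D`. Otherwise `|H| ≤ 2 √τ` and `D` is comparable to `τ`, so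
`|ξ| ≥ τ^(γ - 1/2)` yields the bound. -/
theorem rpow_le_of_mem_regionOne {γ : ℝ} (hγ2 : γ < 2) {p : ℝ × ℝ}
    (hp : p ∈ regionOne γ) (hD : 1 ≤ foldDiscr p.1 p.2) :
    1 / 10 * foldDiscr p.1 p.2 ^ (γ - 1)
      ≤ foldDiscr p.1 p.2 - 2 * whitneyFold p.1 p.2 ^ 2 := by
  obtain ⟨ξ, τ⟩ := p
  simp only at hD ⊢
  have hroot := whitneyFold_root ξ τ
  have hsq := le_whitneyFold_sq ξ τ
  set H := whitneyFold ξ τ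
  have hDdef : foldDiscr ξ τ = 3 * H ^ 2 - τ := rfl
  set D := foldDiscr ξ τ
  have hDpow : D ^ (γ - 1) ≤ D := by
    simpa using Real.rpow_le_rpow_of_exponent_le hD (show γ - 1 ≤ 1 by linarith)
  have hDpos : 0 < D ^ (γ - 1) := Real.rpow_pos_of_pos (by linarith) _
  by_cases hcase : 2 * τ ≤ H ^ 2
  · nlinarith [sq_nonneg H]
  push Not at hcase
  have hτ : 0 < τ := by nlinarith [sq_nonneg H]
  have hξ : τ ^ (γ - 1 / 2) ≤ |ξ| := by
    by_contra! hlt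
    exact hp ⟨hlt, hτ⟩
  have hmul : |H| * (H ^ 2 - τ) = |ξ| := by
    rw [← abs_of_nonneg (sub_nonneg.2 hsq), ← abs_mul, ← abs_neg ξ]
    congr 1; linear_combination hroot
  have hH : |H| ≤ 2 * τ ^ (1 / 2 : ℝ) := by
    rw [← Real.sqrt_eq_rpow]
    refine abs_le_of_sq_le_sq ?_ (by positivity)
    rw [mul_pow, Real.sq_sqrt hτ.le]; linarith
  have h1 : τ ^ (γ - 1 / 2) = τ ^ (1 / 2 : ℝ) * τ ^ (γ - 1) := by
    rw [← Real.rpow_add hτ]; congr 1; ring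
  have h2 : τ ^ (γ - 1) ≤ 2 * (H ^ 2 - τ) := by
    have h3 : τ ^ (1 / 2 : ℝ) * τ ^ (γ - 1) ≤ τ ^ (1 / 2 : ℝ) * (2 * (H ^ 2 - τ)) := by
      rw [← h1]
      refine hξ.trans ?_
      rw [← hmul]
      nlinarith
    exact le_of_mul_le_mul_left h3 (Real.rpow_pos_of_pos hτ _)
  -- Here `τ ≤ D ≤ 5 τ`; the sign of `γ - 1` decides which of the two inequalities is needed.
  have h4 : 1 / 5 * D ^ (γ - 1) ≤ τ ^ (γ - 1) := by
    rcases le_total 1 γ with h | h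
    · have h5 : (D / 5) ^ (γ - 1) ≤ τ ^ (γ - 1) :=
        Real.rpow_le_rpow (by linarith) (by linarith) (by linarith)
      refine le_trans ?_ h5
      have h6 : (5 : ℝ) ^ (γ - 1) ≤ 5 := by
        simpa using Real.rpow_le_rpow_of_exponent_le (show (1 : ℝ) ≤ 5 by norm_num)
          (show γ - 1 ≤ 1 by linarith)
      rw [Real.div_rpow (by linarith) (by norm_num), one_div, inv_mul_eq_div]
      exact div_le_div_of_nonneg_left hDpos.le (by positivity) h6
    · have h5 : D ^ (γ - 1) ≤ τ ^ (γ - 1) :=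
        Real.rpow_le_rpow_of_nonpos hτ (by linarith) (by linarith)
      linarith
  linarith

end WhitneyFold

/-! ### The phase centred at its critical point: uniform moment bounds. -/

section FoldPotential

open MeasureTheory Polynomial

/-- The phase of the Pearcey integral centred at its critical point `H / 2`. -/
noncomputable def foldPotential (H D : ℝ) : ℝ[X] := C D * X ^ 2 + C (4 * H) * X ^ 3 + 2 * X ^ 4

theorem eval_foldPotential (H D u : ℝ) :
    (foldPotential H D).eval u = D * u ^ 2 + 4 * H * u ^ 3 + 2 * u ^ 4 := by
  simp [foldPotential]

theorem isConfining_foldPotential (H D : ℝ) : IsConfining (foldPotential H D) := by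
  obtain ⟨K, hK⟩ := exists_quartic_lower_bound (a := 2) (by norm_num) (|4 * H| + |D|)
  refine ⟨1, one_pos, K, fun s => ?_⟩
  have := hK (4 * H) D 0 (by linarith [abs_nonneg D]) (by linarith [abs_nonneg (4 * H)])
    (by simp; positivity) s
  rw [eval_foldPotential]
  linarith

/-- After translation by `H / 2` the linear coefficient of the phase is `H³ - τ H + ξ = 0`, and the
constant term cancels between numerator and denominator. -/
theorem gibbsMean_pearceyPotential_X (ξ τ : ℝ) :
    gibbsMean (isConfining_pearceyPotential ξ τ) X = whitneyFold ξ τ / 2 +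
      gibbsMean (isConfining_foldPotential (whitneyFold ξ τ) (foldDiscr ξ τ)) X := by
  have hroot := whitneyFold_root ξ τ
  have hD : foldDiscr ξ τ = 3 * whitneyFold ξ τ ^ 2 - τ := rfl
  set H := whitneyFold ξ τ
  set D := foldDiscr ξ τ
  obtain ⟨c, hc⟩ : ∃ c : ℝ, ∀ u : ℝ, (pearceyPotential ξ τ).eval (H / 2 + u)
      = c + (foldPotential H D).eval u := by
    refine ⟨(pearceyPotential ξ τ).eval (H / 2), fun u => ?_⟩
    simp only [pearceyPotential, eval_foldPotential, eval_add, eval_sub, eval_mul, eval_pow,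
      eval_X, eval_C, eval_ofNat]
    rw [hD]
    linear_combination u * hroot
  have hQ := isConfining_foldPotential H D
  have h := gibbsMean_C hQ (H / 2)
  rw [← h, ← map_add, gibbsMean_apply, gibbsMean_apply,
    ← integral_add_left_eq_self _ (H / 2),
    ← integral_add_left_eq_self (fun s => Real.exp (-(pearceyPotential ξ τ).eval s)) (H / 2)]
  simp only [hc, neg_add, Real.exp_add, mul_left_comm _ (Real.exp (-c)), integral_const_mul]
  rw [mul_div_mul_left _ _ (Real.exp_ne_zero _)]
  simp

theorem integrable_abs_pow_mul_exp_neg_abs_rpow (k : ℕ) {c γ : ℝ} (hc : 0 < c) (hγ : 0 < γ) :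
    Integrable fun v : ℝ => |v| ^ k * Real.exp (-c * |v| ^ γ) := by
  have h1 : IntegrableOn (fun v : ℝ => |v| ^ k * Real.exp (-c * |v| ^ γ)) (Set.Ioi 0) := by
    refine (integrableOn_rpow_mul_exp_neg_mul_rpow (s := k)
      (by have : (0 : ℝ) ≤ k := k.cast_nonneg
          linarith) hγ hc).congr_fun (fun v hv => ?_) measurableSet_Ioi
    simp [abs_of_pos (Set.mem_Ioi.1 hv)]
  have h2 : IntegrableOn (fun v : ℝ => |v| ^ k * Real.exp (-c * |v| ^ γ)) (Set.Iio 0) := by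
    have := h1.comp_neg
    simpa using this
  rw [← integrableOn_univ, ← Set.Iic_union_Ioi (a := (0 : ℝ))]
  exact ((integrableOn_Iic_iff_integrableOn_Iio).2 h2).union h1

/-- Uses the factorisation `u² (2 (u + H)² + (D - 2 H²))`. For small `u` the second factor is of
size `D`. Near `u = -H` only `D - 2 H²` survives, which costs the Gaussian decay but leaves the
weaker power `|√D u|^γ`, still enough to integrate every moment. -/
theorem foldPotential_lower_bound {c γ : ℝ} (hc : 0 < c) (hγ0 : 0 < γ) (hγ2 : γ < 2)
    {H D : ℝ} (hD : 1 ≤ D) (hHD : 2 * H ^ 2 ≤ D) (h : c * D ^ (γ - 1) ≤ D - 2 * H ^ 2) (u : ℝ) :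
    min (1 / 8) (c / 16) * |√D * u| ^ γ - 1 ≤ (foldPotential H D).eval u := by
  have hD0 : 0 < D := by linarith
  set v := |√D * u|
  have hv0 : 0 ≤ v := abs_nonneg _
  have hv2 : v ^ 2 = D * u ^ 2 := by rw [sq_abs, mul_pow, Real.sq_sqrt hD0.le]
  have hfac : (foldPotential H D).eval u = u ^ 2 * (2 * (u + H) ^ 2 + (D - 2 * H ^ 2)) := by
    rw [eval_foldPotential]; ring
  have hvγ : 0 ≤ v ^ γ := Real.rpow_nonneg hv0 _
  -- For `|u| ≤ √D / 4` the condition `2 H² ≤ D` keeps `2 u² + 4 H u + D` above `D / 8`.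
  by_cases hu : 16 * u ^ 2 ≤ D
  · have h1 : v ^ γ ≤ 1 + v ^ 2 := by
      rcases le_total v 1 with h | h
      · have := Real.rpow_le_one hv0 h hγ0.le
        nlinarith [sq_nonneg v]
      · have := Real.rpow_le_rpow_of_exponent_le h hγ2.le
        rw [Real.rpow_two] at this
        linarith
    have h2 : D / 8 ≤ 2 * (u + H) ^ 2 + (D - 2 * H ^ 2) := by
      nlinarith [sq_nonneg (3 * H + 4 * u)]
    have h3 : v ^ 2 * (1 / 8) ≤ (foldPotential H D).eval u := by
      rw [hfac, hv2]; nlinarith [mul_le_mul_of_nonneg_left h2 (sq_nonneg u)]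
    have h4 : min (1 / 8) (c / 16) * v ^ γ ≤ 1 / 8 * v ^ γ := by gcongr; exact min_le_left _ _
    linarith
  · push Not at hu
    have hDv : D ≤ 4 * v := by
      refine le_of_sq_le_sq ?_ (by positivity)
      nlinarith
    -- As `γ - 2 < 0`, the bound `D ≤ 4 v` converts `D^(γ-1) u² = D^(γ-2) v²` into a multiple of
    -- `v^γ`, with a loss of at most `4² = 16`.
    have h1 : (4 * v) ^ (γ - 2) ≤ D ^ (γ - 2) :=
      Real.rpow_le_rpow_of_nonpos hD0 hDv (by linarith)
    have hvpos : 0 < v := by linarith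
    have h2 : c * D ^ (γ - 1) * u ^ 2 ≤ (foldPotential H D).eval u := by
      rw [hfac]; nlinarith [mul_le_mul_of_nonneg_left h (sq_nonneg u), mul_nonneg (sq_nonneg u)
        (sq_nonneg (u + H))]
    have h3 : D ^ (γ - 1) * u ^ 2 = D ^ (γ - 2) * v ^ 2 := by
      rw [hv2, show γ - 1 = γ - 2 + 1 by ring, Real.rpow_add_one hD0.ne']; ring
    have h5 : (1 / 16 : ℝ) ≤ 4 ^ (γ - 2) := by
      have := Real.rpow_le_rpow_of_exponent_le (show (1 : ℝ) ≤ 4 by norm_num)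
        (show -2 ≤ γ - 2 by linarith)
      refine le_trans (le_of_eq ?_) this
      rw [Real.rpow_neg (by norm_num)]; norm_num
    have h4 : 1 / 16 * v ^ γ ≤ D ^ (γ - 2) * v ^ 2 := by
      have : v ^ γ = v ^ (γ - 2) * v ^ 2 := by
        rw [← Real.rpow_two, ← Real.rpow_add hvpos]; congr 1; ring
      rw [this, ← mul_assoc]
      gcongr
      refine le_trans ?_ h1
      rw [Real.mul_rpow (by norm_num) hv0]
      gcongr
    have h6 : min (1 / 8) (c / 16) * v ^ γ ≤ c / 16 * v ^ γ := by gcongr; exact min_le_right _ _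
    nlinarith [mul_le_mul_of_nonneg_left h4 hc.le]

/-- In the variable `v = √D u` the numerator is dominated by a fixed integrable function, while the
partition function is at least a constant times `D^(-1/2)`. -/
theorem exists_abs_gibbsMean_foldPotential_le {c γ : ℝ} (hc : 0 < c) (hγ0 : 0 < γ) (hγ2 : γ < 2)
    (k : ℕ) : ∃ K : ℝ, ∀ H D : ℝ, 1 ≤ D → 2 * H ^ 2 ≤ D → c * D ^ (γ - 1) ≤ D - 2 * H ^ 2 →
      |gibbsMean (isConfining_foldPotential H D) (X ^ k)| ≤ K * (√D)⁻¹ ^ k := by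
  set a := min (1 / 8) (c / 16)
  have ha : 0 < a := by positivity
  set g : ℝ → ℝ := fun v => |v| ^ k * Real.exp (-a * |v| ^ γ)
  have hg : Integrable g := integrable_abs_pow_mul_exp_neg_abs_rpow k ha hγ0
  refine ⟨Real.exp 8 * ∫ v, g v, fun H D hD hHD h => ?_⟩
  have hQ := isConfining_foldPotential H D
  have hD0 : 0 < D := by linarith
  set r := (√D)⁻¹
  have hr0 : 0 < r := by positivity
  have hr1 : r ≤ 1 := inv_le_one_of_one_le₀ (Real.one_le_sqrt.2 hD)
  have hrD : r ^ 2 * D = 1 := by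
    rw [inv_pow, Real.sq_sqrt hD0.le]; exact inv_mul_cancel₀ hD0.ne'
  have hnum : |∫ u : ℝ, (X ^ k : ℝ[X]).eval u * Real.exp (-(foldPotential H D).eval u)|
      ≤ Real.exp 1 * r ^ k * (r * ∫ v, g v) := by
    have h1 : ∫ u : ℝ, g (√D * u) = r * ∫ v, g v := by
      rw [Measure.integral_comp_mul_left, abs_of_pos hr0, smul_eq_mul]
    rw [← h1, ← integral_const_mul, ← Real.norm_eq_abs]
    refine norm_integral_le_of_norm_le
      ((hg.comp_mul_left' (Real.sqrt_pos.2 hD0).ne').const_mul _) (ae_of_all _ fun u => ?_)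
    have h2 : r ^ k * |√D * u| ^ k = |u| ^ k := by
      rw [← mul_pow, abs_mul, abs_of_pos (Real.sqrt_pos.2 hD0), ← mul_assoc,
        inv_mul_cancel₀ (Real.sqrt_pos.2 hD0).ne', one_mul]
    have h3 : Real.exp (-(foldPotential H D).eval u)
        ≤ Real.exp 1 * Real.exp (-a * |√D * u| ^ γ) := by
      rw [← Real.exp_add]
      gcongr
      have := foldPotential_lower_bound hc hγ0 hγ2 hD hHD h u
      linarith
    calc ‖(X ^ k : ℝ[X]).eval u * Real.exp (-(foldPotential H D).eval u)‖
        = |u| ^ k * Real.exp (-(foldPotential H D).eval u) := by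
          rw [norm_mul, Real.norm_eq_abs, Real.norm_eq_abs, Real.abs_exp]; simp
      _ ≤ |u| ^ k * (Real.exp 1 * Real.exp (-a * |√D * u| ^ γ)) := by gcongr
      _ = Real.exp 1 * r ^ k * g (√D * u) := by rw [← h2]; simp only [g]; ring
  -- On `[0, r]` the three terms of the phase are at most `1`, `4` and `2`. Together with the factor
  -- `exp 1` of the numerator this explains `exp 8`.
  have hden : r * Real.exp (-7) ≤ ∫ u : ℝ, Real.exp (-(foldPotential H D).eval u) := by
    have h1 : ∫ u in Set.Icc 0 r, Real.exp (-7) = r * Real.exp (-7) := by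
      simp [hr0.le]
    rw [← h1]
    refine le_trans (setIntegral_mono_on (by simp) hQ.integrable_exp.integrableOn
      measurableSet_Icc fun u hu => ?_)
      (setIntegral_le_integral hQ.integrable_exp (ae_of_all _ fun u => (Real.exp_pos _).le))
    gcongr
    rw [eval_foldPotential]
    have hu0 := hu.1
    have hu1 : u ≤ 1 := hu.2.trans hr1
    have h2 : D * u ^ 2 ≤ 1 := by
      rw [← hrD, mul_comm]; gcongr; exact hu.2
    have h3 : H * u ≤ 1 := by
      refine le_of_sq_le_sq ?_ zero_le_one
      nlinarith [mul_le_mul_of_nonneg_right hHD (sq_nonneg u)]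
    have h4 : u ^ 2 ≤ 1 := pow_le_one₀ hu0 hu1
    have h5 : H * u * u ^ 2 ≤ 1 := by nlinarith [sq_nonneg u]
    have h6 : u ^ 4 ≤ 1 := pow_le_one₀ hu0 hu1
    nlinarith
  have hI : 0 ≤ ∫ v, g v := integral_nonneg fun v => by positivity
  rw [gibbsMean_apply, abs_div, abs_of_pos hQ.partition_pos, div_le_iff₀ hQ.partition_pos]
  refine hnum.trans ?_
  calc Real.exp 1 * r ^ k * (r * ∫ v, g v)
      = (Real.exp 8 * ∫ v, g v) * r ^ k * (r * Real.exp (-7)) := by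
        rw [show (1 : ℝ) = 8 + -7 by norm_num, Real.exp_add]; ring
    _ ≤ _ := by gcongr

end FoldPotential

/-! ### The outer expansion in powers of `H` and `D⁻¹`. -/

section OuterExpansion

/-- The part of relative order `D⁻ᵍ` in the formal expansion of the `k`-th centred moment. The
recursion on `k` is integration by parts against the phase `D u² + 4 H u³ + 2 u⁴`. -/
noncomputable def foldCoeff : ℕ → ℕ → MvPolynomial (Fin 3) ℝ
  | 0, 0 => 1
  | _ + 1, 0 => 0
  | 0, k + 1 => MvPolynomial.C ((k : ℝ) / 2) * (MvPolynomial.X 2 * foldCoeff 0 (k - 1))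
  | 1, k + 1 => MvPolynomial.C ((k : ℝ) / 2) * (MvPolynomial.X 2 * foldCoeff 1 (k - 1))
      - MvPolynomial.C 6 * (MvPolynomial.X 0 * MvPolynomial.X 2 * foldCoeff 0 (k + 2))
  | g + 2, k + 1 => MvPolynomial.C ((k : ℝ) / 2) * (MvPolynomial.X 2 * foldCoeff (g + 2) (k - 1))
      - MvPolynomial.C 6 * (MvPolynomial.X 0 * MvPolynomial.X 2 * foldCoeff (g + 1) (k + 2))
      - MvPolynomial.C 4 * (MvPolynomial.X 2 * foldCoeff g (k + 3))
  termination_by g k => (g, k)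

theorem IsFoldHomogeneous.of_eq {P : MvPolynomial (Fin 3) ℝ} {d e : ℤ}
    (h : MvPolynomial.IsWeightedHomogeneous (![1, 2, -2] : Fin 3 → ℤ) P d) (hde : d = e) :
    IsFoldHomogeneous P e := hde ▸ h

/-- Giving `u` the weight `-1` makes all three terms of the recursion scale alike: each step trades
weight between the multiplier and the index `(g, k)`. -/
theorem isFoldHomogeneous_foldCoeff (g k : ℕ) :
    IsFoldHomogeneous (foldCoeff g k) (-(k : ℤ) - 2 * g) := by
  have h0 : IsFoldHomogeneous (MvPolynomial.X 0) 1 :=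
    MvPolynomial.isWeightedHomogeneous_X ℝ _ 0
  have h2 : IsFoldHomogeneous (MvPolynomial.X 2) (-2) :=
    MvPolynomial.isWeightedHomogeneous_X ℝ _ 2
  have hfirst : ∀ g k : ℕ, IsFoldHomogeneous (foldCoeff g (k - 1)) (-((k - 1 : ℕ) : ℤ) - 2 * g) →
      IsFoldHomogeneous (MvPolynomial.C ((k : ℝ) / 2) * (MvPolynomial.X 2 * foldCoeff g (k - 1)))
        (-((k + 1 : ℕ) : ℤ) - 2 * g) := by
    intro g k h
    -- The truncated index `k - 1` at `k = 0` is harmless, since the prefactor `k / 2` vanishes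
    -- there.
    rcases k with _ | k
    · simpa [IsFoldHomogeneous] using
        MvPolynomial.isWeightedHomogeneous_zero ℝ (![1, 2, -2] : Fin 3 → ℤ) _
    · refine .of_eq ((h2.mul h).C_mul _) ?_
      push_cast [Nat.add_sub_cancel]; ring
  induction g, k using foldCoeff.induct with
  | case1 => rw [foldCoeff]; exact MvPolynomial.isWeightedHomogeneous_one ℝ _
  | case2 => rw [foldCoeff]; exact MvPolynomial.isWeightedHomogeneous_zero ℝ _ _
  | case3 k ih => rw [foldCoeff]; exact hfirst 0 k ih
  | case4 k ih1 ih2 =>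
    rw [foldCoeff]
    refine (hfirst 1 k ih1).sub (IsFoldHomogeneous.of_eq (((h0.mul h2).mul ih2).C_mul 6) ?_)
    push_cast; ring
  | case5 g k ih1 ih2 ih3 =>
    rw [foldCoeff]
    refine ((hfirst _ k ih1).sub (IsFoldHomogeneous.of_eq (((h0.mul h2).mul ih2).C_mul 6) ?_)).sub
      (IsFoldHomogeneous.of_eq ((h2.mul ih3).C_mul 4) ?_)
    · push_cast; ring
    · push_cast; ring

/-- Every branch of the recursion preserves the parity of `g + k`, and the only nonzero seed sits at
`(0, 0)`. For `k = 1` this leaves only odd `g`. -/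
theorem foldCoeff_eq_zero_of_odd (g k : ℕ) (h : Odd (g + k)) : foldCoeff g k = 0 := by
  have hfirst : ∀ g k : ℕ, (Odd (g + (k - 1)) → foldCoeff g (k - 1) = 0) → Odd (g + (k + 1)) →
      MvPolynomial.C ((k : ℝ) / 2) * (MvPolynomial.X 2 * foldCoeff g (k - 1)) = 0 := by
    intro g k h hodd
    rcases k with _ | k
    · simp
    · rw [h (by rw [Nat.odd_iff] at hodd ⊢; omega), mul_zero, mul_zero]
  induction g, k using foldCoeff.induct with
  | case1 => simp at h
  | case2 => rw [foldCoeff]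
  | case3 k ih => rw [foldCoeff, hfirst 0 k ih h]
  | case4 k ih1 ih2 =>
    rw [foldCoeff, hfirst 1 k ih1 h, ih2 (by rw [Nat.odd_iff] at h ⊢; omega)]
    simp
  | case5 g k ih1 ih2 ih3 =>
    rw [foldCoeff, hfirst _ k ih1 h, ih2 (by rw [Nat.odd_iff] at h ⊢; omega),
      ih3 (by rw [Nat.odd_iff] at h ⊢; omega)]
    simp

/-- Partial sums obey the same three-term relation as the exact moments, with the cut-off lowered by
the order in `g` of each term. Subtracting the two relations gives a recursion for the errors. -/
theorem sum_eval_foldCoeff_succ (v : Fin 3 → ℝ) (G k : ℕ) :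
    ∑ g ∈ Finset.range G, MvPolynomial.eval v (foldCoeff g (k + 1))
      = (k : ℝ) / 2 * v 2 * ∑ g ∈ Finset.range G, MvPolynomial.eval v (foldCoeff g (k - 1))
        - 6 * v 0 * v 2 * ∑ g ∈ Finset.range (G - 1), MvPolynomial.eval v (foldCoeff g (k + 2))
        - 4 * v 2 * ∑ g ∈ Finset.range (G - 2), MvPolynomial.eval v (foldCoeff g (k + 3)) := by
  induction G with
  | zero => simp
  | succ G ih =>
    rw [Finset.sum_range_succ, ih, Finset.sum_range_succ _ G]
    match G with
    | 0 => rw [foldCoeff]; simp; ring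
    | 1 => rw [foldCoeff]; simp; ring
    | G + 2 =>
      rw [foldCoeff, show G + 2 + 1 - 1 = G + 1 + 1 by omega, show G + 2 + 1 - 2 = G + 1 by omega,
        show G + 2 - 1 = G + 1 by omega, show G + 2 - 2 = G by omega,
        Finset.sum_range_succ (fun g => MvPolynomial.eval v (foldCoeff g (k + 2))) (G + 1),
        Finset.sum_range_succ (fun g => MvPolynomial.eval v (foldCoeff g (k + 3))) G]
      simp only [map_sub, map_mul, MvPolynomial.eval_C, MvPolynomial.eval_X]
      ring

theorem gibbsMean_foldPotential_pow_succ {H D : ℝ} (hD : 0 < D) (k : ℕ) :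
    gibbsMean (isConfining_foldPotential H D) (Polynomial.X ^ (k + 1))
      = (k : ℝ) / 2 * D⁻¹ * gibbsMean (isConfining_foldPotential H D) (Polynomial.X ^ (k - 1))
        - 6 * H * D⁻¹ * gibbsMean (isConfining_foldPotential H D) (Polynomial.X ^ (k + 2))
        - 4 * D⁻¹ * gibbsMean (isConfining_foldPotential H D) (Polynomial.X ^ (k + 3)) := by
  have h := gibbsMean_mul_derivative (isConfining_foldPotential H D) (Polynomial.X ^ k)
  have h1 : (Polynomial.X ^ k * Polynomial.derivative (foldPotential H D) : Polynomial ℝ)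
      = Polynomial.C (2 * D) * Polynomial.X ^ (k + 1)
        + Polynomial.C (12 * H) * Polynomial.X ^ (k + 2)
        + Polynomial.C 8 * Polynomial.X ^ (k + 3) := by
    simp only [foldPotential, Polynomial.derivative_add, Polynomial.derivative_C,
      Polynomial.derivative_X_pow, Polynomial.derivative_mul, Polynomial.derivative_ofNat]
    simp only [map_mul, map_natCast, map_ofNat]
    push_cast
    ring
  rw [h1, Polynomial.derivative_X_pow, map_add, map_add, gibbsMean_C_mul, gibbsMean_C_mul,
    gibbsMean_C_mul, gibbsMean_C_mul] at h
  field_simp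
  linear_combination h

/-- Induction on `(G, k)` along the common recursion of moments and partial sums. The case `G = 0`
is the moment bound and `k = 0` is exact. The value of `τ` is arbitrary because the coefficients
involve only `H` and `D⁻¹`. -/
theorem exists_abs_gibbsMean_sub_sum_foldCoeff_le {c γ : ℝ} (hc : 0 < c) (hγ0 : 0 < γ)
    (hγ2 : γ < 2) (G k : ℕ) : ∃ K : ℝ, ∀ H τ D : ℝ, 1 ≤ D → 2 * H ^ 2 ≤ D →
      c * D ^ (γ - 1) ≤ D - 2 * H ^ 2 →
      |gibbsMean (isConfining_foldPotential H D) (Polynomial.X ^ k)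
        - ∑ g ∈ Finset.range G, MvPolynomial.eval ![H, τ, D⁻¹] (foldCoeff g k)|
        ≤ K * (√D)⁻¹ ^ (k + 2 * G) := by
  induction G using Nat.strong_induction_on generalizing k with
  | _ G ihG =>
  rcases Nat.eq_zero_or_pos G with rfl | hG
  · obtain ⟨K, hK⟩ := exists_abs_gibbsMean_foldPotential_le hc hγ0 hγ2 k
    exact ⟨K, fun H τ D h1 h2 h3 => by simpa using hK H D h1 h2 h3⟩
  induction k using Nat.strong_induction_on with
  | _ k ihk =>
  rcases k with _ | k
  · refine ⟨0, fun H τ D h1 h2 h3 => ?_⟩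
    obtain ⟨G, rfl⟩ := Nat.exists_eq_succ_of_ne_zero hG.ne'
    rw [Finset.sum_range_succ']
    simp [foldCoeff, gibbsMean_one]
  obtain ⟨K1, hK1⟩ := ihk (k - 1) (by omega)
  obtain ⟨K2, hK2⟩ := ihG (G - 1) (by omega) (k + 2)
  obtain ⟨K3, hK3⟩ := ihG (G - 2) (by omega) (k + 3)
  refine ⟨k / 2 * K1 + 6 * K2 + 4 * K3, fun H τ D h1 h2 h3 => ?_⟩
  have hD0 : 0 < D := by linarith
  specialize hK1 H τ D h1 h2 h3
  specialize hK2 H τ D h1 h2 h3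
  specialize hK3 H τ D h1 h2 h3
  rw [gibbsMean_foldPotential_pow_succ hD0, sum_eval_foldCoeff_succ]
  simp only [Matrix.cons_val_zero, Matrix.cons_val]
  set E1 := gibbsMean (isConfining_foldPotential H D) (Polynomial.X ^ (k - 1)) -
    ∑ g ∈ Finset.range G, MvPolynomial.eval ![H, τ, D⁻¹] (foldCoeff g (k - 1)) with hE1
  set E2 := gibbsMean (isConfining_foldPotential H D) (Polynomial.X ^ (k + 2)) -
    ∑ g ∈ Finset.range (G - 1), MvPolynomial.eval ![H, τ, D⁻¹] (foldCoeff g (k + 2)) with hE2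
  set E3 := gibbsMean (isConfining_foldPotential H D) (Polynomial.X ^ (k + 3)) -
    ∑ g ∈ Finset.range (G - 2), MvPolynomial.eval ![H, τ, D⁻¹] (foldCoeff g (k + 3)) with hE3
  set r := (√D)⁻¹ with hr
  have hr0 : 0 < r := by positivity
  have hr1 : r ≤ 1 := inv_le_one_of_one_le₀ (Real.one_le_sqrt.2 h1)
  have hrD : D⁻¹ = r ^ 2 := by rw [hr, inv_pow, Real.sq_sqrt hD0.le]
  -- Hence the multiplier `H D⁻¹` still gains one factor `r = D^(-1/2)`.
  have hHr : |H| * r ≤ 1 := by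
    refine le_of_sq_le_sq ?_ zero_le_one
    rw [mul_pow, sq_abs, ← hrD, ← div_eq_mul_inv, one_pow, div_le_one hD0]
    nlinarith [sq_nonneg H]
  have e1 : |(k : ℝ) / 2 * r ^ 2 * E1| ≤ k / 2 * K1 * r ^ (k + 1 + 2 * G) := by
    rcases k with _ | k
    · simp
    · rw [abs_mul, abs_of_nonneg (by positivity)]
      calc ((k + 1 : ℕ) : ℝ) / 2 * r ^ 2 * |E1|
          ≤ ((k + 1 : ℕ) : ℝ) / 2 * r ^ 2 * (K1 * r ^ (k + 1 - 1 + 2 * G)) := by gcongr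
        _ = _ := by rw [Nat.add_sub_cancel]; ring
  have e2 : |6 * H * r ^ 2 * E2| ≤ 6 * K2 * r ^ (k + 1 + 2 * G) := by
    have : |6 * H * r ^ 2 * E2| = 6 * (|H| * r) * r * |E2| := by
      rw [abs_mul, abs_mul, abs_mul, abs_of_pos (by positivity : 0 < r ^ 2),
        abs_of_pos (by norm_num : (0 : ℝ) < 6)]; ring
    rw [this]
    calc 6 * (|H| * r) * r * |E2| ≤ 6 * 1 * r * (K2 * r ^ (k + 2 + 2 * (G - 1))) := by gcongr
      _ = 6 * K2 * r ^ (k + 2 + 2 * (G - 1) + 1) := by ring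
      _ = _ := by congr 2; omega
  have e3 : |4 * r ^ 2 * E3| ≤ 4 * K3 * r ^ (k + 1 + 2 * G) := by
    have hK3' : 0 ≤ K3 := by
      by_contra! hneg
      have := (abs_nonneg _).trans hK3
      nlinarith [pow_pos hr0 (k + 3 + 2 * (G - 2))]
    rw [abs_mul, abs_of_pos (by positivity)]
    calc 4 * r ^ 2 * |E3| ≤ 4 * r ^ 2 * (K3 * r ^ (k + 3 + 2 * (G - 2))) := by gcongr
      _ = 4 * K3 * r ^ (k + 5 + 2 * (G - 2)) := by ring
      _ ≤ _ := by
        gcongr 4 * K3 * ?_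
        -- An inequality, not an equality: for `G = 1` the truncated `G - 2` is `0` and the exponent
        -- exceeds the required one.
        exact pow_le_pow_of_le_one hr0.le hr1 (by omega)
  rw [hrD]
  calc _ = |(k : ℝ) / 2 * r ^ 2 * E1 - 6 * H * r ^ 2 * E2 - 4 * r ^ 2 * E3| := by
        congr 1; rw [hE1, hE2, hE3, ← hrD]; ring
    _ ≤ |(k : ℝ) / 2 * r ^ 2 * E1| + |6 * H * r ^ 2 * E2| + |4 * r ^ 2 * E3| :=
        (abs_sub _ _).trans (add_le_add_left (abs_sub _ _) _)
    _ ≤ _ := by rw [add_mul, add_mul]; gcongr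

theorem sum_range_foldCoeff_one (v : Fin 3 → ℝ) (N : ℕ) :
    ∑ g ∈ Finset.range (2 * N + 1), MvPolynomial.eval v (foldCoeff g 1)
      = ∑ l ∈ Finset.Icc 1 N, MvPolynomial.eval v (foldCoeff (2 * l - 1) 1) := by
  induction N with
  | zero => simp [foldCoeff]
  | succ N ih =>
    rw [show 2 * (N + 1) + 1 = 2 * N + 1 + 1 + 1 by ring, Finset.sum_range_succ,
      Finset.sum_range_succ, ih, Finset.sum_Icc_succ_top (by omega),
      foldCoeff_eq_zero_of_odd (2 * N + 1 + 1) 1 (by rw [Nat.odd_iff]; omega)]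
    simp [show 2 * (N + 1) - 1 = 2 * N + 1 by omega]

theorem leadingTerm_outer_expansion (φ : ℝ → ℝ) :
    ∃ P : ℕ → MvPolynomial (Fin 3) ℝ,
      (∀ l : ℕ, 1 ≤ l → IsFoldHomogeneous (P l) (1 - 4 * (l : ℤ))) ∧
      ∀ γ₁ : ℝ, 0 < γ₁ → γ₁ < 2 → ∀ N : ℕ,
        (fun p : ℝ × ℝ => leadingTerm φ p.1 p.2
            - ((iteratedDeriv 2 φ 0)⁻¹ * whitneyFold p.1 p.2
              + ∑ l ∈ Finset.Icc 1 N, foldEval (P l) p.1 p.2))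
          =O[comap (fun p : ℝ × ℝ => foldDiscr p.1 p.2) atTop ⊓ 𝓟 (regionOne γ₁)]
        (fun p : ℝ × ℝ => foldDiscr p.1 p.2 ^ ((1 - 4 * ((N : ℝ) + 1)) / 2)) := by
  set a := 2 * (iteratedDeriv 2 φ 0)⁻¹ with ha
  refine ⟨fun l => MvPolynomial.C a * foldCoeff (2 * l - 1) 1, fun l hl => ?_,
    fun γ hγ0 hγ2 N => ?_⟩
  · refine .of_eq ((isFoldHomogeneous_foldCoeff (2 * l - 1) 1).C_mul a) ?_
    push_cast [Nat.cast_sub (show 1 ≤ 2 * l by omega)]; ring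
  -- With cut-off `2 N + 1` the first moment has error `D^(-(4 N + 3) / 2)`, the exponent required;
  -- the odd orders below the cut-off are `2 l - 1` for `l = 1, …, N`.
  obtain ⟨K, hK⟩ := exists_abs_gibbsMean_sub_sum_foldCoeff_le (c := 1 / 10) (by norm_num) hγ0 hγ2
    (2 * N + 1) 1
  refine IsBigO.of_bound (|a| * K) ?_
  rw [eventually_inf_principal, eventually_comap]
  filter_upwards [eventually_ge_atTop 1] with D hD p hpD hp
  subst hpD
  have hmain := hK (whitneyFold p.1 p.2) p.2 (foldDiscr p.1 p.2) hD
    (two_mul_whitneyFold_sq_le _ _) (rpow_le_of_mem_regionOne hγ2 hp hD)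
  have hD0 : 0 < foldDiscr p.1 p.2 := by linarith
  rw [leadingTerm_eq, gibbsMean_pearceyPotential_X, Real.norm_eq_abs, Real.norm_eq_abs,
    abs_of_pos (Real.rpow_pos_of_pos hD0 _)]
  rw [sum_range_foldCoeff_one, pow_one] at hmain
  have hpow : (√(foldDiscr p.1 p.2))⁻¹ ^ (1 + 2 * (2 * N + 1))
      = foldDiscr p.1 p.2 ^ ((1 - 4 * ((N : ℝ) + 1)) / 2) := by
    rw [Real.sqrt_eq_rpow, ← Real.rpow_neg hD0.le, ← Real.rpow_natCast, ← Real.rpow_mul hD0.le]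
    congr 1; push_cast; ring
  rw [← hpow, mul_assoc |a|]
  refine le_trans (le_of_eq ?_) (mul_le_mul_of_nonneg_left hmain (abs_nonneg a))
  rw [← abs_mul]
  congr 1
  simp only [foldEval, map_mul, MvPolynomial.eval_C, ← Finset.mul_sum]
  rw [← ha]
  linear_combination (-(whitneyFold p.1 p.2) / 2) * ha

end OuterExpansion

/-! ### The tilted double well: scaling, moment identities and moment bounds. -/

section WellMoments

open MeasureTheory Polynomial

/-- The symmetric double-well potential `(T / 8) (s² - 1)²` tilted by the field `z`. -/
noncomputable def wellPotential (z T : ℝ) : ℝ[X] := C (T / 8) * (X ^ 2 - 1) ^ 2 + C z * X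

theorem eval_wellPotential (z T s : ℝ) :
    (wellPotential z T).eval s = T / 8 * (s ^ 2 - 1) ^ 2 + z * s := by
  simp [wellPotential]

theorem isConfining_wellPotential (z : ℝ) {T : ℝ} (hT : 0 < T) :
    IsConfining (wellPotential z T) := by
  obtain ⟨K, hK⟩ := exists_quartic_lower_bound (a := T / 8) (by linarith) (|T / 4| + |z|)
  refine ⟨1, one_pos, K, fun s => ?_⟩
  have := hK 0 (-(T / 4)) z (by simp; positivity) (by rw [abs_neg]; linarith [abs_nonneg z])
    (by linarith [abs_nonneg (T / 4)]) s
  rw [eval_wellPotential]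
  nlinarith

/-- The mean position in the tilted double well. -/
noncomputable def wellMean (z T : ℝ) : ℝ :=
  (∫ s : ℝ, s * Real.exp (-(wellPotential z T).eval s)) /
    ∫ s : ℝ, Real.exp (-(wellPotential z T).eval s)

theorem gibbsMean_wellPotential_X (z : ℝ) {T : ℝ} (hT : 0 < T) :
    gibbsMean (isConfining_wellPotential z hT) X = wellMean z T := by
  simp [gibbsMean_apply, wellMean]

theorem gibbsMean_pearceyPotential_X_eq_wellMean (ξ : ℝ) {τ : ℝ} (hτ : 0 < τ) :
    gibbsMean (isConfining_pearceyPotential ξ τ) X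
      = √τ / 2 * wellMean (ξ * √τ / 2) (τ ^ 2) := by
  have hs : 0 < √τ / 2 := by positivity
  have hc : ∀ s : ℝ, (pearceyPotential ξ τ).eval (√τ / 2 * s)
      = -(τ ^ 2 / 8) + (wellPotential (ξ * √τ / 2) (τ ^ 2)).eval s := by
    intro s
    have h2 : √τ ^ 2 = τ := Real.sq_sqrt hτ.le
    simp only [pearceyPotential, eval_wellPotential, eval_add, eval_sub, eval_mul, eval_pow,
      eval_X, eval_C, eval_ofNat]
    linear_combination (s ^ 4 / 8 * (√τ ^ 2 + τ) - τ * s ^ 2 / 4) * h2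
  have h1 : ∫ s : ℝ, (X : ℝ[X]).eval s * Real.exp (-(pearceyPotential ξ τ).eval s)
      = √τ / 2 * (√τ / 2 * (Real.exp (τ ^ 2 / 8) *
        ∫ s : ℝ, s * Real.exp (-(wellPotential (ξ * √τ / 2) (τ ^ 2)).eval s))) := by
    have := Measure.integral_comp_mul_left
      (fun s : ℝ => (X : ℝ[X]).eval s * Real.exp (-(pearceyPotential ξ τ).eval s)) (√τ / 2)
    rw [abs_of_pos (inv_pos.2 hs), smul_eq_mul, eq_inv_mul_iff_mul_eq₀ hs.ne'] at this
    rw [← this]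
    congr 1
    rw [← integral_const_mul, ← integral_const_mul]
    congr 1 with s
    rw [hc, neg_add, neg_neg, Real.exp_add, eval_X]; ring
  have h2 : ∫ s : ℝ, Real.exp (-(pearceyPotential ξ τ).eval s)
      = √τ / 2 * (Real.exp (τ ^ 2 / 8) *
        ∫ s : ℝ, Real.exp (-(wellPotential (ξ * √τ / 2) (τ ^ 2)).eval s)) := by
    have := Measure.integral_comp_mul_left
      (fun s : ℝ => Real.exp (-(pearceyPotential ξ τ).eval s)) (√τ / 2)
    rw [abs_of_pos (inv_pos.2 hs), smul_eq_mul, eq_inv_mul_iff_mul_eq₀ hs.ne'] at this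
    rw [← this]
    congr 1
    rw [← integral_const_mul]
    congr 1 with s
    rw [hc, neg_add, neg_neg, Real.exp_add]
  rw [gibbsMean_apply, h1, h2, mul_div_mul_left _ _ hs.ne', mul_div_assoc,
    mul_div_mul_left _ _ (Real.exp_ne_zero _), wellMean]

variable {z T : ℝ} (hT : 0 < T)

/-- Integration by parts with `Q' = (T / 2) s (s² - 1) + z`: a factor `s (s² - 1)` inside a mean is
worth one power of `T⁻¹`. -/
theorem gibbsMean_wellPotential_mul (p : ℝ[X]) :
    gibbsMean (isConfining_wellPotential z hT) (p * (X * (X ^ 2 - 1)))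
      = T⁻¹ * (2 * gibbsMean (isConfining_wellPotential z hT) (derivative p)
        - 2 * z * gibbsMean (isConfining_wellPotential z hT) p) := by
  have h := gibbsMean_mul_derivative (isConfining_wellPotential z hT) p
  have h1 : p * derivative (wellPotential z T)
      = C (T / 2) * (p * (X * (X ^ 2 - 1))) + C z * p := by
    have h2 : (C (T / 2) : ℝ[X]) = 4 * C (T / 8) := by
      rw [← C_ofNat, ← C_mul]; congr 1; ring
    simp only [wellPotential, derivative_add, derivative_mul, derivative_C, derivative_X,
      derivative_pow, derivative_sub, derivative_one, h2]
    simp only [map_natCast]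
    push_cast
    ring
  rw [h1, map_add, gibbsMean_C_mul, gibbsMean_C_mul] at h
  field_simp
  linear_combination 2 * h

theorem gibbsMean_X_mul_pow_succ (k : ℕ) :
    gibbsMean (isConfining_wellPotential z hT) (X * (X ^ 2 - 1) ^ (k + 1))
      = T⁻¹ * (-2 * z * gibbsMean (isConfining_wellPotential z hT) ((X ^ 2 - 1) ^ k)
        + 4 * k * gibbsMean (isConfining_wellPotential z hT) (X * (X ^ 2 - 1) ^ (k - 1))) := by
  have h := gibbsMean_wellPotential_mul (z := z) hT ((X ^ 2 - 1) ^ k)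
  have h1 : derivative ((X ^ 2 - 1) ^ k : ℝ[X]) = C (2 * k : ℝ) * (X * (X ^ 2 - 1) ^ (k - 1)) := by
    simp only [derivative_pow, derivative_sub, derivative_X, derivative_one]
    simp only [map_mul, map_natCast, map_ofNat]
    push_cast
    ring
  rw [h1, gibbsMean_C_mul] at h
  rw [show (X * (X ^ 2 - 1) ^ (k + 1) : ℝ[X]) = (X ^ 2 - 1) ^ k * (X * (X ^ 2 - 1)) by ring, h]
  ring

theorem derivative_X_mul_sq_sub_one_pow (k : ℕ) :
    derivative (X * (X ^ 2 - 1) ^ k : ℝ[X])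
      = (X ^ 2 - 1) ^ k + C (2 * k : ℝ) * (X ^ 2 * (X ^ 2 - 1) ^ (k - 1)) := by
  simp only [derivative_pow, derivative_sub, derivative_X, derivative_one, derivative_mul]
  simp only [map_mul, map_natCast, map_ofNat]
  push_cast
  ring

/-- The case `p = s (s² - 1)ᵏ`, with `s² = 1 + (s² - 1)` on both sides. Unlike the relation for `⟨s
(s² - 1)ᵏ⁺¹⟩`, it determines only the sum of two consecutive even moments. -/
theorem gibbsMean_pow_add (k : ℕ) :
    gibbsMean (isConfining_wellPotential z hT) ((X ^ 2 - 1) ^ (k + 1))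
        + gibbsMean (isConfining_wellPotential z hT) ((X ^ 2 - 1) ^ (k + 2))
      = T⁻¹ * (-2 * z * gibbsMean (isConfining_wellPotential z hT) (X * (X ^ 2 - 1) ^ k)
        + (2 + 4 * k) * gibbsMean (isConfining_wellPotential z hT) ((X ^ 2 - 1) ^ k)
        + 4 * k * gibbsMean (isConfining_wellPotential z hT) ((X ^ 2 - 1) ^ (k - 1))) := by
  have h := gibbsMean_wellPotential_mul (z := z) hT (X * (X ^ 2 - 1) ^ k)
  have h1 : derivative (X * (X ^ 2 - 1) ^ k : ℝ[X])
      = C (1 + 2 * k : ℝ) * (X ^ 2 - 1) ^ k + C (2 * k : ℝ) * (X ^ 2 - 1) ^ (k - 1) := by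
    rw [derivative_X_mul_sq_sub_one_pow]
    rcases k with _ | k
    · simp
    · rw [Nat.add_sub_cancel, map_add, C_1, pow_succ]
      ring
  rw [h1, map_add, gibbsMean_C_mul, gibbsMean_C_mul] at h
  rw [← map_add, show ((X ^ 2 - 1) ^ (k + 1) + (X ^ 2 - 1) ^ (k + 2) : ℝ[X])
    = X * (X ^ 2 - 1) ^ k * (X * (X ^ 2 - 1)) by ring, h]
  ring

/-- The mass near the local maximum of the double well is exponentially small. -/
theorem gibbsMean_even_pow_le (k : ℕ) :
    gibbsMean (isConfining_wellPotential z hT) ((X ^ 2 - 1) ^ (2 * k))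
      ≤ 4 * gibbsMean (isConfining_wellPotential z hT) (X ^ 2 * (X ^ 2 - 1) ^ (2 * k))
        + 4 * Real.exp (-(T / 32)) := by
  have hQ := isConfining_wellPotential z hT
  set w : ℝ → ℝ := fun s => Real.exp (-(wellPotential z T).eval s) with hw
  have hw0 : ∀ s, 0 < w s := fun s => Real.exp_pos _
  have hwi : Integrable w := hQ.integrable_exp
  -- Mass of an interval of length `1/4` in the well favoured by the field, where `|s| ∈ [3/4, 1]`:
  -- there `(s² - 1)² / 8 ≤ 49 / 2048` and the tilt gains at least `3/4 |z|`.
  have hZ : 1 / 4 * Real.exp (-(49 / 2048 * T) + 3 / 4 * |z|) ≤ ∫ s, w s := by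
    have key : ∀ a : ℝ, (∀ s ∈ Set.Icc a (a + 1 / 4), z * s ≤ -(3 / 4 * |z|) ∧
        3 / 4 ≤ |s| ∧ |s| ≤ 1) → 1 / 4 * Real.exp (-(49 / 2048 * T) + 3 / 4 * |z|) ≤ ∫ s, w s := by
      intro a ha
      have h1 : ∫ s in Set.Icc a (a + 1 / 4), Real.exp (-(49 / 2048 * T) + 3 / 4 * |z|)
          = 1 / 4 * Real.exp (-(49 / 2048 * T) + 3 / 4 * |z|) := by
        simp
      rw [← h1]
      refine le_trans (setIntegral_mono_on (by simp) hwi.integrableOn measurableSet_Icc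
        fun s hs => ?_) (setIntegral_le_integral hwi (ae_of_all _ fun u => (hw0 u).le))
      obtain ⟨h2, h3, h4⟩ := ha s hs
      simp only [hw]
      gcongr
      rw [eval_wellPotential]
      have h5 : 9 / 16 ≤ s ^ 2 := by rw [← sq_abs]; nlinarith
      have h6 : s ^ 2 ≤ 1 := by rw [← sq_abs]; nlinarith
      have h7 : (s ^ 2 - 1) ^ 2 ≤ 49 / 256 := by nlinarith
      nlinarith
    rcases le_total 0 z with hz | hz
    · refine key (-1) fun s hs => ?_
      have h1 := hs.1
      have h2 := hs.2
      rw [abs_of_nonneg hz, abs_of_nonpos (by linarith)]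
      exact ⟨by nlinarith, by linarith, by linarith⟩
    · refine key (3 / 4) fun s hs => ?_
      have h1 := hs.1
      have h2 := hs.2
      rw [abs_of_nonpos hz, abs_of_nonneg (by linarith)]
      exact ⟨by nlinarith, by linarith, by linarith⟩
  have hmid : ∫ s in Set.Icc (-(1 / 2) : ℝ) (1 / 2), w s
      ≤ Real.exp (-(9 / 128 * T) + 1 / 2 * |z|) := by
    have h1 : ∫ s in Set.Icc (-(1 / 2) : ℝ) (1 / 2), Real.exp (-(9 / 128 * T) + 1 / 2 * |z|)
        = Real.exp (-(9 / 128 * T) + 1 / 2 * |z|) := by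
      simp
      norm_num
    rw [← h1]
    refine setIntegral_mono_on hwi.integrableOn (by simp) measurableSet_Icc fun s hs => ?_
    simp only [hw]
    gcongr
    rw [eval_wellPotential]
    have h2 : |s| ≤ 1 / 2 := abs_le.2 hs
    have h3 : s ^ 2 ≤ 1 / 4 := by rw [← sq_abs]; nlinarith [abs_nonneg s]
    have h4 : 9 / 16 ≤ (s ^ 2 - 1) ^ 2 := by nlinarith
    have h5 : |z * s| ≤ |z| * (1 / 2) := by rw [abs_mul]; gcongr
    have h6 := neg_le_of_abs_le h5
    nlinarith
  -- The tilt helps the middle interval by at most `1/2 |z|`, less than `3/4 |z|`, and `9/128 -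
  -- 49/2048 > 1/32`; so the bound is uniform in `z`.
  have hmid2 : ∫ s in Set.Icc (-(1 / 2) : ℝ) (1 / 2), w s
      ≤ 4 * Real.exp (-(T / 32)) * ∫ s, w s := by
    refine hmid.trans (le_trans ?_ (mul_le_mul_of_nonneg_left hZ (by positivity)))
    rw [show 4 * Real.exp (-(T / 32)) * (1 / 4 * Real.exp (-(49 / 2048 * T) + 3 / 4 * |z|))
      = Real.exp (-(T / 32)) * Real.exp (-(49 / 2048 * T) + 3 / 4 * |z|) by ring, ← Real.exp_add]
    refine Real.exp_le_exp.2 ?_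
    linarith [abs_nonneg z]
  have hmain : ∫ s, ((X ^ 2 - 1) ^ (2 * k) : ℝ[X]).eval s * w s
      ≤ 4 * (∫ s, (X ^ 2 * (X ^ 2 - 1) ^ (2 * k) : ℝ[X]).eval s * w s)
        + ∫ s in Set.Icc (-(1 / 2) : ℝ) (1 / 2), w s := by
    rw [← integral_indicator measurableSet_Icc, ← integral_const_mul,
      ← integral_add ((hQ.integrable _).const_mul 4) (hwi.indicator measurableSet_Icc)]
    refine integral_mono (hQ.integrable _)
      (((hQ.integrable _).const_mul 4).add (hwi.indicator measurableSet_Icc)) fun s => ?_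
    simp only [eval_pow, eval_mul, eval_sub, eval_X, eval_one]
    have hpow : 0 ≤ (s ^ 2 - 1) ^ (2 * k) := (even_two_mul k).pow_nonneg _
    by_cases hs : s ∈ Set.Icc (-(1 / 2) : ℝ) (1 / 2)
    · rw [Set.indicator_of_mem hs]
      have h2 : |s| ≤ 1 / 2 := abs_le.2 hs
      have h3 : s ^ 2 ≤ 1 / 4 := by rw [← sq_abs]; nlinarith [abs_nonneg s]
      have h4 : (s ^ 2 - 1) ^ (2 * k) ≤ 1 := by
        rw [pow_mul]
        exact pow_le_one₀ (sq_nonneg _) (by nlinarith [sq_nonneg s])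
      have h5 : 0 ≤ s ^ 2 * (s ^ 2 - 1) ^ (2 * k) * w s := by
        have := hw0 s
        positivity
      nlinarith [hw0 s]
    · rw [Set.indicator_of_notMem hs, add_zero]
      have h2 : 1 / 2 < |s| := by
        by_contra! h
        exact hs (abs_le.1 h)
      have h3 : 1 ≤ 4 * s ^ 2 := by rw [← sq_abs]; nlinarith
      have h4 : 0 ≤ (s ^ 2 - 1) ^ (2 * k) * w s := mul_nonneg hpow (hw0 s).le
      nlinarith
  have hZ0 := hQ.partition_pos
  rw [gibbsMean_apply, gibbsMean_apply, div_le_iff₀ hZ0, add_mul, mul_assoc,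
    div_mul_cancel₀ _ hZ0.ne']
  linarith

/-- Integration by parts evaluates `⟨s² (s² - 1)⟩`, which is at least `3 ⟨s²⟩ - 4`. The tilt term is
at most `(z / T)² + ⟨s²⟩` and is absorbed on the left. -/
theorem gibbsMean_sq_le (hT1 : 1 ≤ T) (hz : |z| ≤ T) :
    gibbsMean (isConfining_wellPotential z hT) (X ^ 2) ≤ 4 := by
  have hQ := isConfining_wellPotential z hT
  have h := gibbsMean_wellPotential_mul (z := z) hT X
  rw [derivative_X, gibbsMean_one] at h
  set y := T⁻¹ * z with hy
  have hy1 : y ^ 2 ≤ 1 := by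
    rw [sq_le_one_iff_abs_le_one, hy, abs_mul, abs_of_pos (inv_pos.2 hT), inv_mul_eq_div]
    exact (div_le_one hT).2 hz
  have hT' : T⁻¹ ≤ 1 := inv_le_one_of_one_le₀ hT1
  have h1 : gibbsMean hQ (C 3 * X ^ 2 - C 4) ≤ gibbsMean hQ (X * (X * (X ^ 2 - 1))) :=
    gibbsMean_mono hQ fun s => by
      simp only [eval_mul, eval_sub, eval_pow, eval_X, eval_one, eval_C]
      nlinarith [sq_nonneg (s ^ 2 - 2)]
  have h2 : gibbsMean hQ (C (-2 * y) * X) ≤ gibbsMean hQ (C (y ^ 2) + X ^ 2) :=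
    gibbsMean_mono hQ fun s => by
      simp only [eval_mul, eval_add, eval_pow, eval_X, eval_C]
      nlinarith [sq_nonneg (s + y)]
  rw [map_sub, gibbsMean_C_mul, gibbsMean_C, h] at h1
  rw [map_add, gibbsMean_C_mul, gibbsMean_C] at h2
  nlinarith

/-- Integration by parts with `p = s (s² - 1)²ᵏ⁺¹`. The tilt term has no sign; completing a square
moves half of the left side against it, hence the factor `1/2`. -/
theorem half_mul_gibbsMean_sq_mul_le (k : ℕ) :
    1 / 2 * gibbsMean (isConfining_wellPotential z hT) (X ^ 2 * (X ^ 2 - 1) ^ (2 * (k + 1)))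
      ≤ (8 * k + 6) * T⁻¹ *
          gibbsMean (isConfining_wellPotential z hT) (X ^ 2 * (X ^ 2 - 1) ^ (2 * k))
        + 2 * (T⁻¹ * z) ^ 2 *
          gibbsMean (isConfining_wellPotential z hT) ((X ^ 2 - 1) ^ (2 * k)) := by
  have hQ := isConfining_wellPotential z hT
  have h := gibbsMean_wellPotential_mul (z := z) hT (X * (X ^ 2 - 1) ^ (2 * k + 1))
  rw [derivative_X_mul_sq_sub_one_pow, map_add, gibbsMean_C_mul, Nat.add_sub_cancel,
    show (X * (X ^ 2 - 1) ^ (2 * k + 1) * (X * (X ^ 2 - 1)) : ℝ[X])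
      = X ^ 2 * (X ^ 2 - 1) ^ (2 * (k + 1)) by ring] at h
  have h1 : gibbsMean hQ ((X ^ 2 - 1) ^ (2 * k + 1))
      ≤ gibbsMean hQ (X ^ 2 * (X ^ 2 - 1) ^ (2 * k)) :=
    gibbsMean_mono hQ fun s => by
      simp only [eval_mul, eval_sub, eval_pow, eval_X, eval_one]
      have hpow : 0 ≤ (s ^ 2 - 1) ^ (2 * k) := (even_two_mul k).pow_nonneg _
      rw [pow_succ]
      nlinarith
  set y := T⁻¹ * z with hy
  have h2 : gibbsMean hQ (C (-2 * y) * (X * (X ^ 2 - 1) ^ (2 * k + 1)))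
      ≤ gibbsMean hQ (C (1 / 2) * (X ^ 2 * (X ^ 2 - 1) ^ (2 * (k + 1)))
        + C (2 * y ^ 2) * (X ^ 2 - 1) ^ (2 * k)) :=
    gibbsMean_mono hQ fun s => by
      simp only [eval_mul, eval_sub, eval_add, eval_pow, eval_X, eval_one, eval_C]
      have h3 := mul_nonneg ((even_two_mul k).pow_nonneg (s ^ 2 - 1))
        (sq_nonneg (s * (s ^ 2 - 1) + 2 * y))
      have e1 : (s ^ 2 - 1) ^ (2 * k + 1) = (s ^ 2 - 1) ^ (2 * k) * (s ^ 2 - 1) := by ring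
      have e2 : (s ^ 2 - 1) ^ (2 * (k + 1)) = (s ^ 2 - 1) ^ (2 * k) * (s ^ 2 - 1) ^ 2 := by ring
      rw [e1, e2]
      linarith
  rw [map_add, gibbsMean_C_mul, gibbsMean_C_mul, gibbsMean_C_mul] at h2
  have h3 := mul_le_mul_of_nonneg_left h1 (inv_pos.2 hT).le
  push_cast at h
  linarith

/-- The moments weighted by `s²` gain a factor `(1 + |z|) / T` per step, by integration by parts.
The weight is then removed at the price of an exponentially small term, which is below any power of
`T⁻¹`. -/
theorem exists_gibbsMean_even_le (k : ℕ) : ∃ K : ℝ, 0 ≤ K ∧ ∀ (z T : ℝ) (hT : 0 < T), 1 ≤ T →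
    |z| ≤ T →
    gibbsMean (isConfining_wellPotential z hT) (X ^ 2 * (X ^ 2 - 1) ^ (2 * k))
        ≤ K * ((1 + |z|) / T) ^ k ∧
      gibbsMean (isConfining_wellPotential z hT) ((X ^ 2 - 1) ^ (2 * k))
        ≤ K * ((1 + |z|) / T) ^ k := by
  induction k with
  | zero =>
    refine ⟨4, by norm_num, fun z T hT hT1 hz => ⟨?_, ?_⟩⟩
    · simpa using gibbsMean_sq_le hT hT1 hz
    · simp [gibbsMean_one]
  | succ k ih =>
    obtain ⟨K, hK0, hK⟩ := ih
    set S := 2 * ((8 * k + 6) * K + 2 * K) with hS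
    have hS0 : 0 ≤ S := by positivity
    set M : ℝ := 4 * ((k + 1).factorial * 32 ^ (k + 1)) with hM
    have hM0 : 0 ≤ M := by positivity
    refine ⟨4 * S + M, by positivity, fun z T hT hT1 hz => ?_⟩
    obtain ⟨h1, h2⟩ := hK z T hT hT1 hz
    have h3 := half_mul_gibbsMean_sq_mul_le (z := z) hT k
    have h4 := gibbsMean_even_pow_le (z := z) hT (k + 1)
    set ρ := (1 + |z|) / T with hρ
    have hρ0 : 0 < ρ := by positivity
    have hTρ : T⁻¹ ≤ ρ := by
      rw [hρ, ← one_div]; gcongr; linarith [abs_nonneg z]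
    have hyρ : (T⁻¹ * z) ^ 2 ≤ ρ := by
      have e1 : |T⁻¹ * z| ≤ 1 := by
        rw [abs_mul, abs_of_pos (inv_pos.2 hT), inv_mul_eq_div]
        exact (div_le_one hT).2 hz
      have e2 : |T⁻¹ * z| ≤ ρ := by
        rw [abs_mul, abs_of_pos (inv_pos.2 hT), inv_mul_eq_div, hρ]
        gcongr; linarith
      rw [← sq_abs]
      nlinarith [abs_nonneg (T⁻¹ * z)]
    have hSk : gibbsMean (isConfining_wellPotential z hT) (X ^ 2 * (X ^ 2 - 1) ^ (2 * (k + 1)))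
        ≤ S * ρ ^ (k + 1) := by
      have e1 : (8 * k + 6) * T⁻¹ *
          gibbsMean (isConfining_wellPotential z hT) (X ^ 2 * (X ^ 2 - 1) ^ (2 * k))
          ≤ (8 * k + 6) * ρ * (K * ρ ^ k) := by
        refine le_trans (mul_le_mul_of_nonneg_left h1 (by positivity)) ?_
        gcongr
      have e2 : 2 * (T⁻¹ * z) ^ 2 *
          gibbsMean (isConfining_wellPotential z hT) ((X ^ 2 - 1) ^ (2 * k))
          ≤ 2 * ρ * (K * ρ ^ k) := by
        refine le_trans (mul_le_mul_of_nonneg_left h2 (by positivity)) ?_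
        gcongr
      have e3 : S * ρ ^ (k + 1) = 2 * ((8 * k + 6) * ρ * (K * ρ ^ k) + 2 * ρ * (K * ρ ^ k)) := by
        rw [hS, pow_succ]; ring
      linarith
    have hexp : 4 * Real.exp (-(T / 32)) ≤ M * ρ ^ (k + 1) := by
      have e1 := Real.pow_div_factorial_le_exp (T / 32) (by positivity) (k + 1)
      have e2 : Real.exp (-(T / 32)) ≤ (k + 1).factorial * 32 ^ (k + 1) * T⁻¹ ^ (k + 1) := by
        rw [Real.exp_neg]
        refine (inv_anti₀ (by positivity) e1).trans (le_of_eq ?_)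
        rw [inv_div, div_pow, inv_pow]
        field_simp
      have e3 : T⁻¹ ^ (k + 1) ≤ ρ ^ (k + 1) := by gcongr
      have e4 := mul_le_mul_of_nonneg_left e3
        (by positivity : (0 : ℝ) ≤ (k + 1).factorial * 32 ^ (k + 1))
      rw [hM]
      linarith
    have hpos : 0 ≤ ρ ^ (k + 1) := by positivity
    constructor
    · nlinarith
    · nlinarith

theorem exists_abs_gibbsMean_pow_le (k : ℕ) : ∃ K : ℝ, 0 ≤ K ∧ ∀ (z T : ℝ) (hT : 0 < T), 1 ≤ T →
    |z| ≤ T →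
    |gibbsMean (isConfining_wellPotential z hT) ((X ^ 2 - 1) ^ k)| ≤ K * ((1 + |z|) / T) ^ (k / 2) ∧
      |gibbsMean (isConfining_wellPotential z hT) (X * (X ^ 2 - 1) ^ k)|
        ≤ K * ((1 + |z|) / T) ^ (k / 2) := by
  obtain ⟨K, hK0, hK⟩ := exists_gibbsMean_even_le (k / 2)
  obtain ⟨K', hK0', hK'⟩ := exists_gibbsMean_even_le (k / 2 + 1)
  refine ⟨2 * K + 4 * K', by positivity, fun z T hT hT1 hz => ?_⟩
  have hQ := isConfining_wellPotential z hT
  obtain ⟨h1, h2⟩ := hK z T hT hT1 hz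
  obtain ⟨h1', h2'⟩ := hK' z T hT hT1 hz
  set ρ := (1 + |z|) / T with hρ
  have hρ0 : 0 < ρ := by positivity
  have hρ2 : ρ ≤ 2 := by
    rw [hρ, div_le_iff₀ hT]; linarith
  have hρk : K' * ρ ^ (k / 2 + 1) ≤ 2 * K' * ρ ^ (k / 2) := by
    rw [pow_succ]
    have : K' * ρ ^ (k / 2) * ρ ≤ K' * ρ ^ (k / 2) * 2 := by gcongr
    linarith
  -- An odd power lies below the sum of the two neighbouring even ones. This loses half an order,
  -- hence the exponent `k / 2` in integer division.
  have habs : ∀ s : ℝ, |s ^ 2 - 1| ^ k ≤ (s ^ 2 - 1) ^ (2 * (k / 2))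
      + (s ^ 2 - 1) ^ (2 * (k / 2 + 1)) := by
    intro s
    have e1 : 0 ≤ (s ^ 2 - 1) ^ (2 * (k / 2)) := (even_two_mul _).pow_nonneg _
    have e2 : 0 ≤ (s ^ 2 - 1) ^ (2 * (k / 2 + 1)) := (even_two_mul _).pow_nonneg _
    rcases Nat.even_or_odd' k with ⟨j, rfl | rfl⟩
    · rw [Nat.mul_div_cancel_left _ two_pos] at *
      rw [(even_two_mul j).pow_abs]
      linarith
    · rw [show (2 * j + 1) / 2 = j by omega] at *
      rw [← (even_two_mul j).pow_abs] at e1 ⊢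
      rw [← (even_two_mul (j + 1)).pow_abs (s ^ 2 - 1)]
      have e3 : |s ^ 2 - 1| ≤ 1 + |s ^ 2 - 1| ^ 2 := by
        nlinarith [sq_nonneg (|s ^ 2 - 1| - 1), abs_nonneg (s ^ 2 - 1)]
      calc |s ^ 2 - 1| ^ (2 * j + 1) = |s ^ 2 - 1| ^ (2 * j) * |s ^ 2 - 1| := by ring
        _ ≤ |s ^ 2 - 1| ^ (2 * j) * (1 + |s ^ 2 - 1| ^ 2) := by gcongr
        _ = _ := by ring
  constructor
  · refine (abs_gibbsMean_le hQ (q := (X ^ 2 - 1) ^ (2 * (k / 2))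
      + (X ^ 2 - 1) ^ (2 * (k / 2 + 1))) fun s => ?_).trans ?_
    · simpa [abs_pow] using habs s
    · rw [map_add]
      have e1 : 0 ≤ K * ρ ^ (k / 2) := by positivity
      have e2 : 0 ≤ K' * ρ ^ (k / 2) := by positivity
      linarith
  · refine (abs_gibbsMean_le hQ (q := X ^ 2 * (X ^ 2 - 1) ^ (2 * (k / 2))
      + (X ^ 2 - 1) ^ (2 * (k / 2)) + (X ^ 2 * (X ^ 2 - 1) ^ (2 * (k / 2 + 1))
      + (X ^ 2 - 1) ^ (2 * (k / 2 + 1)))) fun s => ?_).trans ?_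
    · simp only [eval_mul, eval_add, eval_pow, eval_sub, eval_X, eval_one, abs_mul, abs_pow]
      have e1 : |s| ≤ 1 + s ^ 2 := by nlinarith [sq_abs s, sq_nonneg (|s| - 1), abs_nonneg s]
      calc |s| * |s ^ 2 - 1| ^ k ≤ (1 + s ^ 2) * ((s ^ 2 - 1) ^ (2 * (k / 2))
          + (s ^ 2 - 1) ^ (2 * (k / 2 + 1))) := by gcongr; exact habs s
        _ = _ := by ring
    · rw [map_add, map_add, map_add]
      linarith

end WellMoments

/-! ### Formal solution of the moment identities in terms of the mean. -/

section WellCoefficients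

open Polynomial

/-- Right-hand side of the recursion for the even moments of the double well. -/
noncomputable def wellSource (x y : ℕ → ℝ → ℝ → ℝ) (k : ℕ) (z m : ℝ) : ℝ :=
  -2 * (z * y k z m) + (2 + 4 * k) * x k z m + 4 * k * x (k - 1) z m

/-- The coefficients of `T⁻ʲ` in the formal expansions of the moments `⟨(s² - 1)ᵏ⟩` (first
component) and `⟨s (s² - 1)ᵏ⟩` (second component), as functions of `z` and `m = ⟨s⟩`. -/
noncomputable def wellCoeff : ℕ → (ℕ → ℝ → ℝ → ℝ) × (ℕ → ℝ → ℝ → ℝ)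
  | 0 => (fun k _ _ => if k = 0 then 1 else 0, fun k _ m => if k = 0 then m else 0)
  | j + 1 =>
    (fun k z m => if k = 0 then 0 else ∑ i ∈ Finset.range (2 * j + 3),
        (-1) ^ i * wellSource (wellCoeff j).1 (wellCoeff j).2 (k - 1 + i) z m,
      fun k z m => if k = 0 then 0 else
        -2 * (z * (wellCoeff j).1 (k - 1) z m)
          + 4 * ((k - 1 : ℕ) : ℝ) * (wellCoeff j).2 (k - 2) z m)

theorem wellCoeff_succ_snd (j k : ℕ) (z m : ℝ) :
    (wellCoeff (j + 1)).2 (k + 1) z m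
      = -2 * (z * (wellCoeff j).1 k z m) + 4 * k * (wellCoeff j).2 (k - 1) z m := by
  simp [wellCoeff]

/-- Each order in `T⁻¹` reaches at most two moments further, the formal counterpart of the size `((1
+ |z|) / T)^(k / 2)` of the moments. -/
theorem wellCoeff_eq_zero (j k : ℕ) (h : 2 * j < k) (z m : ℝ) :
    (wellCoeff j).1 k z m = 0 ∧ (wellCoeff j).2 k z m = 0 := by
  induction j generalizing k with
  | zero => simp [wellCoeff, show k ≠ 0 by omega]
  | succ j ih =>
    obtain ⟨k, rfl⟩ := Nat.exists_eq_succ_of_ne_zero (show k ≠ 0 by omega)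
    constructor
    · simp only [wellCoeff, Nat.succ_eq_add_one, Nat.add_one_ne_zero, if_false,
        Nat.add_sub_cancel]
      refine Finset.sum_eq_zero fun i _ => ?_
      rw [wellSource, (ih (k + i) (by omega)).2, (ih (k + i) (by omega)).1,
        (ih (k + i - 1) (by omega)).1]
      simp
    · rw [Nat.succ_eq_add_one, wellCoeff_succ_snd, (ih k (by omega)).1,
        (ih (k - 1) (by omega)).2]
      simp

/-- The relation `x (k + 1) + x (k + 2) = R k` is solved from above by `R k - R (k + 1) + R (k + 2)
- ⋯`. The series is finite because `R` vanishes beyond index `2 j + 1`. -/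
theorem wellCoeff_succ_fst_add (j k : ℕ) (z m : ℝ) :
    (wellCoeff (j + 1)).1 (k + 1) z m + (wellCoeff (j + 1)).1 (k + 2) z m
      = wellSource (wellCoeff j).1 (wellCoeff j).2 k z m := by
  set R := fun k => wellSource (wellCoeff j).1 (wellCoeff j).2 k z m with hR
  have h1 : ∀ k, (wellCoeff (j + 1)).1 (k + 1) z m
      = ∑ i ∈ Finset.range (2 * j + 3), (-1) ^ i * R (k + i) := by
    intro k; simp [wellCoeff, hR]
  have h0 : R (k + 1 + (2 * j + 2)) = 0 := by
    simp only [hR, wellSource]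
    rw [(wellCoeff_eq_zero j _ (by omega) z m).2, (wellCoeff_eq_zero j _ (by omega) z m).1,
      (wellCoeff_eq_zero j _ (by omega) z m).1]
    simp
  rw [h1 k, show k + 2 = k + 1 + 1 by ring, h1 (k + 1), Finset.sum_range_succ',
    Finset.sum_range_succ (fun i => (-1) ^ i * R (k + 1 + i)), h0]
  have h2 : ∑ i ∈ Finset.range (2 * j + 2), (-1) ^ (i + 1) * R (k + (i + 1))
      = -∑ i ∈ Finset.range (2 * j + 2), (-1) ^ i * R (k + 1 + i) := by
    rw [← Finset.sum_neg_distrib]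
    refine Finset.sum_congr rfl fun i _ => ?_
    rw [show k + (i + 1) = k + 1 + i by ring, pow_succ]; ring
  rw [h2]
  simp [hR]

/-- Smooth in `z`, affine in `m`, and of growth order `j` in `z`. -/
structure IsWellTerm (j : ℕ) (f : ℝ → ℝ → ℝ) : Prop where
  affine : ∀ z m, f z m = f z 0 + m * (f z 1 - f z 0)
  contDiff : ∀ m, ContDiff ℝ ∞ fun z => f z m
  growth : ∃ K : ℝ, 0 ≤ K ∧ ∀ z m, |f z m| ≤ K * (1 + |m|) * (1 + |z|) ^ j

theorem IsWellTerm.zero (j : ℕ) : IsWellTerm j fun _ _ => 0 :=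
  ⟨by simp, fun _ => contDiff_const, 0, le_rfl, by simp⟩

theorem IsWellTerm.add {j : ℕ} {f g : ℝ → ℝ → ℝ} (hf : IsWellTerm j f) (hg : IsWellTerm j g) :
    IsWellTerm j fun z m => f z m + g z m := by
  obtain ⟨K, hK0, hK⟩ := hf.growth
  obtain ⟨L, hL0, hL⟩ := hg.growth
  refine ⟨fun z m => ?_, fun m => (hf.contDiff m).add (hg.contDiff m), K + L, by positivity,
    fun z m => ?_⟩
  · rw [hf.affine z m, hg.affine z m]; ring
  · refine (abs_add_le _ _).trans ((add_le_add (hK z m) (hL z m)).trans (le_of_eq ?_))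
    ring

theorem IsWellTerm.const_mul {j : ℕ} {f : ℝ → ℝ → ℝ} (hf : IsWellTerm j f) (a : ℝ) :
    IsWellTerm j fun z m => a * f z m := by
  obtain ⟨K, hK0, hK⟩ := hf.growth
  refine ⟨fun z m => ?_, fun m => contDiff_const.mul (hf.contDiff m), |a| * K, by positivity,
    fun z m => ?_⟩
  · rw [hf.affine z m]; ring
  · rw [abs_mul, mul_assoc, mul_assoc, ← mul_assoc K]
    gcongr
    exact hK z m

theorem IsWellTerm.succ {j : ℕ} {f : ℝ → ℝ → ℝ} (hf : IsWellTerm j f) : IsWellTerm (j + 1) f := by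
  obtain ⟨K, hK0, hK⟩ := hf.growth
  refine ⟨hf.affine, hf.contDiff, K, hK0, fun z m => (hK z m).trans ?_⟩
  gcongr
  · linarith [abs_nonneg z]
  · omega

theorem IsWellTerm.id_mul {j : ℕ} {f : ℝ → ℝ → ℝ} (hf : IsWellTerm j f) :
    IsWellTerm (j + 1) fun z m => z * f z m := by
  obtain ⟨K, hK0, hK⟩ := hf.growth
  refine ⟨fun z m => ?_, fun m => contDiff_id.mul (hf.contDiff m), K, hK0, fun z m => ?_⟩
  · rw [hf.affine z m]; ring
  · rw [abs_mul, pow_succ]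
    calc |z| * |f z m| ≤ (1 + |z|) * (K * (1 + |m|) * (1 + |z|) ^ j) := by
          gcongr
          · linarith
          · exact hK z m
      _ = _ := by ring

theorem IsWellTerm.sum {j : ℕ} {ι : Type*} (s : Finset ι) {f : ι → ℝ → ℝ → ℝ}
    (hf : ∀ i ∈ s, IsWellTerm j (f i)) : IsWellTerm j fun z m => ∑ i ∈ s, f i z m := by
  classical
  induction s using Finset.induction_on with
  | empty => simpa using IsWellTerm.zero j
  | insert a s ha ih =>
    simp only [Finset.sum_insert ha]
    exact (hf a (by simp)).add (ih fun i hi => hf i (by simp [hi]))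

/-- The recursion multiplies only by constants and by `z`, so `m` never meets itself, and each order
adds at most one power of `z`. Affinity in `m` is what makes the equation for the mean a Riccati
equation. -/
theorem isWellTerm_wellCoeff (j k : ℕ) :
    IsWellTerm j ((wellCoeff j).1 k) ∧ IsWellTerm j ((wellCoeff j).2 k) := by
  induction j generalizing k with
  | zero =>
    rcases k with _ | k
    · constructor
      · refine ⟨by simp [wellCoeff], fun m => ?_, 1, by norm_num, fun z m => ?_⟩
        · simpa [wellCoeff] using contDiff_const
        · simp [wellCoeff]
      · refine ⟨by simp [wellCoeff], fun m => ?_, 1, by norm_num, fun z m => ?_⟩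
        · simpa [wellCoeff] using contDiff_const
        · simp [wellCoeff]
    · constructor
      · convert IsWellTerm.zero 0 using 1
        funext z m
        simp [wellCoeff]
      · convert IsWellTerm.zero 0 using 1
        funext z m
        simp [wellCoeff]
  | succ j ih =>
    rcases k with _ | k
    · constructor
      · convert IsWellTerm.zero (j + 1) using 1
        funext z m
        simp [wellCoeff]
      · convert IsWellTerm.zero (j + 1) using 1
        funext z m
        simp [wellCoeff]
    · constructor
      · have h := IsWellTerm.sum (j := j + 1) (Finset.range (2 * j + 3)) (f := fun i z m =>
          (-1) ^ i * wellSource (wellCoeff j).1 (wellCoeff j).2 (k + i) z m) fun i _ =>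
            ((((ih (k + i)).2.id_mul.const_mul (-2)).add
              ((ih (k + i)).1.succ.const_mul (2 + 4 * ((k + i : ℕ) : ℝ)))).add
              ((ih (k + i - 1)).1.succ.const_mul (4 * ((k + i : ℕ) : ℝ)))).const_mul ((-1) ^ i)
        convert h using 1
        funext z m
        simp [wellCoeff]
      · have h := ((ih k).1.id_mul.const_mul (-2)).add ((ih (k - 1)).2.succ.const_mul (4 * k))
        convert h using 1
        funext z m
        exact wellCoeff_succ_snd j k z m

/-- Induction on the order `J`. The relation for `⟨s (s² - 1)ᵏ⁺¹⟩` passes to the next order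
directly. The relation for the even moments bounds only sums of neighbours, so it is run downwards
from a high moment that is negligible by itself. -/
theorem exists_abs_wellMoment_sub_le (J : ℕ) : ∀ k : ℕ, ∃ K : ℝ, 0 ≤ K ∧
    ∀ (z T : ℝ) (hT : 0 < T), 1 ≤ T → |z| ≤ T →
    |gibbsMean (isConfining_wellPotential z hT) ((X ^ 2 - 1) ^ k)
        - ∑ j ∈ Finset.range J, T⁻¹ ^ j * (wellCoeff j).1 k z (wellMean z T)|
        ≤ K * ((1 + |z|) / T) ^ J ∧
      |gibbsMean (isConfining_wellPotential z hT) (X * (X ^ 2 - 1) ^ k)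
        - ∑ j ∈ Finset.range J, T⁻¹ ^ j * (wellCoeff j).2 k z (wellMean z T)|
        ≤ K * ((1 + |z|) / T) ^ J := by
  induction J with
  | zero =>
    intro k
    obtain ⟨K, hK0, hK⟩ := exists_abs_gibbsMean_pow_le k
    refine ⟨K * 2 ^ (k / 2), by positivity, fun z T hT hT1 hz => ?_⟩
    have hρ2 : (1 + |z|) / T ≤ 2 := by
      rw [div_le_iff₀ hT]; linarith
    have h2 : K * ((1 + |z|) / T) ^ (k / 2) ≤ K * 2 ^ (k / 2) := by gcongr
    simpa using ⟨(hK z T hT hT1 hz).1.trans h2, (hK z T hT hT1 hz).2.trans h2⟩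
  | succ J ih =>
    have hy : ∀ k : ℕ, ∃ K : ℝ, 0 ≤ K ∧ ∀ (z T : ℝ) (hT : 0 < T), 1 ≤ T → |z| ≤ T →
        |gibbsMean (isConfining_wellPotential z hT) (X * (X ^ 2 - 1) ^ k)
          - ∑ j ∈ Finset.range (J + 1), T⁻¹ ^ j * (wellCoeff j).2 k z (wellMean z T)|
          ≤ K * ((1 + |z|) / T) ^ (J + 1) := by
      intro k
      rcases k with _ | k
      · refine ⟨0, le_rfl, fun z T hT hT1 hz => ?_⟩
        rw [Finset.sum_range_succ']
        simpa [wellCoeff, sub_eq_zero] using gibbsMean_wellPotential_X z hT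
      obtain ⟨K1, hK10, hK1⟩ := ih k
      obtain ⟨K2, hK20, hK2⟩ := ih (k - 1)
      refine ⟨2 * K1 + 4 * k * K2, by positivity, fun z T hT hT1 hz => ?_⟩
      obtain ⟨h1, -⟩ := hK1 z T hT hT1 hz
      obtain ⟨-, h2⟩ := hK2 z T hT hT1 hz
      have hs : ∑ j ∈ Finset.range (J + 1), T⁻¹ ^ j * (wellCoeff j).2 (k + 1) z (wellMean z T)
          = T⁻¹ * (-2 * z * ∑ j ∈ Finset.range J, T⁻¹ ^ j * (wellCoeff j).1 k z (wellMean z T)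
            + 4 * k * ∑ j ∈ Finset.range J,
              T⁻¹ ^ j * (wellCoeff j).2 (k - 1) z (wellMean z T)) := by
        rw [Finset.sum_range_succ', Finset.mul_sum, Finset.mul_sum, ← Finset.sum_add_distrib,
          Finset.mul_sum]
        rw [show (wellCoeff 0).2 (k + 1) z (wellMean z T) = 0 by simp [wellCoeff], mul_zero,
          add_zero]
        refine Finset.sum_congr rfl fun j _ => ?_
        rw [wellCoeff_succ_snd, pow_succ]; ring
      have hr := gibbsMean_X_mul_pow_succ (z := z) hT k
      set ρ := (1 + |z|) / T with hρ
      have hρ0 : 0 < ρ := by positivity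
      have hTρ : T⁻¹ ≤ ρ := by
        rw [hρ, ← one_div]; gcongr; linarith [abs_nonneg z]
      have hzρ : T⁻¹ * |z| ≤ ρ := by
        rw [hρ, inv_mul_eq_div]; gcongr; linarith
      generalize gibbsMean (isConfining_wellPotential z hT) (X * (X ^ 2 - 1) ^ (k + 1)) = c1 at *
      generalize gibbsMean (isConfining_wellPotential z hT) ((X ^ 2 - 1) ^ k) = a1 at *
      generalize gibbsMean (isConfining_wellPotential z hT) (X * (X ^ 2 - 1) ^ (k - 1)) = a2 at *
      generalize ∑ j ∈ Finset.range (J + 1),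
        T⁻¹ ^ j * (wellCoeff j).2 (k + 1) z (wellMean z T) = d1 at *
      generalize ∑ j ∈ Finset.range J, T⁻¹ ^ j * (wellCoeff j).1 k z (wellMean z T) = b1 at *
      generalize ∑ j ∈ Finset.range J,
        T⁻¹ ^ j * (wellCoeff j).2 (k - 1) z (wellMean z T) = b2 at *
      have e0 : c1 - d1 = T⁻¹ * (-(2 * z * (a1 - b1))) + T⁻¹ * (4 * k * (a2 - b2)) := by
        linear_combination hr - hs
      have e1 : |T⁻¹ * (-(2 * z * (a1 - b1)))| ≤ 2 * ρ * (K1 * ρ ^ J) := by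
        calc |T⁻¹ * (-(2 * z * (a1 - b1)))| = 2 * (T⁻¹ * |z|) * |a1 - b1| := by
              rw [abs_mul, abs_neg, abs_mul, abs_mul, abs_of_pos (two_pos (α := ℝ)),
                abs_of_pos (inv_pos.2 hT)]
              ring
          _ ≤ _ := by gcongr
      have e3 : |T⁻¹ * (4 * k * (a2 - b2))| ≤ ρ * (4 * k * (K2 * ρ ^ J)) := by
        rw [abs_mul, abs_mul, abs_of_pos (inv_pos.2 hT),
          abs_of_nonneg (by positivity : (0 : ℝ) ≤ 4 * k)]
        gcongr
      rw [e0]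
      refine (abs_add_le _ _).trans ((add_le_add e1 e3).trans (le_of_eq ?_))
      ring
    -- Downward induction on `k`, with `n` bounding the distance to `2 J + 2`. From there on the
    -- crude moment bound is already of order `J + 1` and all coefficients in the sum vanish.
    have hx : ∀ n k : ℕ, 2 * J + 2 ≤ k + n → ∃ K : ℝ, 0 ≤ K ∧ ∀ (z T : ℝ) (hT : 0 < T),
        1 ≤ T → |z| ≤ T →
        |gibbsMean (isConfining_wellPotential z hT) ((X ^ 2 - 1) ^ k)
          - ∑ j ∈ Finset.range (J + 1), T⁻¹ ^ j * (wellCoeff j).1 k z (wellMean z T)|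
          ≤ K * ((1 + |z|) / T) ^ (J + 1) := by
      intro n
      induction n with
      | zero =>
        intro k hk
        obtain ⟨K, hK0, hK⟩ := exists_abs_gibbsMean_pow_le k
        obtain ⟨i, hi⟩ : ∃ i, k / 2 = J + 1 + i := ⟨k / 2 - (J + 1), by omega⟩
        refine ⟨K * 2 ^ i, by positivity, fun z T hT hT1 hz => ?_⟩
        rw [Finset.sum_eq_zero, sub_zero]
        · refine (hK z T hT hT1 hz).1.trans ?_
          have hρ2 : (1 + |z|) / T ≤ 2 := by
            rw [div_le_iff₀ hT]; linarith
          rw [hi, pow_add]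
          have : ((1 + |z|) / T) ^ i ≤ 2 ^ i := by gcongr
          calc K * (((1 + |z|) / T) ^ (J + 1) * ((1 + |z|) / T) ^ i)
              ≤ K * (((1 + |z|) / T) ^ (J + 1) * 2 ^ i) := by gcongr
            _ = _ := by ring
        · intro j hj
          rw [(wellCoeff_eq_zero j k (by have := Finset.mem_range.1 hj; omega) _ _).1, mul_zero]
      | succ n ihn =>
        intro k hk
        rcases k with _ | k
        · refine ⟨0, le_rfl, fun z T hT hT1 hz => ?_⟩
          rw [Finset.sum_range_succ']
          simp [wellCoeff, gibbsMean_one]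
        obtain ⟨K0, hK00, hK0⟩ := ihn (k + 2) (by omega)
        obtain ⟨K1, hK10, hK1⟩ := ih k
        obtain ⟨K2, hK20, hK2⟩ := ih (k - 1)
        refine ⟨K0 + (2 * K1 + (2 + 4 * k) * K1 + 4 * k * K2), by positivity,
          fun z T hT hT1 hz => ?_⟩
        have h0 := hK0 z T hT hT1 hz
        obtain ⟨h1, h1'⟩ := hK1 z T hT hT1 hz
        have h2 := (hK2 z T hT hT1 hz).1
        have hs : ∑ j ∈ Finset.range (J + 1), T⁻¹ ^ j * (wellCoeff j).1 (k + 1) z (wellMean z T)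
            + ∑ j ∈ Finset.range (J + 1), T⁻¹ ^ j * (wellCoeff j).1 (k + 2) z (wellMean z T)
            = T⁻¹ * (-2 * z * ∑ j ∈ Finset.range J,
                T⁻¹ ^ j * (wellCoeff j).2 k z (wellMean z T)
              + (2 + 4 * k) * ∑ j ∈ Finset.range J,
                T⁻¹ ^ j * (wellCoeff j).1 k z (wellMean z T)
              + 4 * k * ∑ j ∈ Finset.range J,
                T⁻¹ ^ j * (wellCoeff j).1 (k - 1) z (wellMean z T)) := by
          rw [← Finset.sum_add_distrib, Finset.sum_range_succ', Finset.mul_sum, Finset.mul_sum,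
            Finset.mul_sum, ← Finset.sum_add_distrib, ← Finset.sum_add_distrib, Finset.mul_sum]
          rw [show (wellCoeff 0).1 (k + 1) z (wellMean z T) = 0 by simp [wellCoeff],
            show (wellCoeff 0).1 (k + 2) z (wellMean z T) = 0 by simp [wellCoeff], mul_zero,
            add_zero, add_zero]
          refine Finset.sum_congr rfl fun j _ => ?_
          rw [← mul_add, wellCoeff_succ_fst_add, wellSource, pow_succ]; ring
        have hr := gibbsMean_pow_add (z := z) hT k
        set ρ := (1 + |z|) / T with hρ
        have hρ0 : 0 < ρ := by positivity
        have hTρ : T⁻¹ ≤ ρ := by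
          rw [hρ, ← one_div]; gcongr; linarith [abs_nonneg z]
        have hzρ : T⁻¹ * |z| ≤ ρ := by
          rw [hρ, inv_mul_eq_div]; gcongr; linarith
        generalize gibbsMean (isConfining_wellPotential z hT) ((X ^ 2 - 1) ^ (k + 1)) = c1 at *
        generalize gibbsMean (isConfining_wellPotential z hT) ((X ^ 2 - 1) ^ (k + 2)) = c2 at *
        generalize gibbsMean (isConfining_wellPotential z hT) ((X ^ 2 - 1) ^ k) = a1 at *
        generalize gibbsMean (isConfining_wellPotential z hT) (X * (X ^ 2 - 1) ^ k) = a1' at *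
        generalize gibbsMean (isConfining_wellPotential z hT) ((X ^ 2 - 1) ^ (k - 1)) = a2 at *
        generalize ∑ j ∈ Finset.range (J + 1),
          T⁻¹ ^ j * (wellCoeff j).1 (k + 1) z (wellMean z T) = d1 at *
        generalize ∑ j ∈ Finset.range (J + 1),
          T⁻¹ ^ j * (wellCoeff j).1 (k + 2) z (wellMean z T) = d2 at *
        generalize ∑ j ∈ Finset.range J, T⁻¹ ^ j * (wellCoeff j).1 k z (wellMean z T) = b1 at *
        generalize ∑ j ∈ Finset.range J, T⁻¹ ^ j * (wellCoeff j).2 k z (wellMean z T) = b1' at *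
        generalize ∑ j ∈ Finset.range J,
          T⁻¹ ^ j * (wellCoeff j).1 (k - 1) z (wellMean z T) = b2 at *
        have e0 : c1 - d1 = -(c2 - d2) + (T⁻¹ * (-(2 * z * (a1' - b1')))
            + T⁻¹ * ((2 + 4 * k) * (a1 - b1)) + T⁻¹ * (4 * k * (a2 - b2))) := by
          linear_combination hr - hs
        have hk0 : (0 : ℝ) ≤ k := Nat.cast_nonneg k
        have e1 : |T⁻¹ * (-(2 * z * (a1' - b1')))| ≤ 2 * ρ * (K1 * ρ ^ J) := by
          calc |T⁻¹ * (-(2 * z * (a1' - b1')))| = 2 * (T⁻¹ * |z|) * |a1' - b1'| := by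
                rw [abs_mul, abs_neg, abs_mul, abs_mul, abs_of_pos (two_pos (α := ℝ)),
                  abs_of_pos (inv_pos.2 hT)]
                ring
            _ ≤ _ := by gcongr
        have e2 : |T⁻¹ * ((2 + 4 * k) * (a1 - b1))| ≤ ρ * ((2 + 4 * k) * (K1 * ρ ^ J)) := by
          rw [abs_mul, abs_mul, abs_of_pos (inv_pos.2 hT),
            abs_of_nonneg (by positivity : (0 : ℝ) ≤ 2 + 4 * k)]
          gcongr
        have e3 : |T⁻¹ * (4 * k * (a2 - b2))| ≤ ρ * (4 * k * (K2 * ρ ^ J)) := by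
          rw [abs_mul, abs_mul, abs_of_pos (inv_pos.2 hT),
            abs_of_nonneg (by positivity : (0 : ℝ) ≤ 4 * k)]
          gcongr
        rw [e0]
        refine (abs_add_le _ _).trans ((add_le_add (le_of_eq (abs_neg _))
          ((abs_add_le _ _).trans (add_le_add_left (abs_add_le _ _) _))).trans ?_)
        rw [pow_succ ρ J] at h0 ⊢
        linarith
    intro k
    obtain ⟨K1, hK10, hK1⟩ := hx (2 * J + 2) k (by omega)
    obtain ⟨K2, hK20, hK2⟩ := hy k
    refine ⟨K1 + K2, by positivity, fun z T hT hT1 hz => ⟨(hK1 z T hT hT1 hz).trans ?_,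
      (hK2 z T hT hT1 hz).trans ?_⟩⟩
    · gcongr; linarith
    · gcongr; linarith

end WellCoefficients

/-! ### The inner coefficients as a perturbation series of a Riccati equation. -/

section InnerCoefficients

open MeasureTheory

/-- The solution of `y' = -2 tanh(z) y + g`, `y(0) = 0`. -/
noncomputable def sechIntegral (g : ℝ → ℝ) (z : ℝ) : ℝ :=
  (Real.cosh z ^ 2)⁻¹ * ∫ t in (0 : ℝ)..z, Real.cosh t ^ 2 * g t

theorem sechIntegral_zero (g : ℝ → ℝ) : sechIntegral g 0 = 0 := by
  simp [sechIntegral]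

theorem hasDerivAt_sechIntegral {g : ℝ → ℝ} (hg : Continuous g) (z : ℝ) :
    HasDerivAt (sechIntegral g) (-2 * Real.tanh z * sechIntegral g z + g z) z := by
  have hc : Real.cosh z ≠ 0 := (Real.cosh_pos z).ne'
  have h1 : HasDerivAt (fun z => ∫ t in (0 : ℝ)..z, Real.cosh t ^ 2 * g t)
      (Real.cosh z ^ 2 * g z) z := by
    have hcont : Continuous fun t => Real.cosh t ^ 2 * g t :=
      (Real.continuous_cosh.pow 2).mul hg
    exact (hcont.integral_hasStrictDerivAt 0 z).hasDerivAt
  have h2 := (((Real.hasDerivAt_cosh z).fun_pow 2).fun_inv (pow_ne_zero 2 hc)).fun_mul h1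
  refine h2.congr_deriv ?_
  rw [sechIntegral, Real.tanh_eq_sinh_div_cosh]
  field_simp
  push_cast
  ring

theorem contDiff_tanh : ContDiff ℝ ∞ Real.tanh := by
  have : Real.tanh = fun z => Real.sinh z / Real.cosh z := by
    funext z; exact Real.tanh_eq_sinh_div_cosh z
  rw [this]
  exact Real.contDiff_sinh.div Real.contDiff_cosh fun z => (Real.cosh_pos z).ne'

theorem contDiff_integral {f : ℝ → ℝ} (hf : ContDiff ℝ ∞ f) :
    ContDiff ℝ ∞ fun z => ∫ t in (0 : ℝ)..z, f t := by
  have hd : ∀ z, HasDerivAt (fun z => ∫ t in (0 : ℝ)..z, f t) (f z) z := fun z =>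
    (hf.continuous.integral_hasStrictDerivAt 0 z).hasDerivAt
  rw [contDiff_infty_iff_deriv]
  refine ⟨fun z => (hd z).differentiableAt, ?_⟩
  rwa [show deriv (fun z => ∫ t in (0 : ℝ)..z, f t) = f from funext fun z => (hd z).deriv]

theorem contDiff_sechIntegral {g : ℝ → ℝ} (hg : ContDiff ℝ ∞ g) :
    ContDiff ℝ ∞ (sechIntegral g) :=
  ((Real.contDiff_cosh.pow 2).inv fun z => pow_ne_zero 2 (Real.cosh_pos z).ne').mul
    (contDiff_integral ((Real.contDiff_cosh.pow 2).mul hg))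

/-- For `|t| ≤ |z|` one has `cosh² t ≤ cosh z cosh t`; integrating gives at most `cosh z |sinh z| ≤
cosh² z`. Polynomial growth passes through with the same degree and constant. -/
theorem abs_sechIntegral_le {g : ℝ → ℝ} {M : ℝ} {k : ℕ}
    (hM : ∀ z, |g z| ≤ M * (1 + |z|) ^ k) (z : ℝ) :
    |sechIntegral g z| ≤ M * (1 + |z|) ^ k := by
  have hc : 0 < Real.cosh z := Real.cosh_pos z
  have hM0 : 0 ≤ M := by simpa using (abs_nonneg _).trans (hM 0)
  have h1 : |∫ t in (0 : ℝ)..z, Real.cosh t ^ 2 * g t|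
      ≤ |∫ t in (0 : ℝ)..z, Real.cosh z * (M * (1 + |z|) ^ k) * Real.cosh t| := by
    rw [← Real.norm_eq_abs]
    refine intervalIntegral.norm_integral_le_abs_of_norm_le ?_
      (Continuous.intervalIntegrable (by fun_prop) _ _)
    refine (ae_restrict_iff' measurableSet_uIoc).2 (ae_of_all _ fun t ht => ?_)
    have ht' : |t| ≤ |z| := by
      rcases Set.mem_uIoc.1 ht with h | h
      · rw [abs_of_pos h.1, abs_of_pos (h.1.trans_le h.2)]; exact h.2
      · rw [abs_of_nonpos h.2, abs_of_neg (h.1.trans_le h.2)]; linarith [h.1]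
    have hct : 0 < Real.cosh t := Real.cosh_pos t
    rw [Real.norm_eq_abs, abs_mul, abs_of_pos (by positivity : 0 < Real.cosh t ^ 2)]
    calc Real.cosh t ^ 2 * |g t| = Real.cosh t * |g t| * Real.cosh t := by ring
      _ ≤ Real.cosh z * (M * (1 + |z|) ^ k) * Real.cosh t := by
        gcongr
        · exact Real.cosh_le_cosh.2 ht'
        · refine (hM t).trans ?_
          gcongr
  have h2 : ∫ t in (0 : ℝ)..z, Real.cosh t = Real.sinh z := by
    rw [intervalIntegral.integral_eq_sub_of_hasDerivAt (fun t _ => Real.hasDerivAt_sinh t)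
      (Real.continuous_cosh.intervalIntegrable _ _)]
    simp
  rw [intervalIntegral.integral_const_mul, h2, abs_mul,
    abs_of_nonneg (by positivity : 0 ≤ Real.cosh z * (M * (1 + |z|) ^ k))] at h1
  have h3 : |Real.sinh z| ≤ Real.cosh z := by
    refine abs_le_of_sq_le_sq ?_ hc.le
    rw [Real.cosh_sq]; linarith
  rw [sechIntegral, abs_mul, abs_of_pos (by positivity), inv_mul_le_iff₀ (by positivity)]
  refine h1.trans ?_
  calc Real.cosh z * (M * (1 + |z|) ^ k) * |Real.sinh z|
      ≤ Real.cosh z * (M * (1 + |z|) ^ k) * Real.cosh z := by gcongr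
    _ = _ := by ring

/-- The part of the second moment `⟨s²⟩` that does not involve `⟨s⟩`, at order `T⁻ʲ`. -/
noncomputable def riccatiConst (j : ℕ) (z : ℝ) : ℝ :=
  (if j = 0 then 1 else 0) + (wellCoeff j).1 1 z 0

/-- The coefficient of `⟨s⟩` in the second moment `⟨s²⟩`, at order `T⁻ʲ`. -/
noncomputable def riccatiLinear (j : ℕ) (z : ℝ) : ℝ :=
  (wellCoeff j).1 1 z 1 - (wellCoeff j).1 1 z 0

theorem riccatiConst_zero (z : ℝ) : riccatiConst 0 z = 1 := by
  simp [riccatiConst, wellCoeff]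

theorem riccatiLinear_zero (z : ℝ) : riccatiLinear 0 z = 0 := by
  simp [riccatiLinear, wellCoeff]

theorem contDiff_riccatiConst (j : ℕ) : ContDiff ℝ ∞ (riccatiConst j) :=
  contDiff_const.add ((isWellTerm_wellCoeff j 1).1.contDiff 0)

theorem contDiff_riccatiLinear (j : ℕ) : ContDiff ℝ ∞ (riccatiLinear j) :=
  ((isWellTerm_wellCoeff j 1).1.contDiff 1).sub ((isWellTerm_wellCoeff j 1).1.contDiff 0)

theorem exists_abs_riccatiConst_le (j : ℕ) :
    ∃ M : ℝ, 0 ≤ M ∧ ∀ z, |riccatiConst j z| ≤ M * (1 + |z|) ^ j := by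
  obtain ⟨K, hK0, hK⟩ := (isWellTerm_wellCoeff j 1).1.growth
  refine ⟨1 + K, by positivity, fun z => ?_⟩
  have h1 : |(if j = 0 then 1 else 0 : ℝ)| ≤ 1 * (1 + |z|) ^ j := by
    have : (1 : ℝ) ≤ (1 + |z|) ^ j := one_le_pow₀ (by linarith [abs_nonneg z])
    split_ifs
    · simpa using this
    · simp; positivity
  have h2 := hK z 0
  rw [abs_zero, add_zero, mul_one] at h2
  rw [add_mul]
  exact (abs_add_le _ _).trans (add_le_add h1 h2)

theorem exists_abs_riccatiLinear_le (j : ℕ) :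
    ∃ M : ℝ, 0 ≤ M ∧ ∀ z, |riccatiLinear j z| ≤ M * (1 + |z|) ^ j := by
  obtain ⟨K, hK0, hK⟩ := (isWellTerm_wellCoeff j 1).1.growth
  refine ⟨3 * K, by positivity, fun z => ?_⟩
  have h1 := hK z 1
  have h2 := hK z 0
  rw [abs_one] at h1
  rw [abs_zero] at h2
  refine (abs_sub _ _).trans ((add_le_add h1 h2).trans (le_of_eq ?_))
  ring

/-- The inner coefficients `q_k`, up to the factor `φ''(0)`: the perturbation series of the
Riccati equation for the mean position in the double well. -/
noncomputable def innerCoeff : ℕ → ℝ → ℝ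
  | 0 => fun z => -Real.tanh z
  | k + 1 => sechIntegral fun t =>
      ∑ i : Fin k, innerCoeff (i + 1) t * innerCoeff (k - i) t
        - ∑ i : Fin (k + 1), riccatiLinear (i + 1) t * innerCoeff (k - i) t
        - riccatiConst (k + 1) t
  decreasing_by all_goals omega

/-- The inhomogeneity in the linear equation for `innerCoeff (k + 1)`. -/
noncomputable def innerSource (k : ℕ) (t : ℝ) : ℝ :=
  ∑ i ∈ Finset.range k, innerCoeff (i + 1) t * innerCoeff (k - i) t
    - ∑ i ∈ Finset.range (k + 1), riccatiLinear (i + 1) t * innerCoeff (k - i) t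
    - riccatiConst (k + 1) t

theorem innerCoeff_zero (z : ℝ) : innerCoeff 0 z = -Real.tanh z := by
  rw [innerCoeff]

theorem innerCoeff_succ (k : ℕ) : innerCoeff (k + 1) = sechIntegral (innerSource k) := by
  rw [innerCoeff]
  congr 1
  funext t
  rw [innerSource, Finset.sum_range, Finset.sum_range]

theorem innerCoeff_apply_zero (k : ℕ) : innerCoeff k 0 = 0 := by
  rcases k with _ | k
  · rw [innerCoeff_zero, Real.tanh_zero, neg_zero]
  · rw [innerCoeff_succ, sechIntegral_zero]

theorem contDiff_innerCoeff (k : ℕ) : ContDiff ℝ ∞ (innerCoeff k) := by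
  induction k using Nat.strong_induction_on with
  | _ k ih =>
  rcases k with _ | k
  · rw [innerCoeff]; exact contDiff_tanh.neg
  · rw [innerCoeff_succ]
    refine contDiff_sechIntegral ((ContDiff.sub (ContDiff.sum fun i hi => ?_)
      (ContDiff.sum fun i hi => ?_)).sub (contDiff_riccatiConst _))
    · have := Finset.mem_range.1 hi
      exact (ih (i + 1) (by omega)).mul (ih (k - i) (by omega))
    · exact (contDiff_riccatiLinear _).mul (ih (k - i) (by omega))

theorem contDiff_innerSource (k : ℕ) : ContDiff ℝ ∞ (innerSource k) :=
  ((ContDiff.sum fun _ _ => (contDiff_innerCoeff _).mul (contDiff_innerCoeff _)).sub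
    (ContDiff.sum fun _ _ => (contDiff_riccatiLinear _).mul (contDiff_innerCoeff _))).sub
    (contDiff_riccatiConst _)

theorem exists_abs_sum_mul_le {ι : Type*} (s : Finset ι) (f g : ι → ℝ → ℝ) (d e : ι → ℕ) (n : ℕ)
    (hde : ∀ i ∈ s, d i + e i = n)
    (hf : ∀ i ∈ s, ∃ M : ℝ, 0 ≤ M ∧ ∀ z, |f i z| ≤ M * (1 + |z|) ^ d i)
    (hg : ∀ i ∈ s, ∃ M : ℝ, 0 ≤ M ∧ ∀ z, |g i z| ≤ M * (1 + |z|) ^ e i) :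
    ∃ M : ℝ, 0 ≤ M ∧ ∀ z, |∑ i ∈ s, f i z * g i z| ≤ M * (1 + |z|) ^ n := by
  classical
  induction s using Finset.induction_on with
  | empty => exact ⟨0, le_rfl, by simp⟩
  | insert a s ha ih =>
    obtain ⟨M, hM0, hM⟩ := ih (fun i hi => hde i (by simp [hi])) (fun i hi => hf i (by simp [hi]))
      (fun i hi => hg i (by simp [hi]))
    obtain ⟨A, hA0, hA⟩ := hf a (by simp)
    obtain ⟨B, hB0, hB⟩ := hg a (by simp)
    refine ⟨A * B + M, by positivity, fun z => ?_⟩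
    rw [Finset.sum_insert ha, add_mul]
    refine (abs_add_le _ _).trans (add_le_add ?_ (hM z))
    rw [abs_mul, ← hde a (by simp), pow_add]
    calc |f a z| * |g a z| ≤ A * (1 + |z|) ^ d a * (B * (1 + |z|) ^ e a) := by
          gcongr
          · exact hA z
          · exact hB z
      _ = _ := by ring

/-- The indices in every product of the source add up to `k + 1`, so the growth degrees do too. -/
theorem exists_abs_innerCoeff_le (k : ℕ) :
    ∃ M : ℝ, 0 ≤ M ∧ ∀ z, |innerCoeff k z| ≤ M * (1 + |z|) ^ k := by
  induction k using Nat.strong_induction_on with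
  | _ k ih =>
  rcases k with _ | k
  · refine ⟨1, zero_le_one, fun z => ?_⟩
    rw [innerCoeff_zero, abs_neg, pow_zero, mul_one]
    exact (Real.abs_tanh_lt_one z).le
  · obtain ⟨A, hA0, hA⟩ := exists_abs_sum_mul_le (Finset.range k) (fun i => innerCoeff (i + 1))
      (fun i => innerCoeff (k - i)) (fun i => i + 1) (fun i => k - i) (k + 1)
      (fun i hi => by have := Finset.mem_range.1 hi; omega)
      (fun i hi => ih _ (by have := Finset.mem_range.1 hi; omega)) (fun i hi => ih _ (by omega))
    obtain ⟨B, hB0, hB⟩ := exists_abs_sum_mul_le (Finset.range (k + 1))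
      (fun i => riccatiLinear (i + 1)) (fun i => innerCoeff (k - i)) (fun i => i + 1)
      (fun i => k - i) (k + 1) (fun i hi => by have := Finset.mem_range.1 hi; omega)
      (fun i hi => exists_abs_riccatiLinear_le _) (fun i hi => ih _ (by omega))
    obtain ⟨C, hC0, hC⟩ := exists_abs_riccatiConst_le (k + 1)
    refine ⟨A + B + C, by positivity, fun z => ?_⟩
    rw [innerCoeff_succ]
    refine abs_sechIntegral_le (fun t => ?_) z
    rw [add_mul, add_mul]
    exact (abs_sub _ _).trans (add_le_add ((abs_sub _ _).trans (add_le_add (hA t) (hB t))) (hC t))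

/-- The Riccati equation, order by order. -/
theorem hasDerivAt_innerCoeff (k : ℕ) (z : ℝ) :
    HasDerivAt (innerCoeff k)
      (∑ p ∈ Finset.HasAntidiagonal.antidiagonal k, innerCoeff p.1 z * innerCoeff p.2 z
        - ∑ p ∈ Finset.HasAntidiagonal.antidiagonal k, riccatiLinear p.1 z * innerCoeff p.2 z
        - riccatiConst k z) z := by
  rcases k with _ | k
  · have hc : Real.cosh z ≠ 0 := (Real.cosh_pos z).ne'
    have h : HasDerivAt (fun z => -(Real.sinh z / Real.cosh z)) _ z :=
      ((Real.hasDerivAt_sinh z).fun_div (Real.hasDerivAt_cosh z) hc).fun_neg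
    have h0 : innerCoeff 0 = fun z => -(Real.sinh z / Real.cosh z) := by
      funext t; rw [innerCoeff_zero, Real.tanh_eq_sinh_div_cosh]
    rw [h0]
    refine h.congr_deriv ?_
    simp only [Finset.HasAntidiagonal.antidiagonal_zero, Finset.sum_singleton, riccatiLinear_zero,
      riccatiConst_zero, innerCoeff_zero, Real.tanh_eq_sinh_div_cosh]
    field_simp
    ring
  · have h := hasDerivAt_sechIntegral (contDiff_innerSource k).continuous z
    rw [← innerCoeff_succ] at h
    refine h.congr_deriv ?_
    -- The two end terms of the quadratic sum form `-2 tanh z` times the unknown; `riccatiLinear 0 =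
    -- 0` keeps the unknown out of the linear sum.
    rw [Finset.Nat.sum_antidiagonal_eq_sum_range_succ
        (fun i j => innerCoeff i z * innerCoeff j z),
      Finset.Nat.sum_antidiagonal_eq_sum_range_succ
        (fun i j => riccatiLinear i z * innerCoeff j z),
      Finset.sum_range_succ', Finset.sum_range_succ, Finset.sum_range_succ' _ (k + 1),
      riccatiLinear_zero, innerSource, Nat.sub_self, Nat.sub_zero, innerCoeff_zero]
    simp only [Nat.add_sub_add_right]
    ring

end InnerCoefficients

/-! ### Uniform error bound for the inner expansion. -/

section InnerExpansion

open MeasureTheory Polynomial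

theorem wellPotential_lower_bound (z₀ : ℝ) {T : ℝ} (hT : 0 < T) :
    ∃ K : ℝ, ∀ z : ℝ, |z - z₀| < 1 → ∀ s : ℝ, 1 * s ^ 2 - K ≤
      (C (T / 8) * (X ^ 2 - 1) ^ 2 : ℝ[X]).eval s + z * (X : ℝ[X]).eval s := by
  obtain ⟨K, hK⟩ := exists_quartic_lower_bound (a := T / 8) (by linarith) (|T / 4| + |z₀| + 1)
  refine ⟨K, fun z hz s => ?_⟩
  have h1 : |z| ≤ |T / 4| + |z₀| + 1 := by
    have : |z| ≤ |z - z₀| + |z₀| := by simpa using abs_add_le (z - z₀) z₀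
    linarith [abs_nonneg (T / 4)]
  have := hK 0 (-(T / 4)) z (by simp; positivity) (by rw [abs_neg]; linarith [abs_nonneg z₀]) h1 s
  simp only [eval_mul, eval_sub, eval_pow, eval_X, eval_C, eval_one]
  nlinarith

theorem hasDerivAt_wellPartition (z : ℝ) {T : ℝ} (hT : 0 < T) :
    HasDerivAt (fun z => ∫ s : ℝ, Real.exp (-(wellPotential z T).eval s))
      (-∫ s : ℝ, s * Real.exp (-(wellPotential z T).eval s)) z := by
  obtain ⟨K, hK⟩ := wellPotential_lower_bound z hT
  simpa [wellPotential] using hasDerivAt_integral_eval_mul_exp_neg one_pos one_pos hK 1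

/-- The Riccati equation for the mean position. -/
theorem hasDerivAt_wellMean (z : ℝ) {T : ℝ} (hT : 0 < T) :
    HasDerivAt (fun z => wellMean z T)
      (wellMean z T ^ 2 - gibbsMean (isConfining_wellPotential z hT) (X ^ 2)) z := by
  obtain ⟨K, hK⟩ := wellPotential_lower_bound z hT
  have h1 : HasDerivAt (fun z => ∫ s : ℝ, s * Real.exp (-(wellPotential z T).eval s))
      (-∫ s : ℝ, s ^ 2 * Real.exp (-(wellPotential z T).eval s)) z := by
    simpa [wellPotential, ← pow_two] using
      hasDerivAt_integral_eval_mul_exp_neg one_pos one_pos hK X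
  have hZ := (isConfining_wellPotential z hT).partition_pos.ne'
  refine (h1.fun_div (hasDerivAt_wellPartition z hT) hZ).congr_deriv ?_
  rw [gibbsMean_apply, wellMean]
  simp only [eval_pow, eval_X]
  field_simp
  ring

theorem wellMean_zero (T : ℝ) : wellMean 0 T = 0 := by
  have h : ∫ s : ℝ, s * Real.exp (-(wellPotential 0 T).eval s) = 0 := by
    have h1 := integral_neg_eq_self (fun s : ℝ => s * Real.exp (-(wellPotential 0 T).eval s)) volume
    have h2 : ∀ s : ℝ, -s * Real.exp (-(wellPotential 0 T).eval (-s))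
        = -(s * Real.exp (-(wellPotential 0 T).eval s)) := by
      intro s
      rw [eval_wellPotential, eval_wellPotential, neg_sq]; simp
    simp only [h2, integral_neg] at h1
    linarith
  rw [wellMean, h, zero_div]

/-- The derivative is minus the variance. With the value `0` at the origin this fixes the sign of
the mean on each half-line, a sign that stabilises the error equation. -/
theorem antitone_wellMean {T : ℝ} (hT : 0 < T) : Antitone fun z => wellMean z T := by
  refine antitone_of_deriv_nonpos (fun z => (hasDerivAt_wellMean z hT).differentiableAt)
    fun z => ?_
  rw [(hasDerivAt_wellMean z hT).deriv]
  have hQ := isConfining_wellPotential z hT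
  have h := gibbsMean_mono hQ (p := C (2 * wellMean z T) * X) (q := X ^ 2 + C (wellMean z T ^ 2))
    fun s => by
      simp only [eval_mul, eval_add, eval_pow, eval_X, eval_C]
      nlinarith [sq_nonneg (s - wellMean z T)]
  rw [map_add, gibbsMean_C_mul, gibbsMean_C, gibbsMean_wellPotential_X z hT] at h
  nlinarith

theorem exists_abs_secondMoment_sub_le (N : ℕ) : ∃ K : ℝ, 0 ≤ K ∧
    ∀ (z T : ℝ) (hT : 0 < T), 1 ≤ T → |z| ≤ T →
    |gibbsMean (isConfining_wellPotential z hT) (X ^ 2)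
        - (∑ j ∈ Finset.range (N + 1), T⁻¹ ^ j * riccatiConst j z
          + wellMean z T * ∑ j ∈ Finset.range (N + 1), T⁻¹ ^ j * riccatiLinear j z)|
        ≤ K * ((1 + |z|) / T) ^ (N + 1) := by
  obtain ⟨K, hK0, hK⟩ := exists_abs_wellMoment_sub_le (N + 1) 1
  refine ⟨K, hK0, fun z T hT hT1 hz => ?_⟩
  refine le_trans (le_of_eq ?_) (hK z T hT hT1 hz).1
  rw [pow_one, map_sub, gibbsMean_one, sub_sub]
  congr 2
  have h : ∀ j, T⁻¹ ^ j * (wellCoeff j).1 1 z (wellMean z T)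
      = T⁻¹ ^ j * riccatiConst j z - (if j = 0 then 1 else 0)
        + wellMean z T * (T⁻¹ ^ j * riccatiLinear j z) := by
    intro j
    rw [(isWellTerm_wellCoeff j 1).1.affine z (wellMean z T), riccatiConst, riccatiLinear]
    rcases j with _ | j
    · simp
    · simp; ring
  simp only [h]
  rw [Finset.sum_add_distrib, Finset.sum_sub_distrib, ← Finset.mul_sum]
  simp
  ring

/-- Truncating a Cauchy product of two power series costs one power of the parameter. -/
theorem abs_sum_mul_sum_sub_le {a b : ℕ → ℝ} {A B w x : ℝ} (n : ℕ) (hx : 0 ≤ x)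
    (hw : 0 ≤ w) (hxw : x * w ≤ 1) (ha : ∀ i < n, |a i| ≤ A * w ^ i)
    (hb : ∀ i < n, |b i| ≤ B * w ^ i) (hA : 0 ≤ A) (hB : 0 ≤ B) :
    |(∑ i ∈ Finset.range n, x ^ i * a i) * (∑ i ∈ Finset.range n, x ^ i * b i)
      - ∑ k ∈ Finset.range n, x ^ k *
        ∑ p ∈ Finset.HasAntidiagonal.antidiagonal k, a p.1 * b p.2|
      ≤ n ^ 2 * (A * B) * (x * w) ^ n := by
  set f : ℕ × ℕ → ℝ := fun p => x ^ (p.1 + p.2) * (a p.1 * b p.2) with hf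
  have h1 : (∑ i ∈ Finset.range n, x ^ i * a i) * (∑ i ∈ Finset.range n, x ^ i * b i)
      = ∑ p ∈ Finset.range n ×ˢ Finset.range n, f p := by
    rw [Finset.sum_mul_sum, Finset.sum_product]
    refine Finset.sum_congr rfl fun i _ => Finset.sum_congr rfl fun j _ => ?_
    simp only [hf]
    rw [pow_add]; ring
  have h2 : ∑ k ∈ Finset.range n, x ^ k *
      ∑ p ∈ Finset.HasAntidiagonal.antidiagonal k, a p.1 * b p.2
      = ∑ p ∈ Finset.range n ×ˢ Finset.range n, if p.1 + p.2 < n then f p else 0 := by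
    have h3 : ∀ k ∈ Finset.range n, x ^ k *
        ∑ p ∈ Finset.HasAntidiagonal.antidiagonal k, a p.1 * b p.2
        = ∑ p ∈ Finset.range n ×ˢ Finset.range n, if p.1 + p.2 = k then f p else 0 := by
      intro k hk
      rw [← Finset.sum_filter, Finset.mul_sum]
      have h4 : Finset.filter (fun p : ℕ × ℕ => p.1 + p.2 = k)
          (Finset.range n ×ˢ Finset.range n) = Finset.HasAntidiagonal.antidiagonal k := by
        ext p
        simp only [Finset.mem_filter, Finset.mem_product, Finset.mem_range,
          Finset.HasAntidiagonal.mem_antidiagonal] at hk ⊢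
        omega
      rw [h4]
      refine Finset.sum_congr rfl fun p hp => ?_
      simp only [hf, Finset.HasAntidiagonal.mem_antidiagonal.1 hp]
    rw [Finset.sum_congr rfl h3, Finset.sum_comm]
    refine Finset.sum_congr rfl fun p _ => ?_
    simp [Finset.mem_range]
  rw [h1, h2, ← Finset.sum_sub_distrib]
  refine (Finset.abs_sum_le_sum_abs _ _).trans ?_
  have h5 : ∀ p ∈ Finset.range n ×ˢ Finset.range n,
      |f p - if p.1 + p.2 < n then f p else 0| ≤ A * B * (x * w) ^ n := by
    intro p hp
    obtain ⟨hp1, hp2⟩ := Finset.mem_product.1 hp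
    split_ifs with h
    · rw [sub_self, abs_zero]; positivity
    · rw [sub_zero]
      simp only [hf]
      rw [abs_mul, abs_mul, abs_of_nonneg (by positivity)]
      calc x ^ (p.1 + p.2) * (|a p.1| * |b p.2|)
          ≤ x ^ (p.1 + p.2) * (A * w ^ p.1 * (B * w ^ p.2)) := by
            gcongr
            · exact ha _ (Finset.mem_range.1 hp1)
            · exact hb _ (Finset.mem_range.1 hp2)
        _ = A * B * (x * w) ^ (p.1 + p.2) := by rw [mul_pow, pow_add, pow_add]; ring
        _ ≤ A * B * (x * w) ^ n := by
            gcongr A * B * ?_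
            exact pow_le_pow_of_le_one (by positivity) hxw (by omega)
  refine (Finset.sum_le_sum h5).trans (le_of_eq ?_)
  rw [Finset.sum_const, Finset.card_product, Finset.card_range, nsmul_eq_mul]
  push_cast
  ring

/-- States that `B z = 2 (2 - exp (-z))` satisfies `B' > (1/4 - tanh z) B + 1` on `z ≥ 0`. Near the
origin, where `tanh` does not yet damp, the growth of `B` provides the room; `B` stays below `4`. -/
theorem riccati_barrier {z : ℝ} :
    1 < 2 * Real.exp (-z) - (1 / 4 - Real.tanh z) * (2 * (2 - Real.exp (-z))) ∨ z < 0 := by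
  rcases lt_or_ge z 0 with hz | hz
  · exact Or.inr hz
  left
  have ht : Real.tanh z = (1 - Real.exp (-z) ^ 2) / (1 + Real.exp (-z) ^ 2) := by
    rw [Real.tanh_eq_sinh_div_cosh, Real.sinh_eq, Real.cosh_eq]
    have h : Real.exp z * Real.exp (-z) = 1 := by rw [← Real.exp_add]; simp
    have h1 := Real.exp_pos z
    have h2 := Real.exp_pos (-z)
    rw [div_div_div_cancel_right₀ two_ne_zero, div_eq_div_iff (by positivity) (by positivity)]
    linear_combination (2 * Real.exp (-z)) * h
  have hx0 := Real.exp_pos (-z)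
  have hx1 : Real.exp (-z) ≤ 1 := Real.exp_le_one_iff.2 (by linarith)
  rw [ht]
  set x := Real.exp (-z)
  have key : 2 * x - (1 / 4 - (1 - x ^ 2) / (1 + x ^ 2)) * (2 * (2 - x)) - 1
      = 2 * (9 / 4 * x * (x - 2 / 3) ^ 2 + (1 - 3 / 4 * x)) / (1 + x ^ 2) := by
    field_simp
    ring
  have : 0 < 2 * (9 / 4 * x * (x - 2 / 3) ^ 2 + (1 - 3 / 4 * x)) / (1 + x ^ 2) := by
    have : 0 < 1 - 3 / 4 * x := by linarith
    positivity
  linarith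

/-- Comparison with `R` times the barrier. The upper bound on `a` suffices because at a contact
point `e` equals the barrier and is positive. The result does not depend on `Z`. -/
theorem le_of_linear_ode {e a r : ℝ → ℝ} {Z R : ℝ} (hR : 0 < R)
    (he : ∀ z ∈ Set.Icc 0 Z, HasDerivAt e (a z * e z + r z) z) (h0 : e 0 = 0)
    (ha : ∀ z ∈ Set.Icc 0 Z, a z ≤ 1 / 4 - Real.tanh z) (hr : ∀ z ∈ Set.Icc 0 Z, |r z| ≤ R)
    {z : ℝ} (hz : z ∈ Set.Icc 0 Z) : e z ≤ 4 * R := by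
  have hB : ∀ z, HasDerivAt (fun z => R * (2 * (2 - Real.exp (-z)))) (R * (2 * Real.exp (-z))) z := by
    intro z
    have := (((((hasDerivAt_id z).fun_neg).exp).const_sub 2).const_mul 2).const_mul R
    refine this.congr_deriv ?_
    simp
  have h := image_le_of_deriv_right_lt_deriv_boundary (a := 0) (b := Z) (f := e)
    (fun z hz => (he z hz).continuousAt.continuousWithinAt)
    (fun z hz => (he z (Set.Ico_subset_Icc_self hz)).hasDerivWithinAt)
    (by rw [h0]; norm_num; exact hR.le) hB (fun z hz hez => ?_) hz
  · refine h.trans ?_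
    nlinarith [Real.exp_pos (-z)]
  · have hz' := Set.Ico_subset_Icc_self hz
    have hx1 : Real.exp (-z) ≤ 1 := Real.exp_le_one_iff.2 (by linarith [hz.1])
    have hb := (riccati_barrier (z := z)).resolve_right (by linarith [hz.1])
    have h1 : a z * e z ≤ (1 / 4 - Real.tanh z) * e z := by
      refine mul_le_mul_of_nonneg_right (ha z hz') ?_
      rw [hez]
      have : 0 ≤ 2 - Real.exp (-z) := by linarith
      positivity
    have h2 := (abs_le.1 (hr z hz')).2
    have h3 : (1 / 4 - Real.tanh z) * e z
        = R * ((1 / 4 - Real.tanh z) * (2 * (2 - Real.exp (-z)))) := by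
      rw [hez]; ring
    nlinarith

theorem abs_le_of_linear_ode {e a r : ℝ → ℝ} {Z R : ℝ} (hR : 0 < R)
    (he : ∀ z ∈ Set.Icc 0 Z, HasDerivAt e (a z * e z + r z) z) (h0 : e 0 = 0)
    (ha : ∀ z ∈ Set.Icc 0 Z, a z ≤ 1 / 4 - Real.tanh z) (hr : ∀ z ∈ Set.Icc 0 Z, |r z| ≤ R)
    {z : ℝ} (hz : z ∈ Set.Icc 0 Z) : |e z| ≤ 4 * R := by
  refine abs_le.2 ⟨?_, le_of_linear_ode hR he h0 ha hr hz⟩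
  have := le_of_linear_ode (e := fun z => -e z) (a := a) (r := fun z => -r z) hR
    (fun z hz => (he z hz).fun_neg.congr_deriv (by ring)) (by simp [h0]) ha
    (fun z hz => by rw [abs_neg]; exact hr z hz) hz
  linarith

theorem exists_uniform_bound {f : ℕ → ℝ → ℝ}
    (hf : ∀ k, ∃ M : ℝ, 0 ≤ M ∧ ∀ z, |f k z| ≤ M * (1 + |z|) ^ k) (n : ℕ) :
    ∃ M : ℝ, 0 ≤ M ∧ ∀ k < n, ∀ z, |f k z| ≤ M * (1 + |z|) ^ k := by
  choose M hM0 hM using hf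
  refine ⟨∑ k ∈ Finset.range n, M k, Finset.sum_nonneg fun k _ => hM0 k, fun k hk z => ?_⟩
  refine (hM k z).trans ?_
  gcongr
  exact Finset.single_le_sum (f := M) (fun k _ => hM0 k) (Finset.mem_range.2 hk)

theorem abs_sum_range_succ_sub_le {a : ℕ → ℝ} {A w x : ℝ} (n : ℕ) (hx : 0 ≤ x)
    (hw : 0 ≤ w) (hxw : x * w ≤ 1) (hA : 0 ≤ A) (ha : ∀ i < n + 1, |a i| ≤ A * w ^ i) :
    |∑ i ∈ Finset.range (n + 1), x ^ i * a i - a 0| ≤ n * A * (x * w) := by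
  rw [Finset.sum_range_succ', pow_zero, one_mul, add_sub_cancel_right]
  refine (Finset.abs_sum_le_sum_abs _ _).trans ?_
  have h : ∀ i ∈ Finset.range n, |x ^ (i + 1) * a (i + 1)| ≤ A * (x * w) := by
    intro i hi
    rw [abs_mul, abs_of_nonneg (by positivity)]
    calc x ^ (i + 1) * |a (i + 1)| ≤ x ^ (i + 1) * (A * w ^ (i + 1)) := by
          gcongr
          exact ha _ (by have := Finset.mem_range.1 hi; omega)
      _ = A * ((x * w) * (x * w) ^ i) := by ring
      _ ≤ A * ((x * w) * 1) := by
          gcongr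
          exact pow_le_one₀ (by positivity) hxw
      _ = _ := by ring
  refine (Finset.sum_le_sum h).trans (le_of_eq ?_)
  rw [Finset.sum_const, Finset.card_range, nsmul_eq_mul]; ring

/-- The partial sums of the inner expansion. -/
noncomputable def innerSum (N : ℕ) (z T : ℝ) : ℝ :=
  ∑ k ∈ Finset.range (N + 1), T⁻¹ ^ k * innerCoeff k z

theorem hasDerivAt_innerSum (N : ℕ) (z T : ℝ) :
    HasDerivAt (fun z => innerSum N z T)
      (∑ k ∈ Finset.range (N + 1), T⁻¹ ^ k *
        (∑ p ∈ Finset.HasAntidiagonal.antidiagonal k, innerCoeff p.1 z * innerCoeff p.2 z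
        - ∑ p ∈ Finset.HasAntidiagonal.antidiagonal k, riccatiLinear p.1 z * innerCoeff p.2 z
        - riccatiConst k z)) z :=
  HasDerivAt.fun_sum fun k _ => (hasDerivAt_innerCoeff k z).const_mul _

/-- The error of the inner expansion solves a linear differential equation that is stable away
from the origin. -/
theorem exists_error_equation (N : ℕ) : ∃ K δ : ℝ, 0 < K ∧ 0 < δ ∧ δ ≤ 1 ∧ ∀ T : ℝ, 0 < T →
    ∃ a r : ℝ → ℝ, ∀ z : ℝ, (1 + |z|) / T ≤ δ →
      HasDerivAt (fun z => wellMean z T - innerSum N z T)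
        (a z * (wellMean z T - innerSum N z T) + r z) z ∧
      |a z - (wellMean z T - Real.tanh z)| ≤ 1 / 4 ∧ |r z| ≤ K * ((1 + |z|) / T) ^ (N + 1) := by
  obtain ⟨K, hK0, hK⟩ := exists_abs_secondMoment_sub_le N
  obtain ⟨A, hA0, hA⟩ := exists_uniform_bound exists_abs_innerCoeff_le (N + 1)
  obtain ⟨B, hB0, hB⟩ := exists_uniform_bound exists_abs_riccatiLinear_le (N + 1)
  set L := (N : ℝ) * A + N * B with hL
  have hL0 : 0 ≤ L := by positivity
  -- The second component of the witness is small enough that the corrections of order at least one,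
  -- in the partial sum and in the linear Riccati coefficient, total at most `1/4`.
  refine ⟨K + (((N + 1 : ℕ) : ℝ) ^ 2 * (A * A) + ((N + 1 : ℕ) : ℝ) ^ 2 * (B * A)) + 1,
    min 1 (1 / (4 * (L + 1))), by positivity, by positivity, min_le_left _ _, fun T hT => ?_⟩
  set Sb := fun z => ∑ j ∈ Finset.range (N + 1), T⁻¹ ^ j * riccatiLinear j z with hSb
  set Sa := fun z => ∑ j ∈ Finset.range (N + 1), T⁻¹ ^ j * riccatiConst j z with hSa
  set Pqq := fun z => ∑ k ∈ Finset.range (N + 1), T⁻¹ ^ k *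
    ∑ p ∈ Finset.HasAntidiagonal.antidiagonal k, innerCoeff p.1 z * innerCoeff p.2 z with hPqq
  set Pbq := fun z => ∑ k ∈ Finset.range (N + 1), T⁻¹ ^ k *
    ∑ p ∈ Finset.HasAntidiagonal.antidiagonal k, riccatiLinear p.1 z * innerCoeff p.2 z with hPbq
  -- With `m` the mean and `S` the partial sum, `m² - S² = (m + S)(m - S)` and the linear term
  -- contributes `-Sb (m - S)`. The remainder collects the truncation errors of the second moment
  -- and of two Cauchy products.
  refine ⟨fun z => wellMean z T + innerSum N z T - Sb z, fun z =>
    -(gibbsMean (isConfining_wellPotential z hT) (X ^ 2) - (Sa z + wellMean z T * Sb z))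
      + ((innerSum N z T * innerSum N z T - Pqq z) - (Sb z * innerSum N z T - Pbq z)),
    fun z hz => ?_⟩
  have hρ1 : (1 + |z|) / T ≤ 1 := hz.trans (min_le_left _ _)
  have hρL : (1 + |z|) / T ≤ 1 / (4 * (L + 1)) := hz.trans (min_le_right _ _)
  have hTz : 1 + |z| ≤ T := (div_le_one hT).1 hρ1
  have hz0 := abs_nonneg z
  have hT0 : 0 ≤ T⁻¹ := (inv_pos.2 hT).le
  have hxw : T⁻¹ * (1 + |z|) = (1 + |z|) / T := inv_mul_eq_div _ _
  have hxw1 : T⁻¹ * (1 + |z|) ≤ 1 := by rw [hxw]; exact hρ1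
  have hw : 0 ≤ 1 + |z| := by positivity
  refine ⟨?_, ?_, ?_⟩
  · refine ((hasDerivAt_wellMean z hT).fun_sub (hasDerivAt_innerSum N z T)).congr_deriv ?_
    have : ∑ k ∈ Finset.range (N + 1), T⁻¹ ^ k *
        (∑ p ∈ Finset.HasAntidiagonal.antidiagonal k, innerCoeff p.1 z * innerCoeff p.2 z
        - ∑ p ∈ Finset.HasAntidiagonal.antidiagonal k, riccatiLinear p.1 z * innerCoeff p.2 z
        - riccatiConst k z) = Pqq z - Pbq z - Sa z := by
      simp only [mul_sub, Finset.sum_sub_distrib, hPqq, hPbq, hSa]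
    rw [this]
    ring
  · have h1 := abs_sum_range_succ_sub_le N hT0 hw hxw1 hA0 fun i hi => hA i hi z
    have h2 := abs_sum_range_succ_sub_le N hT0 hw hxw1 hB0 fun i hi => hB i hi z
    rw [innerCoeff_zero, hxw] at h1
    rw [riccatiLinear_zero, hxw] at h2
    have h3 : L * ((1 + |z|) / T) ≤ 1 / 4 := by
      have := mul_le_mul_of_nonneg_left hρL hL0
      refine this.trans ?_
      rw [mul_one_div, div_le_div_iff₀ (by positivity) (by norm_num)]
      linarith
    calc |wellMean z T + innerSum N z T - Sb z - (wellMean z T - Real.tanh z)|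
        = |(innerSum N z T - -Real.tanh z) - (Sb z - 0)| := by congr 1; ring
      _ ≤ N * A * ((1 + |z|) / T) + N * B * ((1 + |z|) / T) :=
        (abs_sub _ _).trans (add_le_add h1 h2)
      _ = L * ((1 + |z|) / T) := by rw [hL]; ring
      _ ≤ 1 / 4 := h3
  · have h1 := hK z T hT (by linarith) (by linarith)
    have h2 := abs_sum_mul_sum_sub_le (N + 1) hT0 hw hxw1 (fun i hi => hA i hi z)
      (fun i hi => hA i hi z) hA0 hA0
    have h3 := abs_sum_mul_sum_sub_le (N + 1) hT0 hw hxw1 (fun i hi => hB i hi z)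
      (fun i hi => hA i hi z) hB0 hA0
    rw [hxw] at h2 h3
    refine (abs_add_le _ _).trans ((add_le_add (le_of_eq (abs_neg _)) (abs_sub _ _)).trans
      ((add_le_add h1 (add_le_add h2 h3)).trans ?_))
    rw [← add_mul, ← add_mul]
    exact mul_le_mul_of_nonneg_right (by linarith) (by positivity)

/-- The error vanishes at `z = 0` by symmetry and is propagated outwards. For `z ≥ 0` the mean is
nonpositive, so the coefficient is at most `1/4 - tanh z`. The source bound increases with `|z|`, so
its value at the endpoint serves throughout. -/
theorem exists_abs_wellMean_sub_innerSum_le (N : ℕ) : ∃ K δ : ℝ, 0 < K ∧ 0 < δ ∧ δ ≤ 1 ∧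
    ∀ z T : ℝ, 0 < T → (1 + |z|) / T ≤ δ →
      |wellMean z T - innerSum N z T| ≤ K * ((1 + |z|) / T) ^ (N + 1) := by
  obtain ⟨K, δ, hK, hδ, hδ1, h⟩ := exists_error_equation N
  refine ⟨4 * K, δ, by positivity, hδ, hδ1, fun Z T hT hZ => ?_⟩
  obtain ⟨a, r, har⟩ := h T hT
  set R := K * ((1 + |Z|) / T) ^ (N + 1) with hR
  have hR0 : 0 < R := by positivity
  have he0 : wellMean 0 T - innerSum N 0 T = 0 := by
    simp [wellMean_zero, innerSum, innerCoeff_apply_zero]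
  have hsub : ∀ z ∈ Set.Icc 0 |Z|, ∀ s : ℝ, |s| = z → (1 + |s|) / T ≤ δ ∧
      K * ((1 + |s|) / T) ^ (N + 1) ≤ R := by
    rintro z hz s rfl
    have : (1 + |s|) / T ≤ (1 + |Z|) / T :=
      div_le_div_of_nonneg_right (by linarith [hz.2]) hT.le
    exact ⟨this.trans hZ, by rw [hR]; gcongr⟩
  have hanti := antitone_wellMean hT
  have hmem : |Z| ∈ Set.Icc 0 |Z| := ⟨abs_nonneg _, le_rfl⟩
  rw [mul_assoc]
  rcases le_total 0 Z with hZ0 | hZ0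
  · have := abs_le_of_linear_ode (e := fun z => wellMean z T - innerSum N z T) (a := a) (r := r)
      (Z := |Z|) hR0 (fun z hz => (har z (hsub z hz z (abs_of_nonneg hz.1)).1).1) he0
      (fun z hz => by
        have h1 := (abs_le.1 (har z (hsub z hz z (abs_of_nonneg hz.1)).1).2.1).2
        have h2 : wellMean z T ≤ wellMean 0 T := hanti hz.1
        rw [wellMean_zero] at h2
        linarith)
      (fun z hz => (har z (hsub z hz z (abs_of_nonneg hz.1)).1).2.2.trans
        (hsub z hz z (abs_of_nonneg hz.1)).2) hmem
    rwa [abs_of_nonneg hZ0] at this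
  -- The negative half-line follows from the reflection `z ↦ -z`, which changes the signs of `a` and
  -- `r`.
  · have habs : ∀ z ∈ Set.Icc 0 |Z|, |(-z)| = z := fun z hz => by
      rw [abs_neg, abs_of_nonneg hz.1]
    have := abs_le_of_linear_ode (e := fun z => wellMean (-z) T - innerSum N (-z) T)
      (a := fun z => -a (-z)) (r := fun z => -r (-z)) (Z := |Z|) hR0
      (fun z hz => by
        have h1 := (har (-z) (hsub z hz (-z) (habs z hz)).1).1
        exact (h1.comp z (hasDerivAt_neg z)).congr_deriv (by ring))
      (by simpa using he0)
      (fun z hz => by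
        have h1 := (abs_le.1 (har (-z) (hsub z hz (-z) (habs z hz)).1).2.1).1
        have h2 : wellMean 0 T ≤ wellMean (-z) T := hanti (by linarith [hz.1])
        rw [wellMean_zero] at h2
        rw [Real.tanh_neg] at h1
        linarith)
      (fun z hz => by
        rw [abs_neg]
        exact (har (-z) (hsub z hz (-z) (habs z hz)).1).2.2.trans
          (hsub z hz (-z) (habs z hz)).2) hmem
    simp only [abs_of_nonpos hZ0, neg_neg] at this
    exact this

end InnerExpansion

/-! ### Asymptotic expansions in powers of `1 / T`. -/

section InverseExpansion

/-- `F(T) ~ f 0 + f 1 / T + f 2 / T² + ⋯` as `T → ∞`. -/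
def HasInvExpansion (F : ℝ → ℝ) (f : ℕ → ℝ) : Prop :=
  ∀ N : ℕ, ∃ C : ℝ, ∀ᶠ T : ℝ in atTop,
    |F T - ∑ k ∈ Finset.range (N + 1), T⁻¹ ^ k * f k| ≤ C * T⁻¹ ^ (N + 1)

theorem HasInvExpansion.add {F G : ℝ → ℝ} {f g : ℕ → ℝ} (hF : HasInvExpansion F f)
    (hG : HasInvExpansion G g) : HasInvExpansion (fun T => F T + G T) fun k => f k + g k := by
  intro N
  obtain ⟨C, hC⟩ := hF N
  obtain ⟨D, hD⟩ := hG N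
  refine ⟨C + D, ?_⟩
  filter_upwards [hC, hD] with T h1 h2
  simp only [mul_add, Finset.sum_add_distrib, add_mul]
  rw [add_sub_add_comm]
  exact (abs_add_le _ _).trans (add_le_add h1 h2)

theorem HasInvExpansion.const_mul {F : ℝ → ℝ} {f : ℕ → ℝ} (hF : HasInvExpansion F f) (a : ℝ) :
    HasInvExpansion (fun T => a * F T) fun k => a * f k := by
  intro N
  obtain ⟨C, hC⟩ := hF N
  refine ⟨|a| * C, ?_⟩
  filter_upwards [hC] with T h1
  simp only [mul_left_comm _ a, ← Finset.mul_sum]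
  rw [← mul_sub, abs_mul, mul_assoc]
  exact mul_le_mul_of_nonneg_left h1 (abs_nonneg a)

theorem HasInvExpansion.inv_mul {F : ℝ → ℝ} {f : ℕ → ℝ} (hF : HasInvExpansion F f) :
    HasInvExpansion (fun T => T⁻¹ * F T) fun k => if k = 0 then 0 else f (k - 1) := by
  intro N
  obtain ⟨C, hC⟩ := hF N
  refine ⟨C + |f N|, ?_⟩
  filter_upwards [hC, eventually_ge_atTop 1] with T h1 hT
  have hT0 : 0 < T⁻¹ := inv_pos.2 (by linarith)
  have hT1 : T⁻¹ ≤ 1 := inv_le_one_of_one_le₀ hT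
  have hs : T⁻¹ * F T - ∑ k ∈ Finset.range (N + 1), T⁻¹ ^ k * (if k = 0 then 0 else f (k - 1))
      = T⁻¹ * (F T - ∑ k ∈ Finset.range (N + 1), T⁻¹ ^ k * f k) + T⁻¹ ^ (N + 1) * f N := by
    rw [Finset.sum_range_succ', Finset.sum_range_succ, mul_sub, mul_add, Finset.mul_sum]
    simp only [Nat.add_one_ne_zero, if_false, if_true, Nat.add_sub_cancel, mul_zero, add_zero,
      pow_succ']
    simp only [mul_assoc]
    ring
  rw [hs, add_mul]
  refine (abs_add_le _ _).trans (add_le_add ?_ (le_of_eq ?_))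
  · rw [abs_mul, abs_of_pos hT0]
    calc T⁻¹ * |F T - ∑ k ∈ Finset.range (N + 1), T⁻¹ ^ k * f k|
        ≤ 1 * |F T - ∑ k ∈ Finset.range (N + 1), T⁻¹ ^ k * f k| := by gcongr
      _ ≤ _ := by rw [one_mul]; exact h1
  · rw [abs_mul, abs_of_pos (by positivity)]; ring

/-- An asymptotic expansion whose derivative also has one may be differentiated termwise. -/
theorem HasInvExpansion.deriv_coeff {F F' : ℝ → ℝ} {f g : ℕ → ℝ}
    (hd : ∀ T, 0 < T → HasDerivAt F (F' T) T) (hF : HasInvExpansion F f)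
    (hF' : HasInvExpansion F' g) (k : ℕ) : g (k + 1) = -k * f k := by
  -- The defect at order `T⁻ʲ` between the expansion of `F'` and the termwise derivative of that of
  -- `F`.
  set e : ℕ → ℝ := fun j => g j + ((j : ℝ) - 1) * (if j = 0 then 0 else f (j - 1)) with he
  suffices h : ∀ j, e j = 0 by
    have := h (k + 1)
    simp only [he, Nat.add_one_ne_zero, if_false, Nat.add_sub_cancel] at this
    push_cast at this
    linarith
  intro j
  induction j using Nat.strong_induction_on with
  | _ j ih =>
  obtain ⟨C₁, hC₁⟩ := hF j
  obtain ⟨C₂, hC₂⟩ := hF' j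
  obtain ⟨T₁, hT₁⟩ := eventually_atTop.1 hC₁
  obtain ⟨T₂, hT₂⟩ := eventually_atTop.1 hC₂
  set E : ℝ → ℝ := fun T => F T - ∑ k ∈ Finset.range (j + 1), T⁻¹ ^ k * f k with hE
  set E' : ℝ → ℝ := fun T => F' T + ∑ k ∈ Finset.range (j + 1), k * T⁻¹ ^ (k + 1) * f k with hE'
  have hEd : ∀ T, 0 < T → HasDerivAt E (E' T) T := by
    intro T hT
    have h1 : HasDerivAt (fun T : ℝ => ∑ k ∈ Finset.range (j + 1), T⁻¹ ^ k * f k)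
        (∑ k ∈ Finset.range (j + 1), -(k * T⁻¹ ^ (k + 1) * f k)) T := by
      refine HasDerivAt.fun_sum fun k _ => ?_
      have := ((hasDerivAt_inv hT.ne').fun_pow k).mul_const (f k)
      refine this.congr_deriv ?_
      rcases k with _ | k
      · simp
      · rw [Nat.add_sub_cancel, ← inv_pow]
        push_cast
        ring
    refine ((hd T hT).fun_sub h1).congr_deriv ?_
    simp only [hE', Finset.sum_neg_distrib, sub_neg_eq_add]
  have hsum : ∀ T : ℝ, ∑ k ∈ Finset.range (j + 1), T⁻¹ ^ k * g k
      + ∑ k ∈ Finset.range (j + 1), k * T⁻¹ ^ (k + 1) * f k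
      = T⁻¹ ^ j * e j + j * T⁻¹ ^ (j + 1) * f j := by
    intro T
    have h1 : ∀ n : ℕ, ∑ k ∈ Finset.range (n + 1), T⁻¹ ^ k * g k
        + ∑ k ∈ Finset.range (n + 1), k * T⁻¹ ^ (k + 1) * f k
        = ∑ k ∈ Finset.range (n + 1), T⁻¹ ^ k * e k + n * T⁻¹ ^ (n + 1) * f n := by
      intro n
      induction n with
      | zero => simp [he]
      | succ n ihn =>
        rw [Finset.sum_range_succ (fun k => T⁻¹ ^ k * g k),
          Finset.sum_range_succ (fun k : ℕ => (k : ℝ) * T⁻¹ ^ (k + 1) * f k),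
          Finset.sum_range_succ (fun k => T⁻¹ ^ k * e k)]
        simp only [he, Nat.add_one_ne_zero, if_false, Nat.add_sub_cancel] at ihn ⊢
        push_cast
        linear_combination ihn
    rw [h1, Finset.sum_range_succ, Finset.sum_eq_zero, zero_add]
    intro k hk
    rw [ih k (Finset.mem_range.1 hk), mul_zero]
  have hbound : ∀ᶠ T : ℝ in atTop,
      |e j| ≤ 2 ^ j * (2 * |C₁| + |C₂| + j * |f j|) * T⁻¹ := by
    filter_upwards [eventually_ge_atTop T₁, eventually_ge_atTop T₂, eventually_ge_atTop 1]
      with T h1 h2 h3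
    have hT0 : 0 < T := by linarith
    -- The mean value theorem on `[T, 2 T]` turns smallness of the remainder at both ends into
    -- smallness of its derivative at some `θ` comparable to `T`. The lower defects vanish by
    -- induction, so `e j = O(T⁻¹)`, hence `e j = 0`.
    obtain ⟨θ, hθ, hslope⟩ := exists_hasDerivAt_eq_slope E E' (show T < 2 * T by linarith)
      (fun x hx => (hEd x (by linarith [hx.1])).continuousAt.continuousWithinAt)
      (fun x hx => hEd x (by linarith [hx.1]))
    have hθ0 : 0 < θ := by linarith [hθ.1]
    have hθT : θ⁻¹ ≤ T⁻¹ := inv_anti₀ hT0 hθ.1.le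
    have hTθ : T⁻¹ ≤ 2 * θ⁻¹ := by
      rw [← one_div, ← div_eq_mul_inv, div_le_div_iff₀ hT0 hθ0]
      linarith [hθ.2]
    have hTi : T⁻¹ ≤ 1 := inv_le_one_of_one_le₀ h3
    have hTi0 : 0 < T⁻¹ := inv_pos.2 hT0
    have hE1 : |E T| ≤ |C₁| * T⁻¹ ^ (j + 1) :=
      (hT₁ T h1).trans (by gcongr; exact le_abs_self _)
    have hE2 : |E (2 * T)| ≤ |C₁| * T⁻¹ ^ (j + 1) := by
      refine (hT₁ (2 * T) (by linarith)).trans ?_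
      gcongr
      · exact le_abs_self _
      · linarith
    have hE3 : |E' θ| ≤ 2 * |C₁| * T⁻¹ ^ (j + 1) := by
      rw [hslope, show 2 * T - T = T by ring, abs_div, abs_of_pos hT0, div_eq_mul_inv]
      calc |E (2 * T) - E T| * T⁻¹ ≤ |E (2 * T) - E T| * 1 := by gcongr
        _ ≤ |C₁| * T⁻¹ ^ (j + 1) + |C₁| * T⁻¹ ^ (j + 1) := by
          rw [mul_one]; exact (abs_sub _ _).trans (add_le_add hE2 hE1)
        _ = _ := by ring
    have hE4 : |F' θ - ∑ k ∈ Finset.range (j + 1), θ⁻¹ ^ k * g k| ≤ |C₂| * T⁻¹ ^ (j + 1) := by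
      refine (hT₂ θ (by linarith [hθ.1])).trans ?_
      gcongr
      exact le_abs_self _
    have hE5 : |j * θ⁻¹ ^ (j + 1) * f j| ≤ j * |f j| * T⁻¹ ^ (j + 1) := by
      rw [abs_mul, abs_of_nonneg (by positivity)]
      calc j * θ⁻¹ ^ (j + 1) * |f j| ≤ j * T⁻¹ ^ (j + 1) * |f j| := by gcongr
        _ = _ := by ring
    have hE6 : θ⁻¹ ^ j * e j = E' θ - (F' θ - ∑ k ∈ Finset.range (j + 1), θ⁻¹ ^ k * g k)
        - j * θ⁻¹ ^ (j + 1) * f j := by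
      simp only [hE']
      linear_combination -(hsum θ)
    have hE7 : θ⁻¹ ^ j * |e j| ≤ (2 * |C₁| + |C₂| + j * |f j|) * T⁻¹ ^ (j + 1) := by
      rw [← abs_of_pos (pow_pos (inv_pos.2 hθ0) j), ← abs_mul, hE6, add_mul, add_mul]
      exact (abs_sub _ _).trans (add_le_add ((abs_sub _ _).trans (add_le_add hE3 hE4)) hE5)
    have hE8 : T⁻¹ ^ j * |e j| ≤ T⁻¹ ^ j * (2 ^ j * (2 * |C₁| + |C₂| + j * |f j|) * T⁻¹) := by
      calc T⁻¹ ^ j * |e j| ≤ (2 * θ⁻¹) ^ j * |e j| := by gcongr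
        _ = 2 ^ j * (θ⁻¹ ^ j * |e j|) := by rw [mul_pow]; ring
        _ ≤ 2 ^ j * ((2 * |C₁| + |C₂| + j * |f j|) * T⁻¹ ^ (j + 1)) := by gcongr
        _ = _ := by rw [pow_succ]; ring
    exact le_of_mul_le_mul_left hE8 (by positivity)
  have hlim : Tendsto (fun T : ℝ => 2 ^ j * (2 * |C₁| + |C₂| + j * |f j|) * T⁻¹) atTop (nhds 0) := by
    simpa using tendsto_inv_atTop_zero.const_mul (2 ^ j * (2 * |C₁| + |C₂| + j * |f j|))
  exact abs_nonpos_iff.1 (ge_of_tendsto hlim hbound)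

end InverseExpansion

/-! ### The recurrence system from the heat equation of the partition function. -/

section Recurrence

open MeasureTheory Polynomial

theorem hasDerivAt_wellPartition_temperature (z : ℝ) {T : ℝ} (hT : 0 < T) :
    HasDerivAt (fun T => ∫ s : ℝ, Real.exp (-(wellPotential z T).eval s))
      (-∫ s : ℝ, (C (1 / 8) * (X ^ 2 - 1) ^ 2 : ℝ[X]).eval s *
        Real.exp (-(wellPotential z T).eval s)) T := by
  have hpot : ∀ T : ℝ, C z * X + C T * (C (1 / 8) * (X ^ 2 - 1) ^ 2) = wellPotential z T := by
    intro T
    rw [wellPotential, div_eq_mul_one_div T, C_mul]; ring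
  -- For `|t - T| < T / 2` the quartic coefficient `t / 8` stays above `T / 16`.
  obtain ⟨K, hK⟩ := exists_quartic_lower_bound (a := T / 16) (by linarith) (|T / 8| + |z|)
  have h := hasDerivAt_integral_eval_mul_exp_neg (A := C z * X)
    (B := C (1 / 8) * (X ^ 2 - 1) ^ 2) (t₀ := T) (b := 1) (K := K) (δ := T / 2) one_pos
    (by linarith) (fun t ht s => by
      have h1 := hK 0 (-(T / 8)) z (by simp; positivity) (by rw [abs_neg]; linarith [abs_nonneg z])
        (by linarith [abs_nonneg (T / 8)]) s
      have h2 : T / 2 ≤ t := by linarith [(abs_lt.1 ht).1]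
      have h3 := mul_le_mul_of_nonneg_right h2 (sq_nonneg (s ^ 2 - 1))
      simp only [eval_mul, eval_sub, eval_pow, eval_X, eval_C, eval_one]
      nlinarith) 1
  simpa only [hpot, eval_one, one_mul] using h

theorem continuous_wellMean {T : ℝ} (hT : 0 < T) : Continuous fun z => wellMean z T :=
  continuous_iff_continuousAt.2 fun z => (hasDerivAt_wellMean z hT).continuousAt

theorem integral_wellMean (z : ℝ) {T : ℝ} (hT : 0 < T) :
    ∫ s in (0 : ℝ)..z, wellMean s T
      = -Real.log (∫ s : ℝ, Real.exp (-(wellPotential z T).eval s))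
        + Real.log (∫ s : ℝ, Real.exp (-(wellPotential 0 T).eval s)) := by
  rw [intervalIntegral.integral_eq_sub_of_hasDerivAt (f := fun z =>
    -Real.log (∫ s : ℝ, Real.exp (-(wellPotential z T).eval s))) (fun s _ => ?_)
    ((continuous_wellMean hT).intervalIntegrable _ _)]
  · ring
  · have hZ := (isConfining_wellPotential s hT).partition_pos.ne'
    refine ((hasDerivAt_wellPartition s hT).log hZ).fun_neg.congr_deriv ?_
    rw [wellMean]; ring

/-- The heat equation for the partition function, integrated in the field. -/
theorem hasDerivAt_integral_wellMean (z : ℝ) {T : ℝ} (hT : 0 < T) :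
    HasDerivAt (fun T => ∫ s in (0 : ℝ)..z, wellMean s T)
      (-(1 / 8) * gibbsMean (isConfining_wellPotential z hT) (X ^ 2)
        + 1 / 8 * gibbsMean (isConfining_wellPotential 0 hT) (X ^ 2)
        + -(z / 4) * (T⁻¹ * wellMean z T)) T := by
  have key : ∀ z : ℝ, HasDerivAt
      (fun T => Real.log (∫ s : ℝ, Real.exp (-(wellPotential z T).eval s)))
      (1 / 8 * gibbsMean (isConfining_wellPotential z hT) (X ^ 2) - 1 / 8
        - 1 / 4 * T⁻¹ * (1 - z * wellMean z T)) T := by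
    intro z
    have hQ := isConfining_wellPotential z hT
    refine ((hasDerivAt_wellPartition_temperature z hT).log hQ.partition_pos.ne').congr_deriv ?_
    rw [neg_div, ← gibbsMean_apply hQ, gibbsMean_C_mul]
    -- The lowest even moment identity trades `⟨(s² - 1)²⟩`, which comes from the `T`-derivative,
    -- for `⟨s²⟩` and the mean.
    have h := gibbsMean_pow_add (z := z) hT 0
    simp only [pow_zero, mul_one, zero_add, pow_one, gibbsMean_one, Nat.cast_zero, mul_zero,
      zero_mul, add_zero] at h
    rw [gibbsMean_wellPotential_X z hT, map_sub, gibbsMean_one] at h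
    linear_combination (-1 / 8) * h
  have h := ((key z).fun_neg.fun_add (key 0)).congr_of_eventuallyEq
    (f₁ := fun T => ∫ s in (0 : ℝ)..z, wellMean s T) (by
      filter_upwards [lt_mem_nhds hT] with S hS
      exact integral_wellMean z hS)
  refine h.congr_deriv ?_
  ring

theorem hasInvExpansion_of_bound {F : ℝ → ℝ} {f : ℕ → ℝ} {w : ℝ}
    (h : ∀ N : ℕ, ∃ K δ : ℝ, 0 < δ ∧ ∀ T : ℝ, 0 < T → w / T ≤ δ →
      |F T - ∑ k ∈ Finset.range (N + 1), T⁻¹ ^ k * f k| ≤ K * (w / T) ^ (N + 1)) :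
    HasInvExpansion F f := by
  intro N
  obtain ⟨K, δ, hδ, hK⟩ := h N
  refine ⟨K * w ^ (N + 1), ?_⟩
  filter_upwards [eventually_gt_atTop 0, eventually_ge_atTop (w / δ)] with T hT hTw
  refine (hK T hT ?_).trans (le_of_eq ?_)
  · rw [div_le_iff₀ hT]
    rw [div_le_iff₀ hδ] at hTw
    linarith
  · rw [div_eq_mul_inv, mul_pow, mul_assoc]

theorem hasInvExpansion_wellMean (z : ℝ) :
    HasInvExpansion (fun T => wellMean z T) fun k => innerCoeff k z := by
  refine hasInvExpansion_of_bound (w := 1 + |z|) fun N => ?_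
  obtain ⟨K, δ, -, hδ, -, hK⟩ := exists_abs_wellMean_sub_innerSum_le N
  exact ⟨K, δ, hδ, fun T hT h => hK z T hT h⟩

/-- The error bound is uniform for `|s| ≤ |z|`, so the expansion of the mean may be integrated
termwise. -/
theorem hasInvExpansion_integral_wellMean (z : ℝ) :
    HasInvExpansion (fun T => ∫ s in (0 : ℝ)..z, wellMean s T)
      fun k => ∫ s in (0 : ℝ)..z, innerCoeff k s := by
  refine hasInvExpansion_of_bound (w := 1 + |z|) fun N => ?_
  obtain ⟨K, δ, hK0, hδ, -, hK⟩ := exists_abs_wellMean_sub_innerSum_le N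
  refine ⟨K * |z|, δ, hδ, fun T hT h => ?_⟩
  have hci : ∀ k, IntervalIntegrable (innerCoeff k) volume 0 z := fun k =>
    (contDiff_innerCoeff k).continuous.intervalIntegrable _ _
  have h1 : ∑ k ∈ Finset.range (N + 1), T⁻¹ ^ k * ∫ s in (0 : ℝ)..z, innerCoeff k s
      = ∫ s in (0 : ℝ)..z, innerSum N s T := by
    simp only [innerSum]
    rw [intervalIntegral.integral_finsetSum fun k _ => (hci k).const_mul _]
    simp only [intervalIntegral.integral_const_mul]
  have hcs : Continuous fun s => innerSum N s T :=
    continuous_finsetSum _ fun k _ => continuous_const.mul (contDiff_innerCoeff k).continuous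
  rw [h1, ← intervalIntegral.integral_sub ((continuous_wellMean hT).intervalIntegrable _ _)
    (hcs.intervalIntegrable _ _), ← Real.norm_eq_abs]
  refine (intervalIntegral.norm_integral_le_of_norm_le_const
    (C := K * ((1 + |z|) / T) ^ (N + 1)) fun s hs => ?_).trans (le_of_eq ?_)
  · have hs' : |s| ≤ |z| := by
      rcases Set.mem_uIoc.1 hs with h | h
      · rw [abs_of_pos h.1, abs_of_pos (h.1.trans_le h.2)]; exact h.2
      · rw [abs_of_nonpos h.2, abs_of_neg (h.1.trans_le h.2)]; linarith [h.1]
    have hsT : (1 + |s|) / T ≤ (1 + |z|) / T :=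
      div_le_div_of_nonneg_right (by linarith) hT.le
    refine (hK s T hT (hsT.trans h)).trans ?_
    gcongr
  · rw [sub_zero]; ring

/-- The coefficients of the second moment `⟨s²⟩`. -/
noncomputable def secondMomentCoeff (k : ℕ) (z : ℝ) : ℝ :=
  riccatiConst k z + ∑ p ∈ Finset.HasAntidiagonal.antidiagonal k,
    riccatiLinear p.1 z * innerCoeff p.2 z

theorem hasInvExpansion_secondMoment (z : ℝ) {F : ℝ → ℝ}
    (hF : ∀ (T : ℝ) (hT : 0 < T), F T = gibbsMean (isConfining_wellPotential z hT) (X ^ 2)) :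
    HasInvExpansion F fun k => secondMomentCoeff k z := by
  refine hasInvExpansion_of_bound (w := 1 + |z|) fun N => ?_
  obtain ⟨K, hK0, hK⟩ := exists_abs_secondMoment_sub_le N
  obtain ⟨L, δ, hL0, hδ, hδ1, hL⟩ := exists_abs_wellMean_sub_innerSum_le N
  obtain ⟨A, hA0, hA⟩ := exists_uniform_bound exists_abs_innerCoeff_le (N + 1)
  obtain ⟨B, hB0, hB⟩ := exists_uniform_bound exists_abs_riccatiLinear_le (N + 1)
  refine ⟨K + (L * (N * B) + ((N + 1 : ℕ) : ℝ) ^ 2 * (B * A)), δ, hδ, fun T hT h => ?_⟩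
  have hz0 := abs_nonneg z
  have hρ1 : (1 + |z|) / T ≤ 1 := h.trans hδ1
  have hTz : 1 + |z| ≤ T := (div_le_one hT).1 hρ1
  have hT0 : 0 ≤ T⁻¹ := (inv_pos.2 hT).le
  have hxw : T⁻¹ * (1 + |z|) = (1 + |z|) / T := inv_mul_eq_div _ _
  have hxw1 : T⁻¹ * (1 + |z|) ≤ 1 := by rw [hxw]; exact hρ1
  have hw : 0 ≤ 1 + |z| := by positivity
  have h1 := hK z T hT (by linarith) (by linarith)
  have h2 := abs_sum_mul_sum_sub_le (N + 1) hT0 hw hxw1 (fun i hi => hB i hi z)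
    (fun i hi => hA i hi z) hB0 hA0
  have h3 := abs_sum_range_succ_sub_le N hT0 hw hxw1 hB0 fun i hi => hB i hi z
  have h4 := hL z T hT h
  rw [riccatiLinear_zero, sub_zero, hxw] at h3
  have h3' : |∑ i ∈ Finset.range (N + 1), T⁻¹ ^ i * riccatiLinear i z| ≤ N * B :=
    h3.trans (mul_le_of_le_one_right (by positivity) hρ1)
  rw [hxw] at h2
  rw [hF T hT]
  have hs : ∑ k ∈ Finset.range (N + 1), T⁻¹ ^ k * secondMomentCoeff k z
      = ∑ k ∈ Finset.range (N + 1), T⁻¹ ^ k * riccatiConst k z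
        + ∑ k ∈ Finset.range (N + 1), T⁻¹ ^ k *
          ∑ p ∈ Finset.HasAntidiagonal.antidiagonal k, riccatiLinear p.1 z * innerCoeff p.2 z := by
    simp only [secondMomentCoeff, mul_add, Finset.sum_add_distrib]
  rw [hs]
  have h5 : |(wellMean z T - innerSum N z T) *
      ∑ i ∈ Finset.range (N + 1), T⁻¹ ^ i * riccatiLinear i z|
      ≤ L * ((1 + |z|) / T) ^ (N + 1) * (N * B) := by
    rw [abs_mul]
    gcongr
  rw [innerSum] at h5
  generalize gibbsMean (isConfining_wellPotential z hT) (X ^ 2) = μ at *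
  generalize ∑ k ∈ Finset.range (N + 1), T⁻¹ ^ k * riccatiConst k z = Sa at *
  generalize ∑ i ∈ Finset.range (N + 1), T⁻¹ ^ i * riccatiLinear i z = Sb at *
  generalize ∑ k ∈ Finset.range (N + 1), T⁻¹ ^ k * innerCoeff k z = Sq at *
  generalize ∑ k ∈ Finset.range (N + 1), T⁻¹ ^ k *
    ∑ p ∈ Finset.HasAntidiagonal.antidiagonal k, riccatiLinear p.1 z * innerCoeff p.2 z = P at *
  calc |μ - (Sa + P)| = |(μ - (Sa + wellMean z T * Sb)) + ((wellMean z T - Sq) * Sb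
        + (Sb * Sq - P))| := by congr 1; ring
    _ ≤ K * ((1 + |z|) / T) ^ (N + 1) + (L * ((1 + |z|) / T) ^ (N + 1) * (N * B)
        + ((N + 1 : ℕ) : ℝ) ^ 2 * (B * A) * ((1 + |z|) / T) ^ (N + 1)) :=
      (abs_add_le _ _).trans (add_le_add h1 ((abs_add_le _ _).trans (add_le_add h5 h2)))
    _ = _ := by ring

/-- Matches the coefficients of `∫₀ᶻ m` with those of its `T`-derivative, computed from the heat
equation. The unknown value at `z = 0` is independent of `z`. -/
theorem secondMomentCoeff_succ (k : ℕ) (z : ℝ) :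
    secondMomentCoeff (k + 1) z = secondMomentCoeff (k + 1) 0 - 2 * z * innerCoeff k z
      + 8 * k * ∫ s in (0 : ℝ)..z, innerCoeff k s := by
  classical
  have hd : ∀ T : ℝ, 0 < T → HasDerivAt (fun T => ∫ s in (0 : ℝ)..z, wellMean s T)
      (-(1 / 8) * (if hT : 0 < T then gibbsMean (isConfining_wellPotential z hT) (X ^ 2) else 0)
        + 1 / 8 * (if hT : 0 < T then gibbsMean (isConfining_wellPotential 0 hT) (X ^ 2) else 0)
        + -(z / 4) * (T⁻¹ * wellMean z T)) T := by
    intro T hT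
    rw [dif_pos hT, dif_pos hT]
    exact hasDerivAt_integral_wellMean z hT
  have h := HasInvExpansion.deriv_coeff hd (hasInvExpansion_integral_wellMean z)
    ((((hasInvExpansion_secondMoment z fun T hT => dif_pos hT).const_mul (-(1 / 8))).add
      ((hasInvExpansion_secondMoment 0 fun T hT => dif_pos hT).const_mul (1 / 8))).add
      ((hasInvExpansion_wellMean z).inv_mul.const_mul (-(z / 4)))) k
  simp only [Nat.add_one_ne_zero, if_false, Nat.add_sub_cancel] at h
  linear_combination (-8) * h

/-- The Riccati equation gives `q' = ∑ q q - ⟨s²⟩` at each order. Inserting the coefficient of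
`⟨s²⟩` and differentiating once removes both the constant and the integral. -/
theorem iteratedDeriv_two_innerCoeff_succ (k : ℕ) (z : ℝ) :
    iteratedDeriv 2 (innerCoeff (k + 1)) z
      - 2 * ∑ p ∈ Finset.HasAntidiagonal.antidiagonal (k + 1),
        innerCoeff p.1 z * deriv (innerCoeff p.2) z
    = (2 - 8 * (k : ℝ)) * innerCoeff k z + 2 * z * deriv (innerCoeff k) z := by
  have hdiff : ∀ k z, HasDerivAt (innerCoeff k) (deriv (innerCoeff k) z) z := fun k z =>
    ((hasDerivAt_innerCoeff k z).differentiableAt).hasDerivAt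
  have h1 : deriv (innerCoeff (k + 1)) = fun z =>
      ∑ p ∈ Finset.HasAntidiagonal.antidiagonal (k + 1), innerCoeff p.1 z * innerCoeff p.2 z
        - secondMomentCoeff (k + 1) 0 + 2 * z * innerCoeff k z
        - 8 * k * ∫ s in (0 : ℝ)..z, innerCoeff k s := by
    funext z
    rw [(hasDerivAt_innerCoeff (k + 1) z).deriv]
    have := secondMomentCoeff_succ k z
    rw [secondMomentCoeff] at this
    linear_combination -this
  have h2 : HasDerivAt (fun z =>
      ∑ p ∈ Finset.HasAntidiagonal.antidiagonal (k + 1), innerCoeff p.1 z * innerCoeff p.2 z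
        - secondMomentCoeff (k + 1) 0 + 2 * z * innerCoeff k z
        - 8 * k * ∫ s in (0 : ℝ)..z, innerCoeff k s)
      (∑ p ∈ Finset.HasAntidiagonal.antidiagonal (k + 1),
          (deriv (innerCoeff p.1) z * innerCoeff p.2 z + innerCoeff p.1 z * deriv (innerCoeff p.2) z)
        + (2 * innerCoeff k z + 2 * z * deriv (innerCoeff k) z) - 8 * k * innerCoeff k z) z := by
    have e1 : HasDerivAt (fun z => 2 * z * innerCoeff k z)
        (2 * innerCoeff k z + 2 * z * deriv (innerCoeff k) z) z := by
      have := ((hasDerivAt_id z).const_mul 2).fun_mul (hdiff k z)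
      simpa using this
    have e2 : HasDerivAt (fun z => ∫ s in (0 : ℝ)..z, innerCoeff k s) (innerCoeff k z) z :=
      ((contDiff_innerCoeff k).continuous.integral_hasStrictDerivAt 0 z).hasDerivAt
    exact (((HasDerivAt.fun_sum fun p _ => (hdiff p.1 z).fun_mul (hdiff p.2 z)).sub_const _).fun_add
      e1).fun_sub (e2.const_mul _)
  rw [iteratedDeriv_succ, iteratedDeriv_one, h1, h2.deriv, Finset.sum_add_distrib]
  have h3 : ∑ p ∈ Finset.HasAntidiagonal.antidiagonal (k + 1),
      deriv (innerCoeff p.1) z * innerCoeff p.2 z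
      = ∑ p ∈ Finset.HasAntidiagonal.antidiagonal (k + 1),
        innerCoeff p.1 z * deriv (innerCoeff p.2) z := by
    rw [← Finset.Nat.sum_antidiagonal_swap]
    exact Finset.sum_congr rfl fun p _ => mul_comm _ _
  rw [h3]
  ring

end Recurrence

/-! ### Return to the variables `ξ`, `τ`. -/

section Theorem

theorem abs_leadingTerm_sub_inner (φ : ℝ → ℝ) (N : ℕ) {ξ τ : ℝ} (hτ : 0 < τ) :
    leadingTerm φ ξ τ - √τ * (-Real.tanh (ξ * √τ / 2) / iteratedDeriv 2 φ 0
        + ∑ k ∈ Finset.Icc 1 N, τ ^ (-2 * (k : ℤ)) *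
          (innerCoeff k (ξ * √τ / 2) / iteratedDeriv 2 φ 0))
      = √τ * (iteratedDeriv 2 φ 0)⁻¹ *
        (wellMean (ξ * √τ / 2) (τ ^ 2) - innerSum N (ξ * √τ / 2) (τ ^ 2)) := by
  rw [leadingTerm_eq, gibbsMean_pearceyPotential_X_eq_wellMean ξ hτ]
  have h1 : innerSum N (ξ * √τ / 2) (τ ^ 2) = -Real.tanh (ξ * √τ / 2)
      + ∑ k ∈ Finset.Icc 1 N, τ ^ (-2 * (k : ℤ)) * innerCoeff k (ξ * √τ / 2) := by
    have h2 : ∀ k : ℕ, τ ^ (-2 * (k : ℤ)) = (τ ^ 2)⁻¹ ^ k := by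
      intro k
      rw [zpow_mul, zpow_natCast, zpow_neg]
      norm_cast
    simp only [h2]
    rw [innerSum, Finset.sum_range_succ', innerCoeff_zero, pow_zero, one_mul, add_comm,
      Finset.range_eq_Ico, Finset.sum_Ico_add' (fun k => (τ ^ 2)⁻¹ ^ k *
        innerCoeff k (ξ * √τ / 2)) 0 N 1]
    rfl
  rw [h1]
  simp only [mul_div_assoc', ← Finset.sum_div]
  ring

theorem leadingTerm_inner_expansion (φ : ℝ → ℝ) (hc : 0 < iteratedDeriv 2 φ 0) :
    ∃ q : ℕ → ℝ → ℝ,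
      (∀ z : ℝ, q 0 z = -Real.tanh z / iteratedDeriv 2 φ 0) ∧
      (∀ k : ℕ, ContDiff ℝ ∞ (q k)) ∧
      SolvesRecurrence (iteratedDeriv 2 φ 0) q ∧
      (∀ k : ℕ, 1 ≤ k → ∃ M : ℝ, ∀ z : ℝ, |q k z| ≤ M * (1 + |z| ^ k)) ∧
      ∀ γ₁ γ₂ : ℝ, 0 < γ₁ → γ₁ < γ₂ → γ₂ < 2 → ∀ N : ℕ,
        (fun p : ℝ × ℝ => leadingTerm φ p.1 p.2
            - √p.2 * (-Real.tanh (p.1 * √p.2 / 2) / iteratedDeriv 2 φ 0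
              + ∑ k ∈ Finset.Icc 1 N, p.2 ^ (-2 * (k : ℤ)) * q k (p.1 * √p.2 / 2)))
          =O[comap (fun p : ℝ × ℝ => p.2) atTop ⊓ 𝓟 (regionTwo γ₂)]
        (fun p : ℝ × ℝ => √p.2 * (p.2 ^ (-2 * ((N : ℤ) + 1))
            * (1 + |p.1 * √p.2 / 2| ^ (N + 1)))) := by
  set c := iteratedDeriv 2 φ 0 with hcdef
  have hpow : ∀ (n : ℕ) (x : ℝ), 0 ≤ x → (1 + x) ^ n ≤ 2 ^ n * (1 + x ^ n) := by
    intro n x hx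
    have h := add_pow_le zero_le_one hx n
    rw [one_pow] at h
    refine h.trans ?_
    gcongr
    · exact one_le_two
    · exact Nat.sub_le n 1
  refine ⟨fun k z => innerCoeff k z / c, fun z => by simp only [innerCoeff_zero],
    fun k => (contDiff_innerCoeff k).div_const c, fun k z => ?_, fun k _ => ?_,
    fun γ₁ γ₂ hγ1 hγ12 hγ2 N => ?_⟩
  · have h := iteratedDeriv_two_innerCoeff_succ k z
    have h1 : iteratedDeriv 2 (fun z => innerCoeff (k + 1) z / c) z
        = iteratedDeriv 2 (innerCoeff (k + 1)) z / c := by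
      rw [iteratedDeriv_succ, iteratedDeriv_one, iteratedDeriv_succ, iteratedDeriv_one,
        show deriv (fun z => innerCoeff (k + 1) z / c) = fun z => deriv (innerCoeff (k + 1)) z / c
          from funext fun z => deriv_div_const _, deriv_div_const]
    simp only [h1, deriv_div_const]
    have h2 : ∑ p ∈ Finset.HasAntidiagonal.antidiagonal (k + 1),
        innerCoeff p.1 z / c * (deriv (innerCoeff p.2) z / c)
        = (∑ p ∈ Finset.HasAntidiagonal.antidiagonal (k + 1),
          innerCoeff p.1 z * deriv (innerCoeff p.2) z) / c ^ 2 := by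
      rw [Finset.sum_div]
      exact Finset.sum_congr rfl fun p _ => by ring
    rw [h2]
    field_simp
    linear_combination h
  · obtain ⟨M, hM0, hM⟩ := exists_abs_innerCoeff_le k
    refine ⟨M * 2 ^ k / c, fun z => ?_⟩
    rw [abs_div, abs_of_pos hc, div_mul_eq_mul_div]
    gcongr
    rw [mul_assoc]
    exact (hM z).trans (mul_le_mul_of_nonneg_left (hpow k _ (abs_nonneg z)) hM0)
  · obtain ⟨K, δ, hK0, hδ, hδ1, hK⟩ := exists_abs_wellMean_sub_innerSum_le N
    refine IsBigO.of_bound (c⁻¹ * (K * 2 ^ (N + 1))) ?_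
    rw [eventually_inf_principal, eventually_comap]
    -- On `Ω₂` one has `|z| ≤ τ^γ₂`, so `(1 + |z|) / τ²` is below this sum. It tends to `0` because
    -- `γ₂ < 2`, which brings the point into the range of the uniform error bound.
    have hlim : Tendsto (fun τ : ℝ => τ ^ (-(2 : ℝ)) + τ ^ (-(2 - γ₂))) atTop (nhds 0) := by
      simpa using (tendsto_rpow_neg_atTop (show (0 : ℝ) < 2 by norm_num)).add
        (tendsto_rpow_neg_atTop (show (0 : ℝ) < 2 - γ₂ by linarith))
    filter_upwards [eventually_gt_atTop 0, hlim.eventually_le_const hδ] with τ hτ hτδ p hp hpΩ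
    obtain ⟨ξ, τ'⟩ := p
    simp only at hp
    subst hp
    simp only
    have hΩ : |ξ| * √τ' < τ' ^ γ₂ := hpΩ.2
    set z := ξ * √τ' / 2 with hz
    have hzabs : |z| ≤ τ' ^ γ₂ := by
      rw [hz, abs_div, abs_mul, abs_of_pos (two_pos (α := ℝ)), abs_of_nonneg (Real.sqrt_nonneg _)]
      have : 0 ≤ |ξ| * √τ' := by positivity
      linarith
    have hρ : (1 + |z|) / τ' ^ 2 ≤ δ := by
      refine le_trans ?_ hτδ
      rw [add_div, Real.rpow_neg hτ.le, neg_sub, Real.rpow_sub hτ, Real.rpow_two, one_div]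
      gcongr
    rw [abs_leadingTerm_sub_inner φ N hτ, Real.norm_eq_abs, Real.norm_eq_abs, abs_mul, abs_mul,
      abs_of_nonneg (Real.sqrt_nonneg _), abs_of_pos (inv_pos.2 hc),
      abs_of_nonneg (by positivity : 0 ≤ √τ' * (τ' ^ (-2 * ((N : ℤ) + 1)) * (1 + |z| ^ (N + 1))))]
    have hzp : τ' ^ (-2 * ((N : ℤ) + 1)) = ((τ' ^ 2) ^ (N + 1))⁻¹ := by
      rw [zpow_mul, zpow_neg, ← inv_pow]
      norm_cast
    rw [hzp]
    calc √τ' * c⁻¹ * |wellMean z (τ' ^ 2) - innerSum N z (τ' ^ 2)|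
        ≤ √τ' * c⁻¹ * (K * ((1 + |z|) / τ' ^ 2) ^ (N + 1)) := by
          gcongr
          exact hK z (τ' ^ 2) (by positivity) hρ
      _ = √τ' * c⁻¹ * (K * ((1 + |z|) ^ (N + 1) * ((τ' ^ 2) ^ (N + 1))⁻¹)) := by
          rw [div_pow, div_eq_mul_inv]
      _ ≤ √τ' * c⁻¹ * (K * ((2 ^ (N + 1) * (1 + |z| ^ (N + 1))) * ((τ' ^ 2) ^ (N + 1))⁻¹)) := by
          gcongr
          exact hpow _ _ (abs_nonneg z)
      _ = _ := by ring

end Theorem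

theorem theorem1 (φ : ℝ → ℝ) (hφ : ContDiff ℝ ∞ φ) (hφ'' : ∀ u : ℝ, 0 < iteratedDeriv 2 φ u) :
    (∃ P : ℕ → MvPolynomial (Fin 3) ℝ,
      (∀ l : ℕ, 1 ≤ l → IsFoldHomogeneous (P l) (1 - 4 * (l : ℤ))) ∧
      ∀ γ₁ : ℝ, 0 < γ₁ → γ₁ < 2 → ∀ N : ℕ,
        (fun p : ℝ × ℝ => leadingTerm φ p.1 p.2
            - ((iteratedDeriv 2 φ 0)⁻¹ * whitneyFold p.1 p.2
              + ∑ l ∈ Finset.Icc 1 N, foldEval (P l) p.1 p.2))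
          =O[comap (fun p : ℝ × ℝ => foldDiscr p.1 p.2) atTop ⊓ 𝓟 (regionOne γ₁)]
        (fun p : ℝ × ℝ => foldDiscr p.1 p.2 ^ ((1 - 4 * ((N : ℝ) + 1)) / 2))) ∧
    (∃ q : ℕ → ℝ → ℝ,
      (∀ z : ℝ, q 0 z = -Real.tanh z / iteratedDeriv 2 φ 0) ∧
      (∀ k : ℕ, ContDiff ℝ ∞ (q k)) ∧
      SolvesRecurrence (iteratedDeriv 2 φ 0) q ∧
      (∀ k : ℕ, 1 ≤ k → ∃ M : ℝ, ∀ z : ℝ, |q k z| ≤ M * (1 + |z| ^ k)) ∧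
      ∀ γ₁ γ₂ : ℝ, 0 < γ₁ → γ₁ < γ₂ → γ₂ < 2 → ∀ N : ℕ,
        (fun p : ℝ × ℝ => leadingTerm φ p.1 p.2
            - √p.2 * (-Real.tanh (p.1 * √p.2 / 2) / iteratedDeriv 2 φ 0
              + ∑ k ∈ Finset.Icc 1 N, p.2 ^ (-2 * (k : ℤ)) * q k (p.1 * √p.2 / 2)))
          =O[comap (fun p : ℝ × ℝ => p.2) atTop ⊓ 𝓟 (regionTwo γ₂)]
        (fun p : ℝ × ℝ => √p.2 * (p.2 ^ (-2 * ((N : ℤ) + 1))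
            * (1 + |p.1 * √p.2 / 2| ^ (N + 1))))) := by
  exact ⟨leadingTerm_outer_expansion φ, leadingTerm_inner_expansion φ (hφ'' 0)⟩
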